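/- Let $\mathbb F\in\{\mathbb R,\mathbb C,\mathbb H\}$, let $p=\dim_{\mathbb R}\mathbb F\in\{1,2,4\}$ and $n\ge 1$. Regard $\mathbb F^n$ as a right vector space over $\mathbb F$ with its standard Euclidean structure (so $\mathbb F^n\cong\mathbb R^{np}$), let $\kappa_k=\pi^{k/2}/\Gamma(\tfrac k2+1)$ denote the volume of the $k$-dimensional Euclidean unit ball, let $\operatorname{Gr}_1(n,\mathbb F)$ be the Grassmannian of $1$-dimensional $\mathbb F$-linear subspaces of $\mathbb F^n$, and let $dE$ denote integration with respect to the Haar probability measure on it, that is, the Borel probability measure invariant under the unitary group of $\mathbb F^n$ ($\mathrm O(n)$, $\mathrm U(n)$ or $\mathrm{Sp}(n)$). Let $|\cdot|$ denote Lebesgue measure, and let $P_E$ be the orthogonal projection of $\mathbb F^n$ onto $E$, so that $|P_EK|$ is the $p$-dimensional Lebesgue measure of $P_EK$ in $E$. Let $K\subset\mathbb F^n$ be a convex body (a compact convex set) with non-empty interior that is invariant under multiplication by scalars of unit length, i.e. $K\cdot a=K$ for all $a\in\mathbb F$ with $|a|=1$. Then the function $E\mapsto|P_EK|^{-n}$ is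 integrable and $$|K|^{-1}\ \ge\ \frac{(\kappa_p)^n}{\kappa_{np}}\int_{\operatorname{Gr}_1(n,\mathbb F)}|P_EK|^{-n}\,dE ,$$ with equality if and only if $K$ is an $\mathbb F$-ellipsoid (real, complex or quaternionic, respectively), i.e. the image of the Euclidean unit ball of $\mathbb F^n$ under an $\mathbb F$-affine map $\mathbb F^n\to\mathbb F^n$. -/

import Mathlib

open scoped Quaternion MulOpposite
open MeasureTheory

noncomputable section

/-- The Borel σ-algebra on the quaternions. -/
instance quaternionMeasurableSpace : MeasurableSpace ℍ := borel ℍ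

instance quaternionBorelSpace : BorelSpace ℍ := ⟨rfl⟩

namespace FLutwak

/-- `κ_k`, the volume of the `k`-dimensional Euclidean unit ball. -/
def kappa (k : ℕ) : ℝ := Real.pi ^ ((k : ℝ) / 2) / Real.Gamma ((k : ℝ) / 2 + 1)

/-- The Lebesgue measure of a finite-dimensional Euclidean space: Mathlib's canonical volume of a
real inner product space, which gives mass `1` to the parallelepiped spanned by any orthonormal
basis. (The instance is given by name because on a linear subspace the bare `volume` could also be
read as the restriction of the volume of the ambient space.) -/
def euclVol (V : Type*) [NormedAddCommGroup V] [InnerProductSpace ℝ V] [FiniteDimensional ℝ V]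
    [MeasurableSpace V] [BorelSpace V] : Measure V :=
  (measureSpaceOfInnerProductSpace : MeasureSpace V).volume

/-! In the following definitions `F` is one of `ℝ`, `ℂ`, `ℍ`. The space `F^n` is
`EuclideanSpace F (Fin n)`; it is a *right* vector space over `F`, that is, a module over the
opposite ring `Fᵐᵒᵖ`: `v · a` is `MulOpposite.op a • v`, with coordinates `v i * a`. It is also a
real inner product space, with the Euclidean inner product `∑ i, ⟪v i, w i⟫_ℝ`. -/

section

variable (F : Type) [NormedDivisionRing F] [InnerProductSpace ℝ F]

/-- `Gr_m(n, F)`: the `m`-dimensional `F`-linear subspaces of `F^n`. -/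
def Gr (m n : ℕ) : Type :=
  {E : Submodule Fᵐᵒᵖ (EuclideanSpace F (Fin n)) // Module.finrank Fᵐᵒᵖ E = m}

/-- The unitary group of `F^n`, that is `O(n)`, `U(n)` or `Sp(n)`: the `F`-linear bijections of
`F^n` which preserve the Euclidean norm. -/
abbrev UnitaryGrp (n : ℕ) : Type :=
  EuclideanSpace F (Fin n) ≃ₗᵢ[Fᵐᵒᵖ] EuclideanSpace F (Fin n)

variable {F} {m n : ℕ}

/-- The action of the unitary group on the Grassmannian, `E ↦ U E`. -/
def Gr.map (U : UnitaryGrp F n) (E : Gr F m n) : Gr F m n :=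
  ⟨E.1.map U.toLinearEquiv.toLinearMap, by
    rw [LinearEquiv.finrank_map_eq]; exact E.2⟩

variable [SMulCommClass ℝ F F] [FiniteDimensional ℝ F]

/-- The real linear subspace underlying a point of the Grassmannian. -/
def Gr.real (E : Gr F m n) : Submodule ℝ (EuclideanSpace F (Fin n)) :=
  E.1.restrictScalars ℝ

/-- The orthogonal projection onto `E`, as a map from `F^n` to `E`. -/
def Gr.proj (E : Gr F m n) : EuclideanSpace F (Fin n) →L[ℝ] E.real :=
  E.real.orthogonalProjectionOnto

/-- The usual topology of the Grassmannian: `E` and `E'` are close to each other if the orthogonal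
projections onto `E` and `E'` are close in operator norm. -/
instance Gr.topologicalSpace : TopologicalSpace (Gr F m n) :=
  TopologicalSpace.induced (fun E : Gr F m n => E.real.starProjection) inferInstance

instance Gr.measurableSpace : MeasurableSpace (Gr F m n) := borel _

instance Gr.borelSpace : BorelSpace (Gr F m n) := ⟨rfl⟩

/-- `μ` is the Haar probability measure of the Grassmannian: a Borel probability measure that is
invariant under the unitary group. -/
structure IsHaarProbability (μ : Measure (Gr F m n)) : Prop where
  isProbabilityMeasure : IsProbabilityMeasure μ
  invariant : ∀ U : UnitaryGrp F n, MeasurePreserving (Gr.map U) μ μ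

/-- `|K|`, the Lebesgue measure of a subset of `F^n`. -/
def vol [MeasurableSpace F] [BorelSpace F] (K : Set (EuclideanSpace F (Fin n))) : ℝ :=
  (euclVol (EuclideanSpace F (Fin n))).real K

/-- `|P_E K|`, the Lebesgue measure in `E` of the orthogonal projection of `K` onto `E`. -/
def projVol [MeasurableSpace F] [BorelSpace F] (K : Set (EuclideanSpace F (Fin n)))
    (E : Gr F m n) : ℝ :=
  (euclVol E.real).real (E.proj '' K)

/-- `K` is invariant under multiplication by scalars of unit length. -/
def UnitScalarInvariant (K : Set (EuclideanSpace F (Fin n))) : Prop :=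
  ∀ a : F, ‖a‖ = 1 → (fun v => MulOpposite.op a • v) '' K = K

/-- `K` is an `F`-ellipsoid: the image of the Euclidean unit ball under an `F`-affine map. -/
def IsEllipsoid (K : Set (EuclideanSpace F (Fin n))) : Prop :=
  ∃ f : EuclideanSpace F (Fin n) →ᵃ[Fᵐᵒᵖ] EuclideanSpace F (Fin n), K = f '' Metric.closedBall 0 1

end

/-! ### Existence of the Haar probability measure on the Grassmannian of lines -/

section

theorem norm_rsmul {F : Type} [NormedDivisionRing F] {n : ℕ} (v : EuclideanSpace F (Fin n))
    (a : F) : ‖MulOpposite.op a • v‖ = ‖a‖ * ‖v‖ := by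
  rw [norm_smul, MulOpposite.norm_op]

theorem inner_rsmul {F : Type} [NormedDivisionRing F] [InnerProductSpace ℝ F] {n : ℕ}
    (v : EuclideanSpace F (Fin n)) (a b : F) :
    inner ℝ (MulOpposite.op a • v) (MulOpposite.op b • v) = ‖v‖ ^ 2 * inner ℝ a b := by
  rw [real_inner_eq_norm_add_mul_self_sub_norm_mul_self_sub_norm_mul_self_div_two,
    real_inner_eq_norm_add_mul_self_sub_norm_mul_self_sub_norm_mul_self_div_two,
    ← add_smul, ← MulOpposite.op_add, norm_rsmul, norm_rsmul, norm_rsmul]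
  ring

variable {F : Type} [NormedDivisionRing F] [InnerProductSpace ℝ F] [SMulCommClass ℝ F F]
  [FiniteDimensional ℝ F] {n : ℕ}

/-- The line `v · F`. -/
def line (v : EuclideanSpace F (Fin n)) (hv : v ≠ 0) : Gr F 1 n :=
  ⟨Submodule.span Fᵐᵒᵖ {v}, finrank_span_singleton hv⟩

/-- The orthogonal projection onto the line `v · F` in coordinates. -/
def lineProj (v : EuclideanSpace F (Fin n)) :
    EuclideanSpace F (Fin n) →L[ℝ] EuclideanSpace F (Fin n) :=
  ∑ i, (‖v‖ ^ 2)⁻¹ • (innerSL ℝ (MulOpposite.op (stdOrthonormalBasis ℝ F i) • v)).smulRight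
    (MulOpposite.op (stdOrthonormalBasis ℝ F i) • v)

theorem line_proj (v : EuclideanSpace F (Fin n)) (hv : v ≠ 0) :
    (line v hv).real.starProjection = lineProj v := by
  have hv' : ‖v‖ ^ 2 ≠ 0 := by positivity
  ext1 x
  apply Submodule.eq_starProjection_of_mem_of_inner_eq_zero
  · simp only [lineProj, sum_apply, smul_apply,
      ContinuousLinearMap.smulRight_apply]
    refine Submodule.sum_mem _ fun i _ => Submodule.smul_mem _ _ (Submodule.smul_mem _ _ ?_)
    exact Submodule.smul_mem (Submodule.span Fᵐᵒᵖ {v}) _ (Submodule.mem_span_singleton_self v)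
  · intro w hw
    obtain ⟨c, rfl⟩ := Submodule.mem_span_singleton.1 (show w ∈ Submodule.span Fᵐᵒᵖ {v} from hw)
    obtain ⟨a, rfl⟩ := MulOpposite.op_surjective c
    have key : MulOpposite.op a • v = ∑ i, inner ℝ (stdOrthonormalBasis ℝ F i) a •
        MulOpposite.op (stdOrthonormalBasis ℝ F i) • v := by
      conv_lhs => rw [← (stdOrthonormalBasis ℝ F).sum_repr' a]
      rw [Finset.op_sum, Finset.sum_smul]
      simp [MulOpposite.op_smul]
    simp only [lineProj, sum_apply, smul_apply,
      ContinuousLinearMap.smulRight_apply, inner_sub_left, sum_inner, inner_smul_left, innerSL_apply_apply]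
    simp only [inner_rsmul]
    conv_lhs => arg 1; rw [key]
    simp only [inner_sum, inner_smul_right]
    rw [sub_eq_zero]
    refine Finset.sum_congr rfl fun i _ => ?_
    rw [real_inner_comm x]
    simp
    field_simp

open Classical in
/-- The map `v ↦ v · F`, with an arbitrary value at `v = 0`. -/
def lineMap (E₀ : Gr F 1 n) (v : EuclideanSpace F (Fin n)) : Gr F 1 n :=
  if hv : v ≠ 0 then line v hv else E₀

variable [MeasurableSpace F] [BorelSpace F]

theorem measurable_lineMap (E₀ : Gr F 1 n) : Measurable (lineMap E₀) := by
  classical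
  have h1 : (Gr.measurableSpace : MeasurableSpace (Gr F 1 n)) =
      MeasurableSpace.comap (fun E : Gr F 1 n => E.real.starProjection) (borel _) := by
    exact borel_comap
  rw [h1, measurable_comap_iff]
  have h2 : (fun E : Gr F 1 n => E.real.starProjection) ∘ lineMap E₀ =
      fun v => if v ≠ 0 then lineProj v else E₀.real.starProjection := by
    funext v
    by_cases hv : v = 0
    · simp [lineMap, hv]
    · simp [lineMap, hv, line_proj]
  rw [h2]
  refine Measurable.ite (measurableSet_singleton 0).compl ?_ measurable_const
  unfold lineProj
  refine Finset.measurable_sum _ fun i _ => ?_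
  refine Measurable.smul (f := fun v : EuclideanSpace F (Fin n) => (‖v‖ ^ 2)⁻¹) (by fun_prop) ?_
  apply Continuous.measurable
  have : Continuous fun v : EuclideanSpace F (Fin n) => MulOpposite.op (stdOrthonormalBasis ℝ F i) • v :=
    continuous_const_smul _
  have h3 : Continuous fun w : EuclideanSpace F (Fin n) => (innerSL ℝ w).smulRight w := by
    exact ((ContinuousLinearMap.smulRightL ℝ (EuclideanSpace F (Fin n)) (EuclideanSpace F (Fin n))).continuous.comp (innerSL ℝ).continuous).clm_apply continuous_id
  exact h3.comp this

/-- The Haar probability measure on the Grassmannian of lines exists. -/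
theorem exists_isHaarProbability (hn : 1 ≤ n) : ∃ μ : Measure (Gr F 1 n), IsHaarProbability μ := by
  have : NeZero n := ⟨by omega⟩
  have he : (WithLp.toLp 2 (fun _ => 1) : EuclideanSpace F (Fin n)) ≠ 0 := fun h => by
    simpa using congrArg (fun v : EuclideanSpace F (Fin n) => v 0) h
  have : Nontrivial (EuclideanSpace F (Fin n)) := ⟨_, _, he⟩
  let E₀ : Gr F 1 n := line _ he
  let vl := (volume : Measure (EuclideanSpace F (Fin n)))
  have hb : vl (Metric.ball 0 1) ≠ 0 := (Metric.measure_ball_pos _ _ one_pos).ne'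
  let ν := ProbabilityTheory.cond vl (Metric.ball 0 1)
  have hν : IsProbabilityMeasure ν := ProbabilityTheory.cond_isProbabilityMeasure_of_finite hb
    measure_ball_lt_top.ne
  have hm := measurable_lineMap E₀
  refine ⟨ν.map (lineMap E₀), ⟨Measure.isProbabilityMeasure_map hm.aemeasurable, fun U => ?_⟩⟩
  let Ur : EuclideanSpace F (Fin n) ≃ₗᵢ[ℝ] EuclideanSpace F (Fin n) :=
    { (U.toLinearEquiv.restrictScalars ℝ) with norm_map' := U.norm_map }
  have hU : MeasurePreserving U ν ν := by
    have h0 : MeasurePreserving U vl vl := Ur.measurePreserving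
    have h1 := h0.restrict_preimage (s := Metric.ball 0 1) Metric.isOpen_ball.measurableSet
    have h2 : U ⁻¹' (Metric.ball 0 1) = Metric.ball 0 1 := by ext; simp
    rw [h2] at h1
    exact h1.smul_measure _
  have hcont : Continuous (Gr.map (m := 1) U) := by
    rw [continuous_induced_rng]
    have : (fun E : Gr F 1 n => E.real.starProjection) ∘ Gr.map U = fun E =>
        (Ur.toContinuousLinearEquiv : _ →L[ℝ] _) ∘L E.real.starProjection ∘L
          (Ur.symm.toContinuousLinearEquiv : _ →L[ℝ] _) := by
      funext E
      ext1 x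
      have h : (Gr.map U E).real = E.real.map (Ur.toLinearEquiv : _ →ₗ[ℝ] _) := by
        ext y
        simp only [Gr.map, Gr.real, Ur]
        simp
        exact ⟨fun h => ⟨U.symm y, h, by simp⟩, by rintro ⟨z, hz, rfl⟩; simpa using hz⟩
      have := Submodule.starProjection_map_apply Ur E.real x
      simp only [Function.comp, h]
      exact this
    rw [this]
    have hc : Continuous (fun E : Gr F 1 n => E.real.starProjection) := continuous_induced_dom
    fun_prop
  refine ⟨hcont.measurable, ?_⟩
  rw [Measure.map_map hcont.measurable hm]
  conv_rhs => rw [← hU.map_eq]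
  rw [Measure.map_map hm hU.measurable]
  refine Measure.map_congr ?_
  have hac : ν ≪ vl := ProbabilityTheory.cond_absolutelyContinuous
  have : ∀ᵐ v ∂ν, v ≠ 0 := by
    apply hac.ae_le
    exact Measure.ae_ne vl 0
  filter_upwards [this] with v hv
  have hv2 : U v ≠ 0 := by simpa using hv
  simp only [Function.comp, lineMap, hv, hv2, ne_eq, not_false_eq_true, dite_true]
  apply Subtype.ext
  simp [Gr.map, line, Submodule.map_span]

end

end FLutwak

end

/-! ### The Prékopa–Leindler inequality with weights 1/2 -/

noncomputable section

namespace ConvexSym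

open Set Filter Topology
open scoped ENNReal Pointwise

/-! The theorem is the Blaschke–Santaló inequality in disguise. Invariance under the scalar `-1`
makes `K` symmetric about the origin. Invariance under all unit scalars makes the projection of `K`
onto the line `vF` a ball, whose radius is `h(v) / ‖v‖` for the support function `h` of `K`
(`proj_image_line`). Hence `|P_E K|^{-n}` equals `κ_p^{-n} (‖v‖ / h(v))^{np}`. As `h` is the gauge
of the polar body `K°`, polar coordinates identify the integral of `(‖v‖ / h(v))^{np}` over the unit
ball with `|K°|`. The line through a uniform random point of the ball is Haar distributed, and the
Haar measure is unique (`IsHaarProbability.unique`). So the integral in the theorem is `|K°| /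
(κ_p^n κ_{np})` (`integral_projVol_zpow`), and the claim becomes `|K| |K°| ≤ κ_{np}²`.

The Blaschke–Santaló inequality and its equality case come from the study of a maximizer. The volume
product is invariant under linear automorphisms, so compactness yields a maximizer
(`exists_forall_volProd_le`). Steiner symmetrization does not decrease `|K|`. The polar of the
symmetral contains the fiberwise half-difference body of `K°`, whose volume is at least `|K°|` by
Prékopa–Leindler. At a maximizer this inclusion is an equality (`polar_steiner_subset`). Read on
support lines, it says that in each plane section the midpoints of parallel chords lie on a line
(`exists_reflection`). A planar body with such reflections in all directions is an ellipse, so the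
gauge of a maximizer satisfies the parallelogram law and the maximizer is an ellipsoid
(`exists_preimage_of_max`). All centred ellipsoids share the volume product of the ball, and a body
with equality is itself a maximizer.

Equality thus yields a real ellipsoid `{x | ‖e x‖ ≤ 1}`. Invariance makes `e† e` commute with the
scalars of `F`; so does `(e† e)^{-1/2}`, a polynomial in it, and this `F`-linear map carries the
unit ball onto `K` (`isEllipsoid_of_equiv`). -/

theorem volume_add_le_of_isCompact {A B C : Set ℝ} (hA : IsCompact A) (hB : IsCompact B)
    (hA' : A.Nonempty) (hB' : B.Nonempty)
    (h : ∀ x ∈ A, ∀ y ∈ B, (1 / 2 : ℝ) * (x + y) ∈ C) :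
    volume A + volume B ≤ 2 * volume C := by
  obtain ⟨a, ha, ha'⟩ := hA.exists_isGreatest hA'
  obtain ⟨b, hb, hb'⟩ := hB.exists_isLeast hB'
  have m1 : volume ({x : ℝ | x - b ∈ A}) = volume A := by
    simpa only [sub_eq_add_neg] using! measure_preimage_add_right volume (-b) A
  have m2 : volume ({x : ℝ | x - a ∈ B}) = volume B := by
    simpa only [sub_eq_add_neg] using! measure_preimage_add_right volume (-a) B
  have m3 : volume ({x : ℝ | (1 / 2 : ℝ) * x ∈ C}) = 2 * volume C := by
    have := Real.volume_preimage_mul_left (a := (1 / 2 : ℝ)) (by norm_num) C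
    have e : ENNReal.ofReal |(1 / 2 : ℝ)⁻¹| = 2 := by norm_num
    rwa [e] at this
  -- Shifting `A` by the least point of `B`, and `B` by the greatest point of `A`, leaves at most
  -- the common point `a + b`; both translates lie in `2C`.
  have hd : AEDisjoint volume {x : ℝ | x - b ∈ A} {x : ℝ | x - a ∈ B} := by
    refine measure_mono_null (t := {a + b}) ?_ (by simp)
    rintro x ⟨hx1, hx2⟩
    have := ha' hx1
    have := hb' hx2
    simp only [mem_singleton_iff]
    linarith
  rw [← m1, ← m2, ← m3, ← measure_union₀ _ hd]
  · refine measure_mono ?_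
    rintro x (hx | hx)
    · simpa using h _ hx _ hb
    · simpa using h _ ha _ hx
  · exact (hB.measurableSet.preimage (by fun_prop : Measurable fun x : ℝ => x - a)).nullMeasurableSet

theorem volume_add_le {A B C : Set ℝ} (hA : MeasurableSet A) (hB : MeasurableSet B)
    (hA' : A.Nonempty) (hB' : B.Nonempty)
    (h : ∀ x ∈ A, ∀ y ∈ B, (1 / 2 : ℝ) * (x + y) ∈ C) :
    volume A + volume B ≤ 2 * volume C := by
  obtain ⟨a, ha⟩ := hA'
  obtain ⟨b, hb⟩ := hB'
  have key : ∀ K ⊆ A, IsCompact K → ∀ L ⊆ B, IsCompact L → volume K + volume L ≤ 2 * volume C := by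
    intro K hK hKc L hL hLc
    -- Inner approximation may produce the empty set; inserting `a` and `b` restores nonemptiness.
    refine le_trans (add_le_add (measure_mono (subset_insert a K))
      (measure_mono (subset_insert b L))) ?_
    refine volume_add_le_of_isCompact (hKc.insert a) (hLc.insert b) (insert_nonempty _ _)
      (insert_nonempty _ _) fun x hx y hy => h x ?_ y ?_
    · exact insert_subset ha hK hx
    · exact insert_subset hb hL hy
  rw [hA.measure_eq_iSup_isCompact, hB.measure_eq_iSup_isCompact]
  simp only [iSup_and']
  exact ENNReal.biSup_add_biSup_le' ⟨∅, empty_subset _, isCompact_empty⟩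
    ⟨∅, empty_subset _, isCompact_empty⟩ fun K hK L hL => key K hK.1 hK.2 L hL.1 hL.2

/-- The one-dimensional inequality behind the theorem of Prékopa and Leindler, for functions with
supremum `1`. -/
theorem lintegral_add_le_of_sup_one {f g h : ℝ → ℝ} (hf : Measurable f) (hg : Measurable g)
    (hh : Measurable h) (f0 : ∀ x, 0 ≤ f x) (g0 : ∀ x, 0 ≤ g x) (h0 : ∀ x, 0 ≤ h x)
    (f1 : ∀ x, f x ≤ 1) (g1 : ∀ x, g x ≤ 1)
    (fs : ∀ t < 1, ∃ x, t < f x) (gs : ∀ t < 1, ∃ x, t < g x)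
    (H : ∀ x y, f x * g y ≤ h ((1 / 2 : ℝ) * (x + y)) ^ 2) :
    (∫⁻ x, ENNReal.ofReal (f x)) + ∫⁻ x, ENNReal.ofReal (g x) ≤ 2 * ∫⁻ x, ENNReal.ofReal (h x) := by
  rw [lintegral_eq_lintegral_meas_lt volume (.of_forall f0) hf.aemeasurable,
    lintegral_eq_lintegral_meas_lt volume (.of_forall g0) hg.aemeasurable,
    lintegral_eq_lintegral_meas_lt volume (.of_forall h0) hh.aemeasurable]
  have mf : Measurable fun t : ℝ => volume {a | t < f a} :=
    Antitone.measurable fun s t hst => measure_mono fun x (hx : t < f x) => hst.trans_lt hx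
  rw [← lintegral_add_left mf, ← lintegral_const_mul' _ _ (by simp)]
  refine setLIntegral_mono_ae' measurableSet_Ioi (.of_forall fun t ht => ?_)
  have ht : 0 < t := ht
  rcases lt_or_ge t 1 with ht1 | ht1
  -- Both superlevel sets are nonempty because the suprema exceed `t`; without this the
  -- one-dimensional bound could fail.
  · refine volume_add_le (measurableSet_lt measurable_const hf)
      (measurableSet_lt measurable_const hg) (fs t ht1) (gs t ht1) fun x hx y hy => ?_
    have hx : t < f x := hx
    have hy : t < g y := hy
    show t < _
    have := H x y
    have h3 : t ^ 2 < h ((1 / 2 : ℝ) * (x + y)) ^ 2 := by nlinarith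
    exact lt_of_pow_lt_pow_left₀ 2 (h0 _) h3
  · have e1 : {a | t < f a} = ∅ := by ext x; simpa using (f1 x).trans ht1
    have e2 : {a | t < g a} = ∅ := by ext x; simpa using (g1 x).trans ht1
    simp [e1, e2]

/-- The inequality of Prékopa and Leindler (with weights `1 / 2`) holds on `V`. -/
def PrekopaLeindler (V : Type*) [AddCommGroup V] [Module ℝ V] [MeasureSpace V] : Prop :=
  ∀ f g h : V → ℝ≥0∞, Measurable f → Measurable g → Measurable h →
    (∀ x y, f x * g y ≤ h ((1 / 2 : ℝ) • (x + y)) ^ 2) → (∫⁻ x, f x) * ∫⁻ x, g x ≤ (∫⁻ x, h x) ^ 2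

/-- Truncation of `f` and `g` at height `n` preserves the hypothesis, and monotone convergence
removes the truncation. -/
theorem PrekopaLeindler.of_bounded {V : Type*} [AddCommGroup V] [Module ℝ V] [MeasureSpace V]
    (H : ∀ f g h : V → ℝ≥0∞, Measurable f → Measurable g → Measurable h → (⨆ x, f x) ≠ ⊤ →
      (⨆ x, g x) ≠ ⊤ →
      (∀ x y, f x * g y ≤ h ((1 / 2 : ℝ) • (x + y)) ^ 2) →
      (∫⁻ x, f x) * ∫⁻ x, g x ≤ (∫⁻ x, h x) ^ 2) : PrekopaLeindler V := by
  intro f g h hf hg hh hfg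
  have key : ∀ f : V → ℝ≥0∞, Measurable f → ∫⁻ x, f x = ⨆ n : ℕ, ∫⁻ x, min (f x) n := by
    intro f hf
    rw [← lintegral_iSup (fun n => hf.min measurable_const)]
    · refine lintegral_congr fun x => ?_
      rw [← inf_iSup_eq, ENNReal.iSup_natCast]; simp
    · intro m n hmn x
      exact min_le_min_left _ (by exact_mod_cast hmn)
  have hb : ∀ (f : V → ℝ≥0∞) (n : ℕ), ⨆ x, min (f x) n ≠ ⊤ := fun f n =>
    ne_top_of_le_ne_top (ENNReal.natCast_ne_top n) (iSup_le fun x => min_le_right _ _)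
  rw [key f hf, key g hg]
  simp only [ENNReal.iSup_mul, ENNReal.mul_iSup, iSup_le_iff]
  intro m n
  exact H _ _ h (hf.min measurable_const) (hg.min measurable_const) hh (hb _ _) (hb _ _)
    fun x y => (mul_le_mul' (min_le_left _ _) (min_le_left _ _)).trans (hfg x y)

/-- Dividing `f`, `g`, `h` by `sup f`, `sup g` and the geometric mean of these suprema reduces the
claim to functions with supremum `1`. For those the stronger additive bound `F + G ≤ 2I` holds, and
the arithmetic–geometric mean inequality gives `F G ≤ I²`. The quotient of `h` is cut off at `1` to
keep it finite. -/
theorem prekopaLeindler_real : PrekopaLeindler ℝ := by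
  refine .of_bounded fun f g h hf hg hh fb gb H => ?_
  by_cases fz : ⨆ x, f x = 0
  · simp only [ENNReal.iSup_eq_zero] at fz
    simp [fz]
  by_cases gz : ⨆ x, g x = 0
  · simp only [ENNReal.iSup_eq_zero] at gz
    simp [gz]
  set a := ⨆ x, f x with ha
  set b := ⨆ x, g x with hb
  set c : ℝ≥0∞ := (a * b) ^ (1 / 2 : ℝ) with hc
  have hab0 : a * b ≠ 0 := mul_ne_zero fz gz
  have habt : a * b ≠ ⊤ := ENNReal.mul_ne_top fb gb
  have c2 : c ^ 2 = a * b := by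
    rw [hc, ← ENNReal.rpow_natCast, ← ENNReal.rpow_mul]; norm_num
  have c0 : c ≠ 0 := by
    intro h0; rw [h0] at c2; exact hab0 (by rw [← c2]; simp)
  have ct : c ≠ ⊤ := by
    intro h0; rw [h0] at c2; exact habt (by rw [← c2]; simp)
  have fa : ∀ x, f x / a ≤ 1 := fun x => ENNReal.div_le_of_le_mul (by simpa using le_iSup f x)
  have ga : ∀ x, g x / b ≤ 1 := fun x => ENNReal.div_le_of_le_mul (by simpa using le_iSup g x)
  have fat : ∀ x, f x / a ≠ ⊤ := fun x => ne_top_of_le_ne_top ENNReal.one_ne_top (fa x)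
  have gat : ∀ x, g x / b ≠ ⊤ := fun x => ne_top_of_le_ne_top ENNReal.one_ne_top (ga x)
  have ht : ∀ x, min (h x / c) 1 ≠ ⊤ := fun x =>
    ne_top_of_le_ne_top ENNReal.one_ne_top (min_le_right _ _)
  have sup : ∀ (f : ℝ → ℝ≥0∞), (⨆ x, f x) ≠ 0 → (⨆ x, f x) ≠ ⊤ → ∀ t < (1 : ℝ),
      ∃ x, t < (f x / ⨆ x, f x).toReal := by
    intro f f0 ft t ht
    rcases lt_or_ge t 0 with h0 | h0
    · exact ⟨0, h0.trans_le ENNReal.toReal_nonneg⟩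
    have : ENNReal.ofReal t * (⨆ x, f x) < ⨆ x, f x := by
      conv_rhs => rw [← one_mul (⨆ x, f x)]
      exact ENNReal.mul_lt_mul_left f0 ft (by simpa using ht)
    obtain ⟨x, hx⟩ := lt_iSup_iff.1 this
    refine ⟨x, ?_⟩
    have h1 : ENNReal.ofReal t < f x / ⨆ x, f x := by
      rwa [ENNReal.lt_div_iff_mul_lt (.inl f0) (.inl ft)]
    have h2 : f x / ⨆ x, f x ≠ ⊤ := ENNReal.div_ne_top (ne_top_of_le_ne_top ft (le_iSup f x)) f0
    exact (ENNReal.ofReal_lt_iff_lt_toReal h0 h2).1 h1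
  have main := lintegral_add_le_of_sup_one (f := fun x => (f x / a).toReal)
    (g := fun x => (g x / b).toReal) (h := fun x => (min (h x / c) 1).toReal)
    (hf.div_const a).ennreal_toReal (hg.div_const b).ennreal_toReal
    ((hh.div_const c).min measurable_const).ennreal_toReal (fun x => ENNReal.toReal_nonneg)
    (fun x => ENNReal.toReal_nonneg) (fun x => ENNReal.toReal_nonneg)
    (fun x => by simpa using ENNReal.toReal_mono ENNReal.one_ne_top (fa x))
    (fun x => by simpa using ENNReal.toReal_mono ENNReal.one_ne_top (ga x))
    (sup f fz fb) (sup g gz gb) (by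
      intro x y
      rw [← ENNReal.toReal_mul, ← ENNReal.toReal_pow]
      refine ENNReal.toReal_mono (ENNReal.pow_ne_top (ht _)) ?_
      rcases le_total (h ((1 / 2 : ℝ) * (x + y)) / c) 1 with h1 | h1
      · rw [min_eq_left h1, div_eq_mul_inv (h _), mul_pow, ← ENNReal.inv_pow, c2, ← div_eq_mul_inv]
        have := H x y
        rw [smul_eq_mul] at this
        calc f x / a * (g y / b) = f x * g y / (a * b) := by
              rw [div_eq_mul_inv, div_eq_mul_inv, div_eq_mul_inv,
                ENNReal.mul_inv (.inl fz) (.inl fb)]; ring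
          _ ≤ _ := by gcongr
      · rw [min_eq_right h1, one_pow]
        exact mul_le_one' (fa x) (ga y))
  simp only [ENNReal.ofReal_toReal (fat _), ENNReal.ofReal_toReal (gat _),
    ENNReal.ofReal_toReal (ht _)] at main
  have i1 : ∫⁻ x, f x = a * ∫⁻ x, f x / a := by
    rw [← lintegral_const_mul' _ _ fb]
    exact lintegral_congr fun x => (ENNReal.mul_div_cancel fz fb).symm
  have i2 : ∫⁻ x, g x = b * ∫⁻ x, g x / b := by
    rw [← lintegral_const_mul' _ _ gb]
    exact lintegral_congr fun x => (ENNReal.mul_div_cancel gz gb).symm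
  have i3 : c * ∫⁻ x, min (h x / c) 1 ≤ ∫⁻ x, h x := by
    rw [← lintegral_const_mul' _ _ ct]
    refine lintegral_mono fun x => ?_
    calc c * min (h x / c) 1 ≤ c * (h x / c) := by gcongr; exact min_le_left _ _
      _ = h x := ENNReal.mul_div_cancel c0 ct
  set F := ∫⁻ x, f x / a
  set G := ∫⁻ x, g x / b
  set I := ∫⁻ x, min (h x / c) 1
  have amgm : F * G ≤ I ^ 2 := by
    by_cases It : I = ⊤
    · simp [It]
    have hFG : F + G ≠ ⊤ := ne_top_of_le_ne_top (ENNReal.mul_ne_top (by simp) It : 2 * I ≠ ⊤) main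
    obtain ⟨hF, hG⟩ := ENNReal.add_ne_top.1 hFG
    clear_value F G I
    lift F to NNReal using hF
    lift G to NNReal using hG
    lift I to NNReal using It
    norm_cast at main ⊢
    rw [← NNReal.coe_le_coe] at main ⊢
    push_cast at main ⊢
    nlinarith [F.coe_nonneg, G.coe_nonneg, I.coe_nonneg, sq_nonneg ((F : ℝ) - G)]
  calc (∫⁻ x, f x) * ∫⁻ x, g x = c ^ 2 * (F * G) := by rw [i1, i2, c2]; ring
    _ ≤ c ^ 2 * I ^ 2 := by gcongr
    _ = (c * I) ^ 2 := by ring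
    _ ≤ _ := by gcongr

/-- The inequality on the fibers `W` says exactly that the fiber integrals satisfy the hypothesis of
the inequality on `V`. -/
theorem PrekopaLeindler.prod {V W : Type*} [AddCommGroup V] [Module ℝ V] [MeasureSpace V]
    [AddCommGroup W] [Module ℝ W] [MeasureSpace W] [SFinite (volume : Measure V)]
    [SFinite (volume : Measure W)]
    (hV : PrekopaLeindler V) (hW : PrekopaLeindler W) : PrekopaLeindler (V × W) := by
  intro f g h hf hg hh H
  rw [Measure.volume_eq_prod, lintegral_prod _ hf.aemeasurable, lintegral_prod _ hg.aemeasurable,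
    lintegral_prod _ hh.aemeasurable]
  refine hV _ _ _ hf.lintegral_prod_right' hg.lintegral_prod_right' hh.lintegral_prod_right'
    fun x y => ?_
  exact hW _ _ _ (hf.comp measurable_prodMk_left) (hg.comp measurable_prodMk_left)
    (hh.comp measurable_prodMk_left) fun z w => H (x, z) (y, w)

theorem PrekopaLeindler.of_equiv {V W : Type*} [AddCommGroup V] [Module ℝ V] [MeasureSpace V]
    [AddCommGroup W] [Module ℝ W] [MeasureSpace W] (hV : PrekopaLeindler V) (e : V ≃ₗ[ℝ] W)
    (he : MeasurePreserving e) : PrekopaLeindler W := by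
  intro f g h hf hg hh H
  rw [← he.lintegral_comp hf, ← he.lintegral_comp hg, ← he.lintegral_comp hh]
  refine hV _ _ _ (hf.comp he.measurable) (hg.comp he.measurable) (hh.comp he.measurable)
    fun x y => ?_
  simpa using H (e x) (e y)

/-- Splitting off the first coordinate. -/
def consEquiv (k : ℕ) : (ℝ × (Fin k → ℝ)) ≃ₗ[ℝ] (Fin (k + 1) → ℝ) where
  toFun p := Fin.cons p.1 p.2
  invFun x := (x 0, Fin.tail x)
  left_inv p := by simp
  right_inv x := by simp
  map_add' p q := by ext i; refine Fin.cases ?_ (fun j => ?_) i <;> simp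
  map_smul' r p := by ext i; refine Fin.cases ?_ (fun j => ?_) i <;> simp

@[simp] theorem consEquiv_apply (k : ℕ) (p : ℝ × (Fin k → ℝ)) :
    consEquiv k p = Fin.cons p.1 p.2 := rfl

theorem measurePreserving_consEquiv (k : ℕ) : MeasurePreserving (consEquiv k) := by
  have := (volume_preserving_piFinSuccAbove (fun _ : Fin (k + 1) => ℝ) 0).symm
  convert! this using 1
  funext p
  simp [MeasurableEquiv.piFinSuccAbove, Fin.insertNthEquiv, Fin.insertNth_zero']

theorem prekopaLeindler_pi : ∀ k : ℕ, PrekopaLeindler (Fin k → ℝ)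
  | 0 => by
    intro f g h hf hg hh H
    have hv : (volume : Measure (Fin 0 → ℝ)) = Measure.dirac 0 := by
      rw [volume_pi, Measure.pi_of_empty _ 0]
    rw [hv, lintegral_dirac, lintegral_dirac, lintegral_dirac]
    simpa using H 0 0
  | k + 1 => (prekopaLeindler_real.prod (prekopaLeindler_pi k)).of_equiv _
      (measurePreserving_consEquiv k)

end ConvexSym

end

/-! ### Volumes of half-differences; symmetric bodies and their polars -/

noncomputable section

namespace ConvexSym

open Set Filter Topology
open scoped ENNReal Pointwise

section HalfDifference

variable {V W : Type*} [AddCommGroup V] [Module ℝ V] [MeasureSpace V] [MeasurableNeg V]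
  [(volume : Measure V).IsNegInvariant] [MeasureSpace W]

/-- Prékopa–Leindler for the indicators of `A`, `-A` and `C`; the reflected set has the same volume,
so the square root of the product is the volume of `A` itself. -/
theorem PrekopaLeindler.volume_le (hV : PrekopaLeindler V) {A C : Set V} (hA : MeasurableSet A)
    (hC : MeasurableSet C) (h : ∀ x ∈ A, ∀ y ∈ A, (1 / 2 : ℝ) • (x - y) ∈ C) :
    volume A ≤ volume C := by
  have := hV (A.indicator 1) ((-A).indicator 1) (C.indicator 1)
    (measurable_one.indicator hA) (measurable_one.indicator hA.neg) (measurable_one.indicator hC)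
    (by
      intro x y
      by_cases hx : x ∈ A
      · by_cases hy : y ∈ -A
        · have := h x hx _ hy
          rw [sub_neg_eq_add] at this
          simp only [indicator_of_mem hx, indicator_of_mem hy, indicator_of_mem this]
          simp
        · simp [hy]
      · simp [hx])
  rw [lintegral_indicator_one hA, lintegral_indicator_one hA.neg, lintegral_indicator_one hC,
    Measure.measure_neg, ← sq] at this
  exact (ENNReal.pow_right_strictMono two_ne_zero).le_iff_le.1 this

theorem PrekopaLeindler.volume_le_left (hV : PrekopaLeindler V) [SFinite (volume : Measure V)]
    [SFinite (volume : Measure W)] {K D : Set (V × W)} (hK : MeasurableSet K)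
    (hD : MeasurableSet D)
    (h : ∀ x x' w, (x, w) ∈ K → (x', w) ∈ K → ((1 / 2 : ℝ) • (x - x'), w) ∈ D) :
    volume K ≤ volume D := by
  rw [Measure.volume_eq_prod, Measure.prod_apply_symm hK, Measure.prod_apply_symm hD]
  exact lintegral_mono fun w => hV.volume_le (measurable_prodMk_right hK)
    (measurable_prodMk_right hD) fun x hx y hy => h x y w hx hy

theorem PrekopaLeindler.volume_le_right (hV : PrekopaLeindler V) [SFinite (volume : Measure V)]
    {K D : Set (W × V)} (hK : MeasurableSet K) (hD : MeasurableSet D)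
    (h : ∀ x x' w, (w, x) ∈ K → (w, x') ∈ K → (w, (1 / 2 : ℝ) • (x - x')) ∈ D) :
    volume K ≤ volume D := by
  rw [Measure.volume_eq_prod, Measure.prod_apply hK, Measure.prod_apply hD]
  exact lintegral_mono fun w => hV.volume_le (measurable_prodMk_left hK)
    (measurable_prodMk_left hD) fun x hx y hy => h x y w hx hy

end HalfDifference

/-- Symmetrizing the first coordinate does not decrease the volume. -/
theorem volume_le_of_head {k : ℕ} {K D : Set (Fin (k + 1) → ℝ)} (hK : MeasurableSet K)
    (hD : MeasurableSet D)
    (h : ∀ (t t' : ℝ) (X : Fin k → ℝ), (Fin.cons t X : Fin (k + 1) → ℝ) ∈ K →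
      (Fin.cons t' X : Fin (k + 1) → ℝ) ∈ K →
      (Fin.cons ((1 / 2 : ℝ) * (t - t')) X : Fin (k + 1) → ℝ) ∈ D) : volume K ≤ volume D := by
  have e := measurePreserving_consEquiv k
  rw [← e.measure_preimage hK.nullMeasurableSet, ← e.measure_preimage hD.nullMeasurableSet]
  exact prekopaLeindler_real.volume_le_left (e.measurable hK) (e.measurable hD) h

/-- Symmetrizing all coordinates but the first does not decrease the volume. -/
theorem volume_le_of_tail {k : ℕ} {K D : Set (Fin (k + 1) → ℝ)} (hK : MeasurableSet K)
    (hD : MeasurableSet D)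
    (h : ∀ (X X' : Fin k → ℝ) (t : ℝ), (Fin.cons t X : Fin (k + 1) → ℝ) ∈ K →
      (Fin.cons t X' : Fin (k + 1) → ℝ) ∈ K →
      (Fin.cons t ((1 / 2 : ℝ) • (X - X')) : Fin (k + 1) → ℝ) ∈ D) : volume K ≤ volume D := by
  have e := measurePreserving_consEquiv k
  rw [← e.measure_preimage hK.nullMeasurableSet, ← e.measure_preimage hD.nullMeasurableSet]
  exact (prekopaLeindler_pi k).volume_le_right (e.measurable hK) (e.measurable hD) h

/-! ### Symmetric convex bodies and their polars -/

/-- Convex bodies that are symmetric about the origin. -/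
structure IsSymBody {V : Type*} [NormedAddCommGroup V] [NormedSpace ℝ V] (K : Set V) : Prop where
  convex : Convex ℝ K
  isCompact : IsCompact K
  neg_mem : ∀ x ∈ K, -x ∈ K
  zero_mem_interior : (0 : V) ∈ interior K

/-- The polar of a set with respect to the dot product. -/
def polar {ι : Type*} [Fintype ι] (K : Set (ι → ℝ)) : Set (ι → ℝ) :=
  {y | ∀ x ∈ K, x ⬝ᵥ y ≤ 1}

/-- The volume product. -/
def volProd {ι : Type*} [Fintype ι] (K : Set (ι → ℝ)) : ℝ≥0∞ :=
  volume K * volume (polar K)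

namespace IsSymBody

variable {V : Type*} [NormedAddCommGroup V] [NormedSpace ℝ V] {K : Set V}

theorem zero_mem (hK : IsSymBody K) : (0 : V) ∈ K := interior_subset hK.zero_mem_interior

theorem exists_closedBall_subset (hK : IsSymBody K) : ∃ r > 0, Metric.closedBall 0 r ⊆ K := by
  have := mem_interior_iff_mem_nhds.1 hK.zero_mem_interior
  exact Metric.nhds_basis_closedBall.mem_iff.1 this

theorem mem_nhds (hK : IsSymBody K) : K ∈ 𝓝 (0 : V) :=
  mem_interior_iff_mem_nhds.1 hK.zero_mem_interior

theorem smul_mem (hK : IsSymBody K) {x : V} (hx : x ∈ K) {c : ℝ} (hc : |c| ≤ 1) : c • x ∈ K := by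
  rcases le_total 0 c with h | h
  · exact hK.convex.smul_mem_of_zero_mem hK.zero_mem hx ⟨h, (le_abs_self c).trans hc⟩
  · have := hK.convex.smul_mem_of_zero_mem hK.zero_mem (hK.neg_mem x hx) (t := -c)
      ⟨by linarith, (neg_le_abs c).trans hc⟩
    simpa using this

theorem of_interior_nonempty (hc : Convex ℝ K) (hK : IsCompact K) (hs : ∀ x ∈ K, -x ∈ K)
    (hi : (interior K).Nonempty) : IsSymBody K := by
  refine ⟨hc, hK, hs, ?_⟩
  obtain ⟨x, hx⟩ := hi
  have h1 : -x ∈ interior K := by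
    have e : -K = K := by
      ext y; exact ⟨fun h => by simpa using hs _ h, fun h => hs _ h⟩
    have h2 : (Homeomorph.neg V) ⁻¹' interior K = interior (-K) := (Homeomorph.neg V).preimage_interior K
    rw [e] at h2
    rw [← h2]
    simpa using hx
  have := hc.interior hx h1 (a := 1 / 2) (b := 1 / 2) (by norm_num) (by norm_num) (by norm_num)
  simpa using this

theorem gauge_le_one_iff (hK : IsSymBody K) {x : V} : gauge K x ≤ 1 ↔ x ∈ K := by
  rw [gauge_le_one_iff_mem_closure hK.convex hK.mem_nhds, hK.isCompact.isClosed.closure_eq]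

theorem gauge_neg (hK : IsSymBody K) (x : V) : gauge K (-x) = gauge K x :=
  _root_.gauge_neg (fun y hy => hK.neg_mem y hy) x

theorem gauge_pos (hK : IsSymBody K) {x : V} (hx : x ≠ 0) : 0 < gauge K x :=
  (_root_.gauge_pos (absorbent_nhds_zero hK.mem_nhds)
    ((NormedSpace.isVonNBounded_iff ℝ).2 hK.isCompact.isBounded)).2 hx

theorem gauge_smul_abs (hK : IsSymBody K) (c : ℝ) (x : V) : gauge K (c • x) = |c| * gauge K x := by
  rcases le_total 0 c with h | h
  · rw [gauge_smul_of_nonneg h, abs_of_nonneg h]; rfl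
  · rw [← hK.gauge_neg, ← neg_smul, gauge_smul_of_nonneg (by linarith), abs_of_nonpos h]; rfl

theorem gauge_add_le (hK : IsSymBody K) (x y : V) : gauge K (x + y) ≤ gauge K x + gauge K y :=
  _root_.gauge_add_le hK.convex (absorbent_nhds_zero hK.mem_nhds) x y

theorem preimage_equiv {U : Type*} [NormedAddCommGroup U] [NormedSpace ℝ U] (hK : IsSymBody K)
    (e : U ≃L[ℝ] V) : IsSymBody (e ⁻¹' K) where
  convex := hK.convex.linear_preimage (e : U →ₗ[ℝ] V)
  isCompact := e.toHomeomorph.isCompact_preimage.2 hK.isCompact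
  neg_mem x hx := by
    have := hK.neg_mem _ hx
    simpa using this
  zero_mem_interior := by
    rw [mem_interior_iff_mem_nhds]
    refine e.continuous.continuousAt.preimage_mem_nhds ?_
    simpa using hK.mem_nhds

end IsSymBody

section Polar

variable {ι : Type*} [Fintype ι] {K L : Set (ι → ℝ)}

theorem polar_anti (h : K ⊆ L) : polar L ⊆ polar K := fun _ hy x hx => hy x (h hx)

theorem polar_smul {c : ℝ} (hc : 0 < c) : polar (c • K) = c⁻¹ • polar K := by
  ext y
  rw [mem_inv_smul_set_iff₀ hc.ne']
  constructor
  · intro h x hx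
    have := h _ (smul_mem_smul_set hx)
    rwa [dotProduct_smul, ← smul_dotProduct]
  · rintro h _ ⟨x, hx, rfl⟩
    have := h x hx
    rwa [dotProduct_smul, ← smul_dotProduct] at this

theorem isClosed_polar : IsClosed (polar K) := by
  have : polar K = ⋂ x ∈ K, {y | x ⬝ᵥ y ≤ 1} := by ext; simp [polar]
  rw [this]
  refine isClosed_biInter fun x _ => isClosed_le ?_ continuous_const
  fun_prop

theorem convex_polar : Convex ℝ (polar K) := by
  intro y hy z hz a b ha hb hab x hx
  rw [dotProduct_add, dotProduct_smul, dotProduct_smul, smul_eq_mul, smul_eq_mul]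
  nlinarith [hy x hx, hz x hx]

theorem polar_isSymBody (hK : IsSymBody K) : IsSymBody (polar K) := by
  classical
  refine ⟨convex_polar, Metric.isCompact_of_isClosed_isBounded isClosed_polar ?_, ?_, ?_⟩
  · obtain ⟨r, hr, hrK⟩ := hK.exists_closedBall_subset
    refine isBounded_iff_forall_norm_le.2 ⟨r⁻¹, fun y hy => ?_⟩
    rw [pi_norm_le_iff_of_nonneg (by positivity)]
    intro i
    have key : ∀ s : ℝ, |s| ≤ r → s * y i ≤ 1 := by
      intro s hs
      have : Pi.single i s ∈ K := hrK (by
        simpa [Pi.norm_single] using hs)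
      simpa using hy _ this
    rw [Real.norm_eq_abs, abs_le, inv_eq_one_div, le_div_iff₀ hr, ← neg_div, div_le_iff₀ hr]
    have h1 := key r (by rw [abs_of_pos hr])
    have h2 := key (-r) (by rw [abs_neg, abs_of_pos hr])
    constructor <;> linarith
  · intro y hy x hx
    have := hy _ (hK.neg_mem x hx)
    simpa using this
  · obtain ⟨R, hR, hRK⟩ := hK.isCompact.isBounded.exists_pos_norm_le
    rw [mem_interior_iff_mem_nhds]
    -- The summand `1` keeps the radius positive for an empty index type.
    have c : (0 : ℝ) < 1 / (R * (Fintype.card ι + 1)) := by positivity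
    refine mem_of_superset (Metric.closedBall_mem_nhds _ c) fun y hy x hx => ?_
    rw [mem_closedBall_zero_iff] at hy
    calc x ⬝ᵥ y = ∑ i, x i * y i := rfl
      _ ≤ ∑ i : ι, R * (1 / (R * (Fintype.card ι + 1))) := by
        refine Finset.sum_le_sum fun i _ => ?_
        refine (le_abs_self _).trans ?_
        rw [abs_mul]
        exact mul_le_mul ((norm_le_pi_norm x i).trans (hRK x hx)) ((norm_le_pi_norm y i).trans hy)
          (abs_nonneg _) hR.le
      _ ≤ 1 := by
        rw [Finset.sum_const, Finset.card_univ, nsmul_eq_mul]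
        field_simp
        linarith

/-- A functional that separates a point from `K`, divided by its bound `u` on `K`, belongs to the
polar and exceeds `1` at the point. -/
theorem polar_polar (hK : IsSymBody K) : polar (polar K) = K := by
  classical
  refine Subset.antisymm (fun x hx => ?_) fun x hx y hy => by
    rw [dotProduct_comm]; exact hy x hx
  by_contra hxK
  obtain ⟨f, u, hfu, hu⟩ := geometric_hahn_banach_closed_point hK.convex hK.isCompact.isClosed hxK
  have hu0 : 0 < u := by simpa using hfu 0 hK.zero_mem
  have hf : ∀ z, z ⬝ᵥ (fun i => f (Pi.single i 1)) = f z := fun z => by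
    conv_rhs => rw [← Finset.univ_sum_single z]
    rw [map_sum]
    refine Finset.sum_congr rfl fun i _ => ?_
    rw [← smul_eq_mul, ← map_smul, ← Pi.single_smul]
    simp
  have h1 : u⁻¹ • (fun i => f (Pi.single i 1)) ∈ polar K := fun z hz => by
    rw [dotProduct_smul, hf, smul_eq_mul, inv_mul_le_iff₀ hu0]
    linarith [hfu z hz]
  have h2 := hx _ h1
  rw [dotProduct_comm, dotProduct_smul, hf, smul_eq_mul, inv_mul_le_iff₀ hu0] at h2
  linarith

/-- Each point which is not interior to a symmetric body has a support functional in the polar. -/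
theorem exists_polar_ge_one (hK : IsSymBody K) {x : ι → ℝ}
    (hx : ∀ c : ℝ, 1 < c → c • x ∉ K) : ∃ y ∈ polar K, 1 ≤ x ⬝ᵥ y := by
  have hP := polar_isSymBody hK
  obtain ⟨y, hy, hmax⟩ := hP.isCompact.exists_isMaxOn ⟨0, hP.zero_mem⟩
    (f := fun y => x ⬝ᵥ y) (by fun_prop)
  refine ⟨y, hy, ?_⟩
  by_contra! h
  have hmax : ∀ z ∈ polar K, x ⬝ᵥ z ≤ x ⬝ᵥ y := fun z hz => hmax hz
  -- If the maximum `m` of `x ⬝ᵥ y` over the polar were below `1`, then `c = 2 / (1 + m)` would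
  -- exceed `1` with `c m ≤ 1`, which puts `c • x` into the bipolar, that is, into `K`.
  obtain ⟨c, hc1, hc2⟩ : ∃ c : ℝ, 1 < c ∧ c * (x ⬝ᵥ y) ≤ 1 := by
    have h0 := hmax 0 hP.zero_mem
    rw [dotProduct_zero] at h0
    refine ⟨2 / (1 + x ⬝ᵥ y), by rw [lt_div_iff₀] <;> linarith, ?_⟩
    rw [div_mul_eq_mul_div, div_le_one] <;> linarith
  refine hx c hc1 ?_
  rw [← polar_polar hK]
  intro z hz
  rw [dotProduct_smul, smul_eq_mul, dotProduct_comm]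
  nlinarith [hmax z hz]

theorem polar_preimage [DecidableEq ι] (A : Matrix ι ι ℝ) (hA : IsUnit A.det) (K : Set (ι → ℝ)) :
    polar (A.mulVec ⁻¹' K) = A⁻¹.transpose.mulVec ⁻¹' polar K := by
  ext y
  constructor
  · intro h x hx
    have : A⁻¹.mulVec x ∈ A.mulVec ⁻¹' K := by
      rwa [mem_preimage, Matrix.mulVec_mulVec, Matrix.mul_nonsing_inv _ hA, Matrix.one_mulVec]
    have := h _ this
    rwa [Matrix.dotProduct_transpose_mulVec, dotProduct_comm]
  · intro h x hx
    have := h _ hx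
    rwa [Matrix.dotProduct_transpose_mulVec, Matrix.mulVec_mulVec, Matrix.nonsing_inv_mul _ hA,
      Matrix.one_mulVec, dotProduct_comm] at this

/-- The volume product is invariant under linear automorphisms. -/
theorem volProd_preimage (e : (ι → ℝ) ≃ₗ[ℝ] (ι → ℝ)) (K : Set (ι → ℝ)) :
    volProd (e ⁻¹' K) = volProd K := by
  classical
  set A := LinearMap.toMatrix' (e : (ι → ℝ) →ₗ[ℝ] (ι → ℝ)) with hAdef
  have hd : IsUnit A.det := by
    rw [hAdef, LinearMap.det_toMatrix']
    exact LinearEquiv.isUnit_det' e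
  have he : (e : (ι → ℝ) → (ι → ℝ)) = A.mulVec := by
    funext x
    simp [hAdef]
  have hv : ∀ (B : Matrix ι ι ℝ), IsUnit B.det → ∀ L : Set (ι → ℝ),
      volume (B.mulVec ⁻¹' L) = ENNReal.ofReal |B.det⁻¹| * volume L := by
    intro B hB L
    have := Measure.addHaar_preimage_linearMap (volume : Measure (ι → ℝ)) (f := Matrix.toLin' B)
      (by rw [LinearMap.det_toLin']; exact hB.ne_zero) L
    rw [LinearMap.det_toLin'] at this
    exact this
  have hd' : IsUnit (A⁻¹.transpose).det := by
    rw [Matrix.det_transpose]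
    exact Matrix.isUnit_nonsing_inv_det A hd
  rw [volProd, he, polar_preimage A hd, hv A hd, hv _ hd', Matrix.det_transpose,
    Matrix.det_nonsing_inv, Ring.inverse_eq_inv', inv_inv, mul_mul_mul_comm, ← ENNReal.ofReal_mul
    (abs_nonneg _), ← abs_mul, inv_mul_cancel₀ hd.ne_zero]
  simp [volProd]

end Polar

end ConvexSym

end

/-! ### Existence of a body of maximal volume product -/

noncomputable section

namespace ConvexSym

open Set Filter Topology TopologicalSpace
open scoped ENNReal Pointwise

/-- Each symmetric body has a linear image between two fixed balls. -/
theorem IsSymBody.exists_position {N : ℕ} {K : Set (Fin N → ℝ)} (hK : IsSymBody K) :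
    ∃ e : (Fin N → ℝ) ≃ₗ[ℝ] (Fin N → ℝ), Metric.closedBall 0 (1 / (N + 1 : ℝ)) ⊆ e ⁻¹' K ∧
      e ⁻¹' K ⊆ Metric.closedBall 0 1 := by
  classical
  have hc : IsCompact (Set.pi univ fun _ : Fin N => K) := isCompact_univ_pi fun _ => hK.isCompact
  -- An Auerbach-type basis: `N` vectors of `K` spanning a parallelepiped of the largest volume.
  obtain ⟨M, hM, hmax⟩ := hc.exists_isMaxOn ⟨0, fun i _ => hK.zero_mem⟩
    (f := fun M : Fin N → Fin N → ℝ => |(Matrix.of M).det|)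
    (Continuous.continuousOn (by
      refine continuous_abs.comp (Continuous.matrix_det ?_)
      exact continuous_id))
  have hM : ∀ i, M i ∈ K := fun i => hM i (mem_univ i)
  have hmax : ∀ A : Fin N → Fin N → ℝ, (∀ i, A i ∈ K) →
      |(Matrix.of A).det| ≤ |(Matrix.of M).det| := fun A hA => hmax fun i _ => hA i
  have hdet : 0 < |(Matrix.of M).det| := by
    obtain ⟨r, hr, hrK⟩ := hK.exists_closedBall_subset
    have h1 := hmax (fun i => Pi.single i r) fun i => hrK (by
      simp [Pi.norm_single, abs_of_pos hr])
    have h2 : (Matrix.of fun i : Fin N => (Pi.single i r : Fin N → ℝ)) =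
        Matrix.diagonal fun _ => r := by
      ext i j
      by_cases h : i = j
      · subst h; simp
      · simp [Matrix.diagonal_apply_ne _ h, Pi.single_eq_of_ne (Ne.symm h)]
    rw [h2, Matrix.det_diagonal] at h1
    refine lt_of_lt_of_le ?_ h1
    simp [hr.ne']
  have hf : LinearMap.det (Matrix.toLin' (Matrix.of M).transpose) ≠ 0 := by
    rw [LinearMap.det_toLin', Matrix.det_transpose]
    exact abs_pos.1 hdet
  let e := LinearMap.equivOfDetNeZero _ hf
  have he : ∀ a, e a = ∑ i, a i • M i := by
    intro a
    show (Matrix.of M).transpose.mulVec a = _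
    rw [Matrix.mulVec_eq_sum]
    simp only [op_smul_eq_smul, Matrix.transpose_transpose]
    rfl
  refine ⟨e, fun a ha => ?_, fun a ha => ?_⟩
  · rw [mem_closedBall_zero_iff] at ha
    rw [mem_preimage, he, ← hK.gauge_le_one_iff]
    calc gauge K (∑ i, a i • M i) ≤ ∑ i, gauge K (a i • M i) :=
          gauge_sum_le hK.convex (absorbent_nhds_zero hK.mem_nhds) _ _
      _ ≤ ∑ i : Fin N, 1 / (N + 1 : ℝ) := by
          refine Finset.sum_le_sum fun i _ => ?_
          rw [hK.gauge_smul_abs]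
          have h1 := hK.gauge_le_one_iff.2 (hM i)
          have h2 := (norm_le_pi_norm a i).trans ha
          rw [Real.norm_eq_abs] at h2
          nlinarith [abs_nonneg (a i)]
      _ ≤ 1 := by
          rw [Finset.sum_const, Finset.card_univ, Fintype.card_fin, nsmul_eq_mul]
          field_simp
          linarith
  · rw [mem_preimage, he] at ha
    rw [mem_closedBall_zero_iff, pi_norm_le_iff_of_nonneg zero_le_one]
    intro i
    -- Replacing the `i`-th vector by the given point of `K` multiplies the determinant by `a i`, so
    -- maximality forces `|a i| ≤ 1`.
    have h1 := hmax (Function.update M i (∑ k, a k • M k)) fun j => by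
      by_cases h : j = i
      · subst h; simpa using ha
      · simpa [Function.update_of_ne h] using hM j
    have h2 := Matrix.det_updateRow_sum (Matrix.of M) i a
    have h3 : Matrix.of (Function.update M i (∑ k, a k • M k)) =
      (Matrix.of M).updateRow i (∑ k, a k • (Matrix.of M) k) := rfl
    rw [h3, h2, smul_eq_mul, abs_mul] at h1
    rw [Real.norm_eq_abs]
    exact le_of_mul_le_mul_right (by linarith) hdet

/-- If two convex sets that contain a ball of radius `δ` have distance less than `ε`, then one is
contained in the dilation of the other by the factor `1 + ε / δ`. -/
theorem subset_smul_of_near {V : Type*} [NormedAddCommGroup V] [NormedSpace ℝ V] {K L : Set V}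
    {δ ε : ℝ} (hδ : 0 < δ) (hε : 0 < ε) (hL : Convex ℝ L) (hδL : Metric.closedBall 0 δ ⊆ L)
    (h : ∀ x ∈ K, ∃ y ∈ L, dist x y < ε) : K ⊆ (1 + ε / δ) • L := by
  intro x hx
  obtain ⟨y, hy, hxy⟩ := h x hx
  -- By convexity the dilate is `L + (ε / δ) • L`, and the second summand contains the ball of
  -- radius `ε`, hence `x - y`.
  rw [hL.add_smul zero_le_one (by positivity), one_smul]
  refine ⟨y, hy, x - y, ?_, by simp⟩
  rw [mem_smul_set_iff_inv_smul_mem₀ (by positivity)]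
  apply hδL
  rw [mem_closedBall_zero_iff, norm_smul, Real.norm_of_nonneg (by positivity), ← dist_eq_norm,
    inv_div]
  rw [div_mul_eq_mul_div, div_le_iff₀ hε]
  gcongr

/-- Polarity reverses inclusions, so the polars are also within a factor `c` of each other; each of
the two volumes contributes `c ^ N`. -/
theorem volProd_le_of_near {N : ℕ} {K L : Set (Fin N → ℝ)} {c : ℝ} (hc : 0 < c)
    (h1 : K ⊆ c • L) (h2 : L ⊆ c • K) :
    volProd K ≤ ENNReal.ofReal (c ^ N) ^ 2 * volProd L := by
  have e1 : volume K ≤ ENNReal.ofReal (c ^ N) * volume L := by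
    refine (measure_mono h1).trans_eq ?_
    rw [Measure.addHaar_smul_of_nonneg _ hc.le]
    simp
  have h3 : polar K ⊆ c • polar L := by
    have := polar_anti h2
    rw [polar_smul hc] at this
    calc polar K = c • (c⁻¹ • polar K) := by rw [smul_smul, mul_inv_cancel₀ hc.ne', one_smul]
      _ ⊆ _ := smul_set_mono this
  have e2 : volume (polar K) ≤ ENNReal.ofReal (c ^ N) * volume (polar L) := by
    refine (measure_mono h3).trans_eq ?_
    rw [Measure.addHaar_smul_of_nonneg _ hc.le]
    simp
  calc volProd K ≤ _ := mul_le_mul' e1 e2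
    _ = _ := by rw [volProd]; ring

/-- A form of the selection theorem of Blaschke. -/
theorem exists_subseq_tendsto_hausdorffDist {V : Type*} [MetricSpace V] {Q : Set V}
    (hQ : IsCompact Q) (K : ℕ → Set V) (hK : ∀ n, IsCompact (K n)) (hne : ∀ n, (K n).Nonempty)
    (hKQ : ∀ n, K n ⊆ Q) : ∃ L ⊆ Q, IsCompact L ∧ L.Nonempty ∧ ∃ φ : ℕ → ℕ, StrictMono φ ∧
      Tendsto (fun n => Metric.hausdorffDist (K (φ n)) L) atTop (𝓝 0) := by
  let KK : ℕ → NonemptyCompacts V := fun n => ⟨⟨K n, hK n⟩, hne n⟩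
  obtain ⟨L, hL, φ, hφ, hlim⟩ := (NonemptyCompacts.isCompact_subsets_of_isCompact hQ).tendsto_subseq
    (x := KK) hKQ
  exact ⟨L, hL, L.isCompact, L.nonempty, φ, hφ, tendsto_iff_dist_tendsto_zero.1 hlim⟩

section Limits

variable {V : Type*} [MetricSpace V] {K : ℕ → Set V} {L : Set V}

theorem exists_tendsto_of_mem (hK : ∀ n, IsCompact (K n)) (hKne : ∀ n, (K n).Nonempty)
    (hne : ∀ n, Metric.hausdorffEDist (K n) L ≠ ⊤)
    (h : Tendsto (fun n => Metric.hausdorffDist (K n) L) atTop (𝓝 0)) {z : V} (hz : z ∈ L) :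
    ∃ w : ℕ → V, (∀ n, w n ∈ K n) ∧ Tendsto w atTop (𝓝 z) := by
  choose w hw hw' using fun n => (hK n).exists_infDist_eq_dist (hKne n) z
  refine ⟨w, hw, tendsto_iff_dist_tendsto_zero.2 ?_⟩
  refine squeeze_zero (fun n => dist_nonneg) (fun n => ?_) h
  rw [dist_comm, ← hw', Metric.hausdorffDist_comm]
  exact Metric.infDist_le_hausdorffDist_of_mem hz (by rw [Metric.hausdorffEDist_comm]; exact hne n)

theorem mem_of_tendsto_of_hausdorffDist (hL : IsClosed L) (hLne : L.Nonempty)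
    (hne : ∀ n, Metric.hausdorffEDist (K n) L ≠ ⊤)
    (h : Tendsto (fun n => Metric.hausdorffDist (K n) L) atTop (𝓝 0)) {w : ℕ → V} {z : V}
    (hw : ∀ n, w n ∈ K n) (hwz : Tendsto w atTop (𝓝 z)) : z ∈ L := by
  rw [hL.mem_iff_infDist_zero hLne]
  refine le_antisymm ?_ Metric.infDist_nonneg
  have h1 : Tendsto (fun n => Metric.hausdorffDist (K n) L + dist (w n) z) atTop (𝓝 (0 + 0)) :=
    h.add (tendsto_iff_dist_tendsto_zero.1 hwz)
  rw [add_zero] at h1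
  refine ge_of_tendsto h1 (.of_forall fun n => ?_)
  rw [dist_comm]
  exact Metric.infDist_le_infDist_add_dist.trans
    (by gcongr; exact Metric.infDist_le_hausdorffDist_of_mem (hw n) (hne n))

end Limits

/-- Linear invariance restricts the competition to bodies between two fixed balls. A maximizing
sequence there has a Hausdorff limit, and the common inner ball converts small Hausdorff distance
into dilations with factor close to `1`, so the volume product of the limit reaches the supremum. -/
theorem exists_forall_volProd_le (N : ℕ) :
    ∃ L : Set (Fin N → ℝ), IsSymBody L ∧ ∀ K : Set (Fin N → ℝ), IsSymBody K → volProd K ≤ volProd L := by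
  set δ : ℝ := 1 / (N + 1 : ℝ) with hδdef
  have hδ : 0 < δ := by positivity
  let C : Set (Set (Fin N → ℝ)) := {K | IsSymBody K ∧ Metric.closedBall 0 δ ⊆ K ∧
    K ⊆ Metric.closedBall 0 1}
  have hδ1 : δ ≤ 1 := by
    rw [hδdef, div_le_one (by positivity)]
    linarith [(Nat.cast_nonneg N : (0 : ℝ) ≤ N)]
  have hball : Metric.closedBall (0 : Fin N → ℝ) 1 ∈ C :=
    ⟨⟨convex_closedBall _ _, isCompact_closedBall _ _, fun x hx => by simpa using hx,
      mem_interior_iff_mem_nhds.2 (Metric.closedBall_mem_nhds _ one_pos)⟩,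
      Metric.closedBall_subset_closedBall hδ1, Subset.rfl⟩
  obtain ⟨u, -, hu, huC⟩ := exists_seq_tendsto_sSup (S := volProd '' C) ⟨_, _, hball, rfl⟩
    (OrderTop.bddAbove _)
  choose K hKC hKu using huC
  have hKb : ∀ n, IsSymBody (K n) := fun n => (hKC n).1
  obtain ⟨L, hL1, hLc, hLne, φ, hφ, hdist⟩ := exists_subseq_tendsto_hausdorffDist
    (isCompact_closedBall (0 : Fin N → ℝ) 1) K (fun n => (hKb n).isCompact)
    (fun n => ⟨0, (hKb n).zero_mem⟩) fun n => (hKC n).2.2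
  have hne : ∀ n, Metric.hausdorffEDist (K (φ n)) L ≠ ⊤ := fun n =>
    Metric.hausdorffEDist_ne_top_of_nonempty_of_bounded ⟨0, (hKb _).zero_mem⟩ hLne
      (hKb _).isCompact.isBounded hLc.isBounded
  have happrox := fun (z : Fin N → ℝ) (hz : z ∈ L) => exists_tendsto_of_mem
    (fun n => (hKb (φ n)).isCompact) (fun n => ⟨0, (hKb _).zero_mem⟩) hne hdist hz
  have hlimmem := fun (w : ℕ → Fin N → ℝ) (z : Fin N → ℝ) (hw : ∀ n, w n ∈ K (φ n)) =>
    mem_of_tendsto_of_hausdorffDist (z := z) hLc.isClosed hLne hne hdist hw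
  have hLδ : Metric.closedBall 0 δ ⊆ L := fun z hz =>
    hlimmem (fun _ => z) z (fun n => (hKC _).2.1 hz) tendsto_const_nhds
  have hLb : IsSymBody L := by
    refine ⟨?_, hLc, ?_, mem_interior_iff_mem_nhds.2
      (mem_of_superset (Metric.closedBall_mem_nhds _ hδ) hLδ)⟩
    · intro x hx y hy a b ha hb hab
      obtain ⟨w, hw, hwx⟩ := happrox x hx
      obtain ⟨v, hv, hvy⟩ := happrox y hy
      exact hlimmem (fun n => a • w n + b • v n) _
        (fun n => (hKC _).1.convex (hw n) (hv n) ha hb hab)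
        ((hwx.const_smul a).add (hvy.const_smul b))
    · intro x hx
      obtain ⟨w, hw, hwx⟩ := happrox x hx
      exact hlimmem (fun n => - w n) _ (fun n => (hKC _).1.neg_mem _ (hw n)) hwx.neg
  refine ⟨L, hLb, ?_⟩
  have hsup : sSup (volProd '' C) ≤ volProd L := by
    have hLne : volProd L ≠ ⊤ :=
      ENNReal.mul_ne_top hLc.measure_lt_top.ne
        (polar_isSymBody hLb).isCompact.measure_lt_top.ne
    -- Upper semicontinuity: the supremum is bounded with the loss factor of each `ε`, and then `ε`
    -- tends to zero from the right.
    have hev : ∀ ε > 0, sSup (volProd '' C) ≤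
        ENNReal.ofReal ((1 + ε / δ) ^ N) ^ 2 * volProd L := by
      intro ε hε
      refine le_of_tendsto (hu.comp hφ.tendsto_atTop) ?_
      filter_upwards [hdist.eventually (gt_mem_nhds hε)] with n hn
      rw [Function.comp, ← hKu]
      refine volProd_le_of_near (by positivity) ?_ ?_
      · refine subset_smul_of_near hδ hε hLb.convex hLδ fun x hx => ?_
        exact Metric.exists_dist_lt_of_hausdorffDist_lt hx hn (hne _)
      · refine subset_smul_of_near hδ hε (hKC _).1.convex (hKC _).2.1 fun x hx => ?_
        obtain ⟨y, hy, h⟩ := Metric.exists_dist_lt_of_hausdorffDist_lt' hx hn (hne _)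
        exact ⟨y, hy, by rwa [dist_comm]⟩
    have hlim0 : Tendsto (fun ε : ℝ => ENNReal.ofReal ((1 + ε / δ) ^ N) ^ 2 *
        volProd L) (𝓝[>] 0) (𝓝 (1 * volProd L)) := by
      refine ENNReal.Tendsto.mul_const ?_ (.inr hLne)
      have : Continuous fun ε : ℝ => ENNReal.ofReal ((1 + ε / δ) ^ N) ^ 2 :=
        (ENNReal.continuous_pow 2).comp (ENNReal.continuous_ofReal.comp (by fun_prop))
      have := this.tendsto 0
      simp only [zero_div, add_zero, one_pow, ENNReal.ofReal_one] at this
      exact this.mono_left nhdsWithin_le_nhds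
    rw [one_mul] at hlim0
    exact ge_of_tendsto hlim0 (by filter_upwards [self_mem_nhdsWithin] with ε hε using hev ε hε)
  intro K hK
  obtain ⟨e, he1, he2⟩ := hK.exists_position
  rw [← volProd_preimage e K]
  have hKe : e ⁻¹' K ∈ C := ⟨hK.preimage_equiv e.toContinuousLinearEquiv, he1, he2⟩
  exact (le_sSup (mem_image_of_mem volProd hKe)).trans hsup

end ConvexSym

end

/-! ### Maximal bodies have linear reflections in plane sections -/

noncomputable section

namespace ConvexSym

open Set Filter Topology
open scoped ENNReal Pointwise

/-! ### Functions with common supergradients -/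

/-- Two functions with a common supergradient at each point differ by a constant. -/
theorem sub_eq_sub_of_supergradient {I : Set ℝ} (hI : I.OrdConnected) {F G σ : ℝ → ℝ}
    (hF : ∀ x ∈ I, ∀ y ∈ I, F y - F x ≤ σ x * (y - x))
    (hG : ∀ x ∈ I, ∀ y ∈ I, G y - G x ≤ σ x * (y - x)) {x y : ℝ} (hx : x ∈ I) (hy : y ∈ I)
    (hxy : x ≤ y) : F x - G x = F y - G y := by
  -- The increments of `F` and of `G` both lie between `σ y * (y - x)` and `σ x * (y - x)`.
  have step : ∀ x ∈ I, ∀ y ∈ I, |(F y - G y) - (F x - G x)| ≤ (σ x - σ y) * (y - x) := by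
    intro x hx y hy
    rw [abs_le]
    have h1 := hF x hx y hy
    have h2 := hF y hy x hx
    have h3 := hG x hx y hy
    have h4 := hG y hy x hx
    constructor <;> linarith
  -- On a partition into `n + 1` equal intervals the values of `σ` telescope, which improves the
  -- estimate by the factor `n + 1`.
  have bound : ∀ n : ℕ, |(F y - G y) - (F x - G x)| * (n + 1) ≤ (σ x - σ y) * (y - x) := by
    intro n
    set d := (y - x) / (n + 1) with hd
    have hd0 : 0 ≤ d := div_nonneg (by linarith) (by positivity)
    have hdn : d * (n + 1) = y - x := by rw [hd]; field_simp
    have hm : ∀ i : ℕ, i ≤ n + 1 → x + i * d ∈ I := by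
      intro i hi
      have hi' : (i : ℝ) ≤ n + 1 := by exact_mod_cast hi
      refine hI.out hx hy ⟨le_add_of_nonneg_right (by positivity), ?_⟩
      nlinarith
    have tele : |(F y - G y) - (F x - G x)| ≤ (σ x - σ y) * d := by
      have e1 := Finset.sum_range_sub (fun i : ℕ => F (x + i * d) - G (x + i * d)) (n + 1)
      have e2 := Finset.sum_range_sub' (fun i : ℕ => σ (x + i * d)) (n + 1)
      have hy' : x + ((n + 1 : ℕ) : ℝ) * d = y := by push_cast; linarith
      simp only [hy', Nat.cast_zero, zero_mul, add_zero] at e1 e2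
      rw [← e1, ← e2, Finset.sum_mul]
      refine (Finset.abs_sum_le_sum_abs _ _).trans (Finset.sum_le_sum fun i hi => ?_)
      have hi : i < n + 1 := Finset.mem_range.1 hi
      have := step _ (hm i hi.le) _ (hm (i + 1) hi)
      refine this.trans_eq ?_
      push_cast
      ring
    calc _ ≤ (σ x - σ y) * d * (n + 1) := by gcongr
      _ = _ := by rw [mul_assoc, hdn]
  by_contra hne
  have hpos : 0 < |(F y - G y) - (F x - G x)| := abs_pos.2 fun h => hne (by linarith)
  obtain ⟨n, hn⟩ := exists_nat_gt ((σ x - σ y) * (y - x) / |(F y - G y) - (F x - G x)|)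
  rw [div_lt_iff₀ hpos] at hn
  have := bound n
  nlinarith

/-- A planar convex set such that at the end points of each chord in the second direction there
are supporting lines with opposite slopes, suitably normalized, is symmetric under a linear
reflection in this direction. -/
theorem exists_reflection_of_normals {C : Set (ℝ × ℝ)} (hC : IsSymBody C) {R : ℝ} (hR : 0 < R)
    (hCR : ∀ p ∈ C, p.1 ≤ R)
    (H : ∀ r, 0 < r → r < R → ∃ t₁ t₂ a b s : ℝ, 0 < s ∧ (r, t₁) ∈ C ∧ (r, t₂) ∈ C ∧
      a * r + s * t₁ = 1 ∧ b * r + s * t₂ = -1 ∧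
      ∀ p ∈ C, a * p.1 + s * p.2 ≤ 1 ∧ -1 ≤ b * p.1 + s * p.2) :
    ∃ c : ℝ, ∀ r t, (r, t) ∈ C → (r, 2 * c * r - t) ∈ C := by
  choose! t₁ t₂ a b s hs ht₁ ht₂ ha hb hab using H
  -- The projective substitution `ρ = 1 / r` turns the support lines into `a + s (t₁ ρ) = ρ` and `b
  -- + s (t₂ ρ) = -ρ`. Thus `t₁ ρ` and `-(t₂ ρ)` have the common supergradient `1 / s`, and `(t₁ +
  -- t₂) / r` is constant.
  set I : Set ℝ := Ioi R⁻¹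
  have hI : ∀ ρ ∈ I, 0 < ρ⁻¹ ∧ ρ⁻¹ < R ∧ 0 < ρ := by
    intro ρ hρ
    have h0 : 0 < ρ := (inv_pos.2 hR).trans hρ
    exact ⟨inv_pos.2 h0, inv_lt_of_inv_lt₀ hR hρ, h0⟩
  have const : ∀ r r' : ℝ, 0 < r → r < R → 0 < r' → r' < R →
      (t₁ r + t₂ r) / r = (t₁ r' + t₂ r') / r' := by
    have key : ∀ ρ ∈ I, ∀ ρ' ∈ I, ρ ≤ ρ' →
        t₁ ρ⁻¹ * ρ - (-(t₂ ρ⁻¹ * ρ)) = t₁ ρ'⁻¹ * ρ' - (-(t₂ ρ'⁻¹ * ρ')) := by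
      intro ρ hρ ρ' hρ' hle
      refine sub_eq_sub_of_supergradient (F := fun ρ => t₁ ρ⁻¹ * ρ) (G := fun ρ => -(t₂ ρ⁻¹ * ρ))
        (σ := fun ρ => (s ρ⁻¹)⁻¹) (ordConnected_Ioi (a := R⁻¹)) ?_ ?_ hρ hρ' hle
      · intro x hx y hy
        obtain ⟨x1, x2, x3⟩ := hI x hx
        obtain ⟨y1, y2, y3⟩ := hI y hy
        have h1 := (hab _ x1 x2 _ (ht₁ _ y1 y2)).1
        have h2 := ha _ x1 x2
        have hs' := hs _ x1 x2
        simp only at h1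
        rw [inv_mul_eq_div, le_div_iff₀ hs']
        have e1 : a x⁻¹ + s x⁻¹ * t₁ x⁻¹ * x = x := by
          have := congrArg (· * x) h2
          field_simp at this ⊢
          linarith
        have e2 : a x⁻¹ + s x⁻¹ * t₁ y⁻¹ * y ≤ y := by
          have := mul_le_mul_of_nonneg_right h1 y3.le
          have e : (a x⁻¹ * y⁻¹ + s x⁻¹ * t₁ y⁻¹) * y = a x⁻¹ + s x⁻¹ * t₁ y⁻¹ * y := by
            field_simp
          linarith
        nlinarith
      · intro x hx y hy
        obtain ⟨x1, x2, x3⟩ := hI x hx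
        obtain ⟨y1, y2, y3⟩ := hI y hy
        have h1 := (hab _ x1 x2 _ (ht₂ _ y1 y2)).2
        have h2 := hb _ x1 x2
        have hs' := hs _ x1 x2
        simp only at h1
        rw [inv_mul_eq_div, le_div_iff₀ hs']
        have e1 : b x⁻¹ + s x⁻¹ * t₂ x⁻¹ * x = -x := by
          have := congrArg (· * x) h2
          field_simp at this ⊢
          linarith
        have e2 : -y ≤ b x⁻¹ + s x⁻¹ * t₂ y⁻¹ * y := by
          have := mul_le_mul_of_nonneg_right h1 y3.le
          have e : (b x⁻¹ * y⁻¹ + s x⁻¹ * t₂ y⁻¹) * y = b x⁻¹ + s x⁻¹ * t₂ y⁻¹ * y := by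
            field_simp
          linarith
        nlinarith
    intro r r' h1 h2 h3 h4
    have m1 : r⁻¹ ∈ I := inv_strictAnti₀ h1 h2
    have m2 : r'⁻¹ ∈ I := inv_strictAnti₀ h3 h4
    rcases le_total r⁻¹ r'⁻¹ with h | h
    · have := key _ m1 _ m2 h
      simp only [inv_inv] at this
      rw [div_eq_mul_inv, div_eq_mul_inv]
      linarith
    · have := key _ m2 _ m1 h
      simp only [inv_inv] at this
      rw [div_eq_mul_inv, div_eq_mul_inv]
      linarith
  -- The midpoint of the chord at `r` is `c * r`; the value at `R / 2` determines the constant.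
  set c := (t₁ (R / 2) + t₂ (R / 2)) / (R / 2) / 2 with hc
  have hmid : ∀ r, 0 < r → r < R → t₁ r + t₂ r = 2 * c * r := by
    intro r h1 h2
    have := const r (R / 2) h1 h2 (by linarith) (by linarith)
    rw [hc, ← this]
    field_simp
  -- Since `s > 0`, the two support lines show that the chord is exactly `[t₂ r, t₁ r]`, which is
  -- symmetric about its midpoint `c * r`.
  have hint : ∀ r t, 0 < r → r < R → (r, t) ∈ C → (r, 2 * c * r - t) ∈ C := by
    intro r t h1 h2 hrt
    obtain ⟨h3, h4⟩ := hab r h1 h2 _ hrt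
    simp only at h3 h4
    have hs' := hs r h1 h2
    have u1 : t ≤ t₁ r := by
      have := ha r h1 h2
      exact le_of_mul_le_mul_left (by linarith) hs'
    have u2 : t₂ r ≤ t := by
      have := hb r h1 h2
      exact le_of_mul_le_mul_left (by linarith) hs'
    have hm := hmid r h1 h2
    have hseg : (r, 2 * c * r - t) ∈ segment ℝ (r, t₂ r) (r, t₁ r) := by
      rw [← Prod.image_mk_segment_right, segment_eq_Icc (u2.trans u1)]
      exact ⟨_, ⟨by linarith, by linarith⟩, rfl⟩
    exact hC.convex.segment_subset (ht₂ r h1 h2) (ht₁ r h1 h2) hseg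
  -- The extreme value `r = R` is reached by shrinking the point by `l < 1` and letting `l` tend to
  -- `1`.
  have hpos : ∀ r t, 0 < r → (r, t) ∈ C → (r, 2 * c * r - t) ∈ C := by
    intro r t h1 hrt
    have hcont : Continuous fun l : ℝ => (l * r, 2 * c * (l * r) - l * t) := by fun_prop
    have hlim : Tendsto (fun l : ℝ => (l * r, 2 * c * (l * r) - l * t)) (𝓝[<] 1)
        (𝓝 (r, 2 * c * r - t)) := by
      have := hcont.tendsto 1
      simp only [one_mul] at this
      exact this.mono_left nhdsWithin_le_nhds
    refine hC.isCompact.isClosed.mem_of_tendsto hlim ?_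
    filter_upwards [Ioo_mem_nhdsLT (zero_lt_one' ℝ)] with l hl
    have hle := hCR _ hrt
    simp only at hle
    refine hint _ _ (mul_pos hl.1 h1) (by nlinarith [hl.1, hl.2]) ?_
    have := hC.smul_mem hrt (c := l) (by rw [abs_of_pos hl.1]; exact hl.2.le)
    simpa using this
  refine ⟨c, fun r t hrt => ?_⟩
  rcases lt_trichotomy r 0 with h | h | h
  · have h1 := hpos (-r) (-t) (by linarith) (by simpa using hC.neg_mem _ hrt)
    have h2 := hC.neg_mem _ h1
    convert! h2 using 1
    simp only [Prod.neg_mk, neg_neg, Prod.mk.injEq, true_and]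
    ring
  · subst h
    simpa using hC.neg_mem _ hrt
  · exact hpos r t h hrt

/-! ### The symmetrization step -/

section Symmetrization

variable {k : ℕ} {K : Set (Fin (k + 1) → ℝ)}

theorem cons_dot {k : ℕ} (t s : ℝ) (X Y : Fin k → ℝ) :
    (Fin.cons t X : Fin (k + 1) → ℝ) ⬝ᵥ (Fin.cons s Y : Fin (k + 1) → ℝ) = t * s + X ⬝ᵥ Y := by
  simp [dotProduct, Fin.sum_univ_succ]

/-- The Steiner symmetral in the direction of the first coordinate. -/
def steiner (K : Set (Fin (k + 1) → ℝ)) : Set (Fin (k + 1) → ℝ) :=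
  {x | ∃ (t t' : ℝ) (X : Fin k → ℝ), (Fin.cons t X : Fin (k + 1) → ℝ) ∈ K ∧
    (Fin.cons t' X : Fin (k + 1) → ℝ) ∈ K ∧ x = Fin.cons ((1 / 2 : ℝ) * (t - t')) X}

/-- The fiberwise difference body with respect to all coordinates but the first. -/
def fiberDiff (K : Set (Fin (k + 1) → ℝ)) : Set (Fin (k + 1) → ℝ) :=
  {x | ∃ (X X' : Fin k → ℝ) (t : ℝ), (Fin.cons t X : Fin (k + 1) → ℝ) ∈ K ∧
    (Fin.cons t X' : Fin (k + 1) → ℝ) ∈ K ∧ x = Fin.cons t ((1 / 2 : ℝ) • (X - X'))}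

theorem isCompact_steiner (hK : IsCompact K) : IsCompact (steiner K) := by
  have hc : IsCompact ({p : (Fin (k + 1) → ℝ) × (Fin (k + 1) → ℝ) | p.1 ∈ K ∧ p.2 ∈ K} ∩
      {p | ∀ i : Fin k, p.1 i.succ = p.2 i.succ}) := by
    refine (hK.prod hK).inter_right ?_
    simp only [ofPred_forall]
    exact isClosed_iInter fun i => isClosed_eq (by fun_prop) (by fun_prop)
  have := hc.image (f := fun p => (Fin.cons ((1 / 2 : ℝ) * (p.1 0 - p.2 0)) (Fin.tail p.1) :
    Fin (k + 1) → ℝ)) (by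
      refine continuous_pi fun i => ?_
      refine Fin.cases ?_ (fun j => ?_) i
      · simp only [Fin.cons_zero]; fun_prop
      · simp only [Fin.cons_succ, Fin.tail]; fun_prop)
  convert! this using 1
  ext x
  constructor
  · rintro ⟨t, t', X, h1, h2, rfl⟩
    exact ⟨((Fin.cons t X : Fin (k + 1) → ℝ), (Fin.cons t' X : Fin (k + 1) → ℝ)),
      ⟨⟨h1, h2⟩, fun i => by simp⟩, by simp⟩
  · rintro ⟨⟨p, q⟩, ⟨⟨h1, h2⟩, h3⟩, rfl⟩
    have e : Fin.tail q = Fin.tail p := by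
      funext i
      exact (h3 i).symm
    refine ⟨p 0, q 0, Fin.tail p, by simpa using h1, ?_, rfl⟩
    rw [← e]
    simpa using h2

theorem isCompact_fiberDiff (hK : IsCompact K) : IsCompact (fiberDiff K) := by
  have hc : IsCompact ({p : (Fin (k + 1) → ℝ) × (Fin (k + 1) → ℝ) | p.1 ∈ K ∧ p.2 ∈ K} ∩
      {p | p.1 0 = p.2 0}) :=
    (hK.prod hK).inter_right (isClosed_eq (by fun_prop) (by fun_prop))
  have := hc.image (f := fun p => (Fin.cons (p.1 0) ((1 / 2 : ℝ) • (Fin.tail p.1 - Fin.tail p.2)) :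
    Fin (k + 1) → ℝ)) (by
      refine continuous_pi fun i => ?_
      refine Fin.cases ?_ (fun j => ?_) i
      · simp only [Fin.cons_zero]; fun_prop
      · simp only [Fin.cons_succ, Fin.tail, Pi.smul_apply, Pi.sub_apply]; fun_prop)
  convert! this using 1
  ext x
  constructor
  · rintro ⟨X, X', t, h1, h2, rfl⟩
    exact ⟨((Fin.cons t X : Fin (k + 1) → ℝ), (Fin.cons t X' : Fin (k + 1) → ℝ)),
      ⟨⟨h1, h2⟩, by simp⟩, by simp⟩
  · rintro ⟨⟨p, q⟩, ⟨⟨h1, h2⟩, h3⟩, rfl⟩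
    refine ⟨Fin.tail p, Fin.tail q, p 0, by simpa using h1, ?_, rfl⟩
    rw [show p 0 = q 0 from h3]
    simpa using h2

theorem cons_add_smul (a b t t' : ℝ) (X X' : Fin k → ℝ) :
    a • (Fin.cons t X : Fin (k + 1) → ℝ) + b • (Fin.cons t' X' : Fin (k + 1) → ℝ) =
      Fin.cons (a * t + b * t') (a • X + b • X') := by
  ext i
  refine Fin.cases ?_ (fun j => ?_) i <;> simp

theorem neg_cons (t : ℝ) (X : Fin k → ℝ) :
    -(Fin.cons t X : Fin (k + 1) → ℝ) = Fin.cons (-t) (-X) := by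
  ext i
  refine Fin.cases ?_ (fun j => ?_) i <;> simp

theorem smul_cons (c t : ℝ) (X : Fin k → ℝ) :
    c • (Fin.cons t X : Fin (k + 1) → ℝ) = Fin.cons (c * t) (c • X) := by
  ext i
  refine Fin.cases ?_ (fun j => ?_) i <;> simp

theorem norm_cons_neg (t : ℝ) (X : Fin k → ℝ) {r : ℝ}
    (h : (Fin.cons t X : Fin (k + 1) → ℝ) ∈ Metric.closedBall 0 r) :
    (Fin.cons (-t) X : Fin (k + 1) → ℝ) ∈ Metric.closedBall 0 r := by
  rw [mem_closedBall_zero_iff] at h ⊢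
  have hr := (norm_nonneg _).trans h
  rw [pi_norm_le_iff_of_nonneg hr] at h ⊢
  intro i
  have := h i
  revert this
  refine Fin.cases ?_ (fun j => ?_) i <;> simp

theorem isSymBody_steiner (hK : IsSymBody K) : IsSymBody (steiner K) := by
  refine ⟨?_, isCompact_steiner hK.isCompact, ?_, ?_⟩
  · rintro _ ⟨t, t', X, h1, h2, rfl⟩ _ ⟨s, s', Y, h3, h4, rfl⟩ a b ha hb hab
    have e1 := hK.convex h1 h3 ha hb hab
    have e2 := hK.convex h2 h4 ha hb hab
    rw [cons_add_smul] at e1 e2 ⊢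
    refine ⟨_, _, _, e1, e2, ?_⟩
    congr 1
    ring
  · rintro _ ⟨t, t', X, h1, h2, rfl⟩
    have e1 := hK.neg_mem _ h1
    have e2 := hK.neg_mem _ h2
    rw [neg_cons] at e1 e2 ⊢
    refine ⟨_, _, _, e1, e2, ?_⟩
    congr 1
    ring
  · obtain ⟨r, hr, hrK⟩ := hK.exists_closedBall_subset
    rw [mem_interior_iff_mem_nhds]
    refine mem_of_superset (Metric.closedBall_mem_nhds _ hr) fun x hx => ?_
    obtain ⟨t, X, rfl⟩ : ∃ (t : ℝ) (X : Fin k → ℝ), x = Fin.cons t X :=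
      ⟨x 0, Fin.tail x, by simp⟩
    refine ⟨t, -t, X, hrK hx, hrK (norm_cons_neg t X hx), ?_⟩
    congr 1
    ring

/-- This is the average of two polar constraints: `(s, Y)` tested on `(t, X)`, and `(s, Y')` tested
on `-(t', X)`. The shared coordinates `s` and `X` make the mixed terms combine. -/
theorem fiberDiff_polar_subset (hK : IsSymBody K) :
    fiberDiff (polar K) ⊆ polar (steiner K) := by
  rintro _ ⟨Y, Y', s, h1, h2, rfl⟩ _ ⟨t, t', X, h3, h4, rfl⟩
  have e1 := h1 _ h3
  have e2 := h2 _ (hK.neg_mem _ h4)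
  rw [neg_cons] at e2
  rw [cons_dot] at e1 e2 ⊢
  rw [dotProduct_smul, dotProduct_sub, smul_eq_mul]
  rw [neg_dotProduct] at e2
  linarith

/-- The open set `interior L \ M` is null and therefore empty, and a convex body is the closure of
its interior. -/
theorem subset_of_volume_le {V : Type*} [NormedAddCommGroup V] [NormedSpace ℝ V]
    [MeasureSpace V] [BorelSpace V] [(volume : Measure V).IsOpenPosMeasure] {M L : Set V}
    (hM : IsClosed M) (hL : IsSymBody L) (hML : M ⊆ L) (hv : volume L ≤ volume M)
    (hfin : volume M ≠ ⊤) : L ⊆ M := by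
  have h0 : volume (L \ M) = 0 := by
    rw [measure_sdiff hML hM.measurableSet.nullMeasurableSet hfin]
    exact tsub_eq_zero_of_le hv
  have h1 : interior L \ M = ∅ := by
    rw [← (isOpen_interior.sdiff hM).measure_eq_zero_iff (volume : Measure V)]
    exact measure_mono_null (sdiff_subset_sdiff_left interior_subset) h0
  have h2 : interior L ⊆ M := sdiff_eq_empty.1 h1
  calc L = closure (interior L) := by
        rw [hL.convex.closure_interior_eq_closure_of_nonempty_interior
          ⟨0, hL.zero_mem_interior⟩, hL.isCompact.isClosed.closure_eq]
    _ ⊆ M := closure_minimal h2 hM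

/-- For a body of maximal volume product, the polar of the Steiner symmetral is obtained from the
polar by a fiberwise difference. -/
theorem polar_steiner_subset (hK : IsSymBody K)
    (hmax : ∀ L : Set (Fin (k + 1) → ℝ), IsSymBody L → volProd L ≤ volProd K) :
    polar (steiner K) ⊆ fiberDiff (polar K) := by
  have hS := isSymBody_steiner hK
  have hP := polar_isSymBody hK
  have hPS := polar_isSymBody hS
  have hM := isCompact_fiberDiff hP.isCompact
  have v1 : volume K ≤ volume (steiner K) :=
    volume_le_of_head hK.isCompact.measurableSet hS.isCompact.measurableSet
      fun t t' X h1 h2 => ⟨t, t', X, h1, h2, rfl⟩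
  have v2 : volume (polar K) ≤ volume (fiberDiff (polar K)) :=
    volume_le_of_tail hP.isCompact.measurableSet hM.measurableSet
      fun X X' t h1 h2 => ⟨X, X', t, h1, h2, rfl⟩
  have hpos : volume (steiner K) ≠ 0 :=
    (Measure.measure_pos_of_mem_nhds _ hS.mem_nhds).ne'
  refine subset_of_volume_le hM.isClosed hPS (fiberDiff_polar_subset hK) ?_ hM.measure_lt_top.ne
  have h := hmax _ hS
  -- Maximality bounds the volume product of the symmetral by that of `K`, and symmetrization
  -- decreases neither factor; cancelling `volume (steiner K)` leaves the reverse volume inequality.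
  have h' : volume (steiner K) * volume (polar (steiner K)) ≤
      volume (steiner K) * volume (fiberDiff (polar K)) :=
    h.trans (mul_le_mul' v1 v2)
  exact (ENNReal.mul_le_mul_iff_right hpos hS.isCompact.measure_lt_top.ne).1 h'

/-- The reflection property of bodies with maximal volume product, for the first coordinate. -/
theorem exists_reflection_cons (hK : IsSymBody K)
    (hmax : ∀ L : Set (Fin (k + 1) → ℝ), IsSymBody L → volProd L ≤ volProd K)
    {θ : Fin k → ℝ} (hθ : θ ≠ 0) :
    ∃ c : ℝ, ∀ r t : ℝ, (Fin.cons t (r • θ) : Fin (k + 1) → ℝ) ∈ K →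
      (Fin.cons (2 * c * r - t) (r • θ) : Fin (k + 1) → ℝ) ∈ K := by
  -- The plane through the first axis and `θ`: the chord direction is the second coordinate `t`, and
  -- `r` is the coefficient of `θ`.
  let e : (ℝ × ℝ) →ₗ[ℝ] (Fin (k + 1) → ℝ) :=
    { toFun := fun p => Fin.cons p.2 (p.1 • θ)
      map_add' := fun p q => by
        have := cons_add_smul 1 1 p.2 q.2 (p.1 • θ) (q.1 • θ)
        simp only [one_smul, one_mul] at this
        rw [this, Prod.fst_add, Prod.snd_add, add_smul]
      map_smul' := fun c p => by
        rw [RingHom.id_apply, smul_cons, Prod.smul_fst, Prod.smul_snd, smul_eq_mul, smul_eq_mul,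
          mul_smul] }
  have he : ∀ p : ℝ × ℝ, e p = Fin.cons p.2 (p.1 • θ) := fun p => rfl
  have heinj : Function.Injective e := by
    rw [← LinearMap.ker_eq_bot, LinearMap.ker_eq_bot']
    intro p hp
    rw [he] at hp
    have h0 : p.2 = 0 := by simpa using congrFun hp 0
    have h1 : p.1 • θ = 0 := by
      funext i
      simpa using congrFun hp i.succ
    exact Prod.ext ((smul_eq_zero.1 h1).resolve_right hθ) h0
  have hcl : Topology.IsClosedEmbedding e :=
    LinearMap.isClosedEmbedding_of_injective (LinearMap.ker_eq_bot.2 heinj)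
  set C : Set (ℝ × ℝ) := e ⁻¹' K with hC
  have hCb : IsSymBody C := by
    refine ⟨hK.convex.linear_preimage e, hcl.isCompact_preimage hK.isCompact, fun x hx => ?_, ?_⟩
    · have := hK.neg_mem _ hx
      simpa [hC] using this
    · rw [mem_interior_iff_mem_nhds]
      refine hcl.continuous.continuousAt.preimage_mem_nhds ?_
      rw [map_zero]
      exact hK.mem_nhds
  suffices h : ∃ c : ℝ, ∀ r t, (r, t) ∈ C → (r, 2 * c * r - t) ∈ C from h
  obtain ⟨δ, hδ, hδC⟩ := hCb.exists_closedBall_subset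
  have hδ1 : (δ, (0 : ℝ)) ∈ C := hδC (by simp [Prod.norm_def, abs_of_pos hδ, hδ.le])
  have hδ2 : ((0 : ℝ), δ) ∈ C := hδC (by simp [Prod.norm_def, abs_of_pos hδ, hδ.le])
  obtain ⟨⟨R, tR⟩, hRC, hRmax⟩ := hCb.isCompact.exists_isMaxOn ⟨0, hCb.zero_mem⟩
    (f := fun p : ℝ × ℝ => p.1) (by fun_prop)
  have hRmax : ∀ p ∈ C, p.1 ≤ R := fun p hp => hRmax hp
  have hR : 0 < R := hδ.trans_le (hRmax _ hδ1)
  refine exists_reflection_of_normals hCb hR hRmax fun r hr hrR => ?_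
  have hsl : IsCompact {p ∈ C | p.1 = r} :=
    hCb.isCompact.inter_right (isClosed_eq continuous_fst continuous_const)
  have hrR0 : 0 < r / R := div_pos hr hR
  have hrR1 : r / R < 1 := (div_lt_one hR).2 hrR
  -- Mixing an extreme point over `R` with the points `(0, ε * δ)` shows that the chord at `r < R`
  -- has positive length.
  have hpm : ∀ ε : ℝ, |ε| ≤ 1 → (r, r / R * tR + (1 - r / R) * (ε * δ)) ∈ C := by
    intro ε hε
    have := hCb.convex hRC (hCb.smul_mem hδ2 hε) hrR0.le (sub_nonneg.2 hrR1.le) (by ring)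
    convert! this using 1
    simp only [Prod.smul_mk, smul_eq_mul, Prod.mk_add_mk, Prod.mk.injEq, and_true, mul_zero,
      add_zero]
    field_simp
  obtain ⟨⟨r₁, t₁⟩, ⟨h1C, h1r⟩, h1max⟩ := hsl.exists_isMaxOn ⟨_, hpm 1 (by simp), rfl⟩
    (f := fun p : ℝ × ℝ => p.2) (by fun_prop)
  obtain ⟨⟨r₂, t₂⟩, ⟨h2C, h2r⟩, h2min⟩ := hsl.exists_isMinOn ⟨_, hpm 1 (by simp), rfl⟩
    (f := fun p : ℝ × ℝ => p.2) (by fun_prop)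
  simp only at h1r h2r
  subst h1r
  subst h2r
  have h1max : ∀ t, (r₂, t) ∈ C → t ≤ t₁ := fun t ht => h1max (a := (r₂, t)) ⟨ht, rfl⟩
  have h2min : ∀ t, (r₂, t) ∈ C → t₂ ≤ t := fun t ht => h2min (a := (r₂, t)) ⟨ht, rfl⟩
  have hlt : t₂ < t₁ := by
    have e1 := h1max _ (hpm 1 (by simp))
    have e2 := h2min _ (hpm (-1) (by simp))
    have : 0 < (1 - r₂ / R) * δ := mul_pos (by linarith) hδ
    linarith
  -- The end of the symmetrized chord is a boundary point of the symmetral: if a dilate lay inside,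
  -- a convex combination with a point of the axis would give a half-chord longer than the maximum.
  have hnot : ∀ c : ℝ, 1 < c →
      c • (Fin.cons ((1 / 2 : ℝ) * (t₁ - t₂)) (r₂ • θ) : Fin (k + 1) → ℝ) ∉ steiner K := by
    intro c hc hmem
    have hS := isSymBody_steiner hK
    have hδS : (Fin.cons δ 0 : Fin (k + 1) → ℝ) ∈ steiner K := by
      have e1 : (Fin.cons δ 0 : Fin (k + 1) → ℝ) ∈ K := by
        have : e (0, δ) ∈ K := hδ2
        rwa [he, zero_smul] at this
      have e2 := hK.neg_mem _ e1
      rw [neg_cons, neg_zero] at e2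
      refine ⟨_, _, _, e1, e2, ?_⟩
      congr 1
      ring
    have hc0 : 0 < c := by linarith
    have hc1 : c⁻¹ < 1 := inv_lt_one_of_one_lt₀ hc
    have := hS.convex hmem hδS (inv_pos.2 hc0).le (sub_nonneg.2 hc1.le) (by ring)
    rw [smul_smul, inv_mul_cancel₀ hc0.ne', cons_add_smul] at this
    obtain ⟨t, t', X, m1, m2, h⟩ := this
    obtain ⟨h3, h4⟩ := Fin.cons_injective2 h
    simp only [one_smul, smul_zero, add_zero] at h4
    subst h4
    have := h1max t m1
    have := h2min t' m2
    have : 0 < (1 - c⁻¹) * δ := mul_pos (by linarith) hδ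
    linarith
  obtain ⟨y, hy, hy1⟩ := exists_polar_ge_one (isSymBody_steiner hK) hnot
  -- The support functional of the symmetral splits into two functionals in the polar of `K` with
  -- the same `s`. Each contributes at most `1` at its end of the chord and their mean is at least
  -- `1`, so both support `K` there.
  obtain ⟨Y, Y', s, hY, hY', rfl⟩ := polar_steiner_subset hK hmax hy
  have hYp : ∀ p ∈ C, (θ ⬝ᵥ Y) * p.1 + s * p.2 ≤ 1 := by
    intro p hp
    have := hY _ hp
    rw [he, cons_dot, smul_dotProduct, smul_eq_mul] at this
    linarith
  have hYp' : ∀ p ∈ C, -1 ≤ (θ ⬝ᵥ Y') * p.1 + s * p.2 := by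
    intro p hp
    have := hY' _ (hK.neg_mem _ hp)
    rw [he, neg_cons, cons_dot, neg_dotProduct, smul_dotProduct, smul_eq_mul] at this
    linarith
  rw [cons_dot, smul_dotProduct, dotProduct_smul, dotProduct_sub, smul_eq_mul, smul_eq_mul] at hy1
  have a1 := hYp _ h1C
  have a2 := hYp' _ h2C
  have b1 := hYp _ hRC
  have b2 := hYp' _ hRC
  simp only at a1 a2 b1 b2
  refine ⟨t₁, t₂, θ ⬝ᵥ Y, θ ⬝ᵥ Y', s, ?_, h1C, h2C, by linarith, by linarith,
    fun p hp => ⟨hYp p hp, hYp' p hp⟩⟩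
  set A := θ ⬝ᵥ Y
  set B := θ ⬝ᵥ Y'
  -- Positivity of `s`: the two support inequalities at the point over `R` bound the slope
  -- difference, so that `s * (t₁ - t₂) = 2 - (A - B) * r₂` is positive because `r₂ < R`.
  have q1 : (A - B) * R ≤ 2 := by linarith
  have q2 : s * (t₁ - t₂) = 2 - (A - B) * r₂ := by linarith
  have q3 : (A - B) * r₂ < 2 := by
    have : (A - B) * r₂ = (A - B) * R * (r₂ / R) := by field_simp
    rw [this]
    nlinarith
  have q4 : 0 < s * (t₁ - t₂) := by linarith
  exact pos_of_mul_pos_left q4 (by linarith)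

end Symmetrization

/-- The reflection property of bodies with maximal volume product. -/
theorem exists_reflection {N : ℕ} {K : Set (Fin N → ℝ)} (hK : IsSymBody K)
    (hmax : ∀ L : Set (Fin N → ℝ), IsSymBody L → volProd L ≤ volProd K)
    {u w : Fin N → ℝ} (huw : LinearIndependent ℝ ![u, w]) :
    ∃ c : ℝ, ∀ r t : ℝ, r • w + t • u ∈ K → r • w + (2 * c * r - t) • u ∈ K := by
  obtain ⟨k, rfl⟩ : ∃ k, N = k + 1 := by
    refine Nat.exists_eq_succ_of_ne_zero ?_
    rintro rfl
    exact huw.ne_zero 0 (Subsingleton.elim _ _)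
  have hu : u ≠ 0 := huw.ne_zero 0
  obtain ⟨e, he⟩ : ∃ e : (Fin (k + 1) → ℝ) ≃ₗ[ℝ] (Fin (k + 1) → ℝ),
      e (Fin.cons 1 0) = u := by
    have h1 : (Fin.cons 1 0 : Fin (k + 1) → ℝ) ≠ 0 := fun h => by simpa using congrFun h 0
    obtain ⟨e, he⟩ := SeparatingDual.exists_continuousLinearEquiv_apply_eq (R := ℝ) h1 hu
    exact ⟨e.toLinearEquiv, he⟩
  set L := e ⁻¹' K
  have hL : IsSymBody L := hK.preimage_equiv e.toContinuousLinearEquiv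
  have hLmax : ∀ L' : Set (Fin (k + 1) → ℝ), IsSymBody L' → volProd L' ≤ volProd L := fun L' h =>
    (hmax L' h).trans_eq (volProd_preimage e K).symm
  obtain ⟨a, θ, hw⟩ : ∃ (a : ℝ) (θ : Fin k → ℝ), e.symm w = Fin.cons a θ :=
    ⟨e.symm w 0, Fin.tail (e.symm w), by simp⟩
  have hw' : w = e (Fin.cons a θ) := by rw [← hw, LinearEquiv.apply_symm_apply]
  have hθ : θ ≠ 0 := by
    rintro rfl
    rw [LinearIndependent.pair_iff] at huw
    have := huw a (-1) (by
      rw [hw', ← he, ← map_smul, ← map_smul, ← map_add, cons_add_smul]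
      convert map_zero e
      ext i
      refine Fin.cases ?_ (fun j => ?_) i <;> simp)
    norm_num at this
  obtain ⟨c, hc⟩ := exists_reflection_cons hL hLmax hθ
  have key : ∀ r t : ℝ, r • w + t • u = e (Fin.cons (r * a + t) (r • θ)) := by
    intro r t
    rw [hw', ← he, ← map_smul, ← map_smul, ← map_add, cons_add_smul]
    simp
  -- In the new coordinates `w` has first coordinate `a`, which shears the line of midpoints by `a`.
  refine ⟨c - a, fun r t h => ?_⟩
  rw [key] at h ⊢
  have := hc r _ h
  rwa [show r * a + (2 * (c - a) * r - t) = 2 * c * r - (r * a + t) by ring]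

end ConvexSym

end

/-! ### From reflections to ellipses and the parallelogram law -/

noncomputable section

namespace ConvexSym

open Set Filter Topology
open scoped ENNReal Pointwise

/-- The standard area form of the plane. -/
def area (x y : ℝ × ℝ) : ℝ := x.1 * y.2 - x.2 * y.1

theorem area_expand {u v : ℝ × ℝ} (h : area u v ≠ 0) (x : ℝ × ℝ) :
    x = (area u x / area u v) • v + (area x v / area u v) • u := by
  simp only [area] at *
  ext
  · simp only [Prod.fst_add, Prod.smul_fst, smul_eq_mul]
    field_simp
    ring
  · simp only [Prod.snd_add, Prod.smul_snd, smul_eq_mul]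
    field_simp
    ring

/-- The linear reflection which fixes `v` and maps `u` to `-u`. -/
def planeReflection (u v : ℝ × ℝ) : (ℝ × ℝ) →ₗ[ℝ] (ℝ × ℝ) where
  toFun x := x - (2 * area x v / area u v) • u
  map_add' x y := by
    ext <;> simp [area] <;> ring
  map_smul' c x := by
    ext <;> simp [area] <;> ring

theorem planeReflection_apply (u v x : ℝ × ℝ) :
    planeReflection u v x = x - (2 * area x v / area u v) • u := rfl

theorem area_planeReflection {u v : ℝ × ℝ} (h : area u v ≠ 0) (x y : ℝ × ℝ) :
    area (planeReflection u v x) (planeReflection u v y) = -area x y := by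
  have hm : ∀ z : ℝ × ℝ, 2 * area z v / area u v * area u v = 2 * area z v := fun z =>
    div_mul_cancel₀ _ h
  have hx := hm x
  have hy := hm y
  rw [planeReflection_apply, planeReflection_apply]
  refine mul_right_cancel₀ h ?_
  set a := 2 * area x v / area u v
  set b := 2 * area y v / area u v
  simp only [area, Prod.fst_sub, Prod.snd_sub, Prod.smul_fst, Prod.smul_snd, smul_eq_mul] at *
  linear_combination (-(x.1 * u.2 - x.2 * u.1)) * hy - (u.1 * y.2 - u.2 * y.1) * hx

theorem area_planeReflection_right {u v : ℝ × ℝ} (h : area u v ≠ 0) (x : ℝ × ℝ) :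
    area (planeReflection u v x) v = -area x v := by
  have hm : 2 * area x v / area u v * area u v = 2 * area x v := div_mul_cancel₀ _ h
  rw [planeReflection_apply]
  set a := 2 * area x v / area u v
  simp only [area, Prod.fst_sub, Prod.snd_sub, Prod.smul_fst, Prod.smul_snd, smul_eq_mul] at *
  linear_combination -hm

theorem planeReflection_involutive {u v : ℝ × ℝ} (h : area u v ≠ 0) :
    Function.Involutive (planeReflection u v) := by
  intro x
  rw [planeReflection_apply, area_planeReflection_right h, planeReflection_apply, mul_neg, neg_div,
    neg_smul, sub_neg_eq_add, sub_add_cancel]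

/-- The determinant of an involution is `1` or `-1`. -/
theorem measurePreserving_planeReflection {u v : ℝ × ℝ} (h : area u v ≠ 0) :
    MeasurePreserving (planeReflection u v) := by
  have hinv := planeReflection_involutive h
  have hd : LinearMap.det (planeReflection u v) * LinearMap.det (planeReflection u v) = 1 := by
    rw [← LinearMap.det_comp]
    have : planeReflection u v ∘ₗ planeReflection u v = LinearMap.id :=
      LinearMap.ext fun x => hinv x
    rw [this, LinearMap.det_id]
  have hd0 : LinearMap.det (planeReflection u v) ≠ 0 := by
    intro h0
    rw [h0] at hd
    simp at hd
  refine ⟨(LinearMap.continuous_of_finiteDimensional _).measurable, ?_⟩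
  rw [Measure.map_linearMap_addHaar_eq_smul_addHaar _ hd0]
  have : |(LinearMap.det (planeReflection u v))⁻¹| = 1 := by
    rcases mul_self_eq_one_iff.1 hd with h | h <;> simp [h]
  rw [this]
  simp

/-- A planar symmetric body with a linear reflection in each direction is an ellipse: its gauge
is determined by a positive definite quadratic form. -/
theorem exists_quadratic_of_reflections {C : Set (ℝ × ℝ)} (hC : IsSymBody C)
    (hrefl : ∀ u : ℝ × ℝ, u ≠ 0 → ∃ v, area u v ≠ 0 ∧
      ∀ r t : ℝ, r • v + t • u ∈ C → r • v - t • u ∈ C) :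
    ∃ α β γ : ℝ, ∀ x : ℝ × ℝ,
      gauge C x ^ 2 = α * x.1 ^ 2 + β * (x.1 * x.2) + γ * x.2 ^ 2 := by
  set α := ∫ z in C, z.2 ^ 2 with hα
  set β := ∫ z in C, z.1 * z.2 with hβ
  set γ := ∫ z in C, z.1 ^ 2 with hγ
  -- The inertia form of `C`. Reflections of `C` preserve Lebesgue measure and change the area form
  -- only by a sign, so they are isometries of this positive definite form.
  let q : ℝ × ℝ → ℝ := fun x => ∫ z in C, area x z ^ 2
  have hint : ∀ f : ℝ × ℝ → ℝ, Continuous f → IntegrableOn f C := fun f hf =>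
    hf.continuousOn.integrableOn_compact hC.isCompact
  have hq : ∀ x, q x = α * x.1 ^ 2 - 2 * β * (x.1 * x.2) + γ * x.2 ^ 2 := by
    intro x
    have e : ∀ z : ℝ × ℝ, area x z ^ 2 =
        x.1 ^ 2 * z.2 ^ 2 - (2 * (x.1 * x.2)) * (z.1 * z.2) + x.2 ^ 2 * z.1 ^ 2 := fun z => by
      simp only [area]; ring
    have i1 := (hint (fun z => z.2 ^ 2) (by fun_prop)).const_mul (x.1 ^ 2)
    have i2 := (hint (fun z => z.1 * z.2) (by fun_prop)).const_mul (2 * (x.1 * x.2))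
    have i3 := (hint (fun z => z.1 ^ 2) (by fun_prop)).const_mul (x.2 ^ 2)
    show ∫ z in C, area x z ^ 2 = _
    simp only [e]
    rw [integral_add (f := fun z : ℝ × ℝ => x.1 ^ 2 * z.2 ^ 2 - 2 * (x.1 * x.2) * (z.1 * z.2))
      (i1.sub i2) i3, integral_sub i1 i2, integral_const_mul, integral_const_mul,
      integral_const_mul]
    ring
  have hqpos : ∀ x, x ≠ 0 → 0 < q x := by
    intro x hx
    have hx2 : 0 < x.1 ^ 2 + x.2 ^ 2 := by
      by_contra! h
      exact hx (Prod.ext (by simp; nlinarith [sq_nonneg x.1, sq_nonneg x.2])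
        (by simp; nlinarith [sq_nonneg x.1, sq_nonneg x.2]))
    have hcont : Continuous fun z : ℝ × ℝ => area x z ^ 2 := by unfold area; fun_prop
    have hpos := (setIntegral_pos_iff_support_of_nonneg_ae (μ := volume) (s := C)
      (f := fun z => area x z ^ 2) (.of_forall fun z => sq_nonneg _) (hint _ hcont)).2
    refine hpos ?_
    have ho : IsOpen (Function.support (fun z => area x z ^ 2) ∩ interior C) :=
      hcont.isOpen_support.inter isOpen_interior
    refine lt_of_lt_of_le (ho.measure_pos volume ?_) (measure_mono (inter_subset_inter_right _
      interior_subset))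
    have hc : Continuous fun ε : ℝ => ε • ((-x.2, x.1) : ℝ × ℝ) := by fun_prop
    have hnear : ∀ᶠ ε : ℝ in 𝓝 0, ε • ((-x.2, x.1) : ℝ × ℝ) ∈ interior C := by
      refine hc.continuousAt.eventually_mem ?_
      rw [zero_smul]
      exact isOpen_interior.mem_nhds hC.zero_mem_interior
    obtain ⟨ε, hε, hε0⟩ := ((hnear.filter_mono nhdsWithin_le_nhds).and
      (self_mem_nhdsWithin (s := Ioi (0 : ℝ)))).exists
    have hε0 : 0 < ε := hε0
    refine ⟨_, ?_, hε⟩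
    simp only [Function.mem_support, area, Prod.smul_fst, Prod.smul_snd, smul_eq_mul]
    have : x.1 * (ε * x.1) - x.2 * (ε * -x.2) = ε * (x.1 ^ 2 + x.2 ^ 2) := by ring
    rw [this]
    positivity
  have hinv : ∀ u v : ℝ × ℝ, area u v ≠ 0 →
      (∀ r t : ℝ, r • v + t • u ∈ C → r • v - t • u ∈ C) → q (u + v) = q (v - u) := by
    intro u v huv h
    have hmaps : ∀ x ∈ C, planeReflection u v x ∈ C := by
      intro x hx
      have e := area_expand huv x
      have h1 := h (area u x / area u v) (area x v / area u v) (by rwa [← e])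
      convert! h1 using 1
      rw [planeReflection_apply, mul_div_assoc]
      set a := area u x / area u v
      set b := area x v / area u v
      rw [sub_eq_iff_eq_add]
      refine e.trans ?_
      module
    have hpre : planeReflection u v ⁻¹' C = C := by
      refine Subset.antisymm (fun x hx => ?_) hmaps
      rw [← planeReflection_involutive huv x]
      exact hmaps _ hx
    have hme : MeasurableEmbedding (planeReflection u v) :=
      ((LinearEquiv.ofInvolutive _ (planeReflection_involutive
        huv)).toContinuousLinearEquiv.toHomeomorph).measurableEmbedding
    have e := (measurePreserving_planeReflection huv).setIntegral_preimage_emb hme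
      (fun z => area (planeReflection u v (u + v)) z ^ 2) C
    rw [hpre] at e
    simp only [area_planeReflection huv, neg_sq] at e
    have e2 : planeReflection u v (u + v) = v - u := by
      have e3 : area (u + v) v = area u v := by simp only [area, Prod.fst_add, Prod.snd_add]; ring
      rw [planeReflection_apply, e3, mul_div_assoc, div_self huv]
      module
    rw [e2] at e
    exact e
  -- The reflection in the direction `x - y` fixes a vector `v` that is `q`-orthogonal to `x - y`.
  -- If `q x = q y`, then `x + y` is also `q`-orthogonal to `x - y`, hence a multiple of `v`, and
  -- the reflection exchanges `x` and `y`. The gauge therefore depends on `q` alone.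
  have hle : ∀ x y, q x = q y → gauge C y ≤ gauge C x := by
    intro x y hxy
    by_cases hne : x = y
    · rw [hne]
    have hx : x ≠ 0 := by
      rintro rfl
      have h0 : q 0 = 0 := by rw [hq]; simp
      exact (hqpos y (Ne.symm hne)).ne' (by rw [← hxy, h0])
    obtain ⟨v, huv, hv⟩ := hrefl (x - y) (sub_ne_zero.2 hne)
    have horth := hinv _ _ huv hv
    have e := area_expand huv (x + y)
    set a := area (x - y) (x + y) / area (x - y) v
    set b := area (x + y) v / area (x - y) v
    -- The `q`-inner product of `x + y = a • v + b • (x - y)` with `x - y` is zero and equals `b * q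
    -- (x - y)`.
    have hb : b = 0 := by
      have hu := hqpos _ (sub_ne_zero.2 hne)
      have e1 : x.1 + y.1 = a * v.1 + b * (x.1 - y.1) := by simpa using congrArg Prod.fst e
      have e2 : x.2 + y.2 = a * v.2 + b * (x.2 - y.2) := by simpa using congrArg Prod.snd e
      have : b * q (x - y) = 0 := by
        rw [hq] at *
        rw [hq] at horth hxy
        simp only [Prod.fst_sub, Prod.snd_sub, Prod.fst_add, Prod.snd_add] at *
        linear_combination hxy - a / 4 * horth
          - (α * (x.1 - y.1) - β * (x.2 - y.2)) * e1 - (γ * (x.2 - y.2) - β * (x.1 - y.1)) * e2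
      exact (mul_eq_zero.1 this).resolve_right hu.ne'
    rw [hb, zero_smul, add_zero] at e
    have hg := hC.gauge_pos hx
    have hxC : (gauge C x)⁻¹ • x ∈ C := by
      rw [← hC.gauge_le_one_iff, hC.gauge_smul_abs, abs_of_pos (inv_pos.2 hg),
        inv_mul_cancel₀ hg.ne']
    have hx2 : x = (a / 2) • v + (1 / 2 : ℝ) • (x - y) := by
      have : (a / 2) • v = (1 / 2 : ℝ) • (x + y) := by rw [e, smul_smul]; ring_nf
      rw [this, ← smul_add, add_add_sub_cancel, ← two_smul ℝ x, smul_smul]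
      norm_num
    have hy2 : y = (a / 2) • v - (1 / 2 : ℝ) • (x - y) := by
      have : (a / 2) • v = (1 / 2 : ℝ) • (x + y) := by rw [e, smul_smul]; ring_nf
      rw [this, ← smul_sub, add_sub_sub_cancel, ← two_smul ℝ y, smul_smul]
      norm_num
    have hyC : (gauge C x)⁻¹ • y ∈ C := by
      generalize (gauge C x)⁻¹ = l at hxC ⊢
      have h1 : l • x = (l * (a / 2)) • v + (l * (1 / 2)) • (x - y) := by
        refine (congrArg (l • ·) hx2).trans ?_
        simp only [smul_add, smul_smul]
      have h2 : l • y = (l * (a / 2)) • v - (l * (1 / 2)) • (x - y) := by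
        refine (congrArg (l • ·) hy2).trans ?_
        simp only [smul_sub, smul_smul]
      rw [h2]
      exact hv _ _ (by rwa [← h1])
    rw [← hC.gauge_le_one_iff, hC.gauge_smul_abs, abs_of_pos (inv_pos.2 hg),
      inv_mul_le_iff₀ hg, mul_one] at hyC
    exact hyC
  have heq : ∀ x y, q x = q y → gauge C x = gauge C y := fun x y h =>
    le_antisymm (hle y x h.symm) (hle x y h)
  have hqs : ∀ (c : ℝ) x, q (c • x) = c ^ 2 * q x := by
    intro c x
    rw [hq, hq]
    simp only [Prod.smul_fst, Prod.smul_snd, smul_eq_mul]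
    ring
  set p : ℝ × ℝ := (1, 0)
  have hp : p ≠ 0 := by simp [p]
  have hqp := hqpos p hp
  -- Each `x` is compared with the multiple of `p` that has the same `q`-length; both sides are
  -- homogeneous of degree two.
  have hfin : ∀ x, gauge C x ^ 2 = gauge C p ^ 2 / q p * q x := by
    intro x
    have h0 : 0 ≤ q x := integral_nonneg fun z => sq_nonneg _
    have hs : q (√(q x / q p) • p) = q x := by
      rw [hqs, Real.sq_sqrt (by positivity)]
      field_simp
    rw [← heq _ _ hs, hC.gauge_smul_abs, mul_pow, sq_abs, Real.sq_sqrt (by positivity)]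
    ring
  refine ⟨gauge C p ^ 2 / q p * α, gauge C p ^ 2 / q p * (-2 * β), gauge C p ^ 2 / q p * γ,
    fun x => ?_⟩
  rw [hfin, hq x]
  ring

/-- The gauge of a body of maximal volume product satisfies the parallelogram law. -/
theorem parallelogram_of_max {N : ℕ} {K : Set (Fin N → ℝ)} (hK : IsSymBody K)
    (hmax : ∀ L : Set (Fin N → ℝ), IsSymBody L → volProd L ≤ volProd K) (x y : Fin N → ℝ) :
    gauge K (x + y) ^ 2 + gauge K (x - y) ^ 2 = 2 * (gauge K x ^ 2 + gauge K y ^ 2) := by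
  by_cases hxy : LinearIndependent ℝ ![x, y]
  · let e : (ℝ × ℝ) →ₗ[ℝ] (Fin N → ℝ) :=
      LinearMap.coprod (LinearMap.toSpanSingleton ℝ _ x) (LinearMap.toSpanSingleton ℝ _ y)
    have he : ∀ p : ℝ × ℝ, e p = p.1 • x + p.2 • y := fun p => by simp [e]
    have heinj : Function.Injective e := by
      rw [← LinearMap.ker_eq_bot, LinearMap.ker_eq_bot']
      intro p hp
      rw [he] at hp
      obtain ⟨h1, h2⟩ := LinearIndependent.pair_iff.1 hxy _ _ hp
      exact Prod.ext h1 h2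
    have hcl : Topology.IsClosedEmbedding e :=
      LinearMap.isClosedEmbedding_of_injective (LinearMap.ker_eq_bot.2 heinj)
    have hCb : IsSymBody (e ⁻¹' K) := by
      refine ⟨hK.convex.linear_preimage e, hcl.isCompact_preimage hK.isCompact, fun x hx => ?_, ?_⟩
      · have := hK.neg_mem _ hx
        simpa using this
      · rw [mem_interior_iff_mem_nhds]
        refine hcl.continuous.continuousAt.preimage_mem_nhds ?_
        rw [map_zero]
        exact hK.mem_nhds
    have hg : ∀ p, gauge (e ⁻¹' K) p = gauge K (e p) := by
      intro p
      simp only [gauge_def', mem_preimage, map_smul]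
    obtain ⟨α, β, γ, h⟩ := exists_quadratic_of_reflections hCb (by
      intro u hu
      have hd : ∃ w, area u w ≠ 0 := by
        refine ⟨(-u.2, u.1), fun h => hu ?_⟩
        simp only [area] at h
        exact Prod.ext (by simp; nlinarith [sq_nonneg u.1, sq_nonneg u.2])
          (by simp; nlinarith [sq_nonneg u.1, sq_nonneg u.2])
      obtain ⟨w, hw⟩ := hd
      have hli : LinearIndependent ℝ ![e u, e w] := by
        rw [LinearIndependent.pair_iff]
        intro s t hst
        rw [← map_smul, ← map_smul, ← map_add, ← map_zero e] at hst
        have hst := heinj hst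
        have e1 : s * u.1 + t * w.1 = 0 := by simpa using congrArg Prod.fst hst
        have e2 : s * u.2 + t * w.2 = 0 := by simpa using congrArg Prod.snd hst
        simp only [area] at hw
        constructor
        · refine (mul_eq_zero.1 (?_ : s * (u.1 * w.2 - u.2 * w.1) = 0)).resolve_right hw
          linear_combination w.2 * e1 - w.1 * e2
        · refine (mul_eq_zero.1 (?_ : t * (u.1 * w.2 - u.2 * w.1) = 0)).resolve_right hw
          linear_combination u.1 * e2 - u.2 * e1
      obtain ⟨c, hc⟩ := exists_reflection hK hmax hli
      -- Moving the axis to the line of midpoints turns `t ↦ 2 * c * r - t` into `t ↦ -t`.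
      refine ⟨w + c • u, ?_, fun r t hrt => ?_⟩
      · simp only [area, Prod.fst_add, Prod.snd_add, Prod.smul_fst, Prod.smul_snd,
          smul_eq_mul] at hw ⊢
        intro h
        exact hw (by linear_combination h)
      · have e1 : e (r • (w + c • u) + t • u) = r • e w + (c * r + t) • e u := by
          simp only [map_add, map_smul]
          module
        rw [mem_preimage, e1] at hrt
        have h2 := hc _ _ hrt
        rw [mem_preimage]
        convert! h2 using 1
        simp only [map_sub, map_add, map_smul]
        module)
    have hx := h (1, 0)
    have hy := h (0, 1)
    have hadd := h (1, 1)
    have hsub := h (1, -1)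
    rw [hg, he] at hx hy hadd hsub
    simp only [one_smul, zero_smul, add_zero, zero_add, neg_smul, ← sub_eq_add_neg] at hx hy hadd hsub
    rw [hx, hy, hadd, hsub]
    ring
  · have hcase : ∃ (z : Fin N → ℝ) (a b : ℝ), x = a • z ∧ y = b • z := by
      by_cases hy : y = 0
      · exact ⟨x, 1, 0, by simp, by simp [hy]⟩
      · rw [LinearIndependent.pair_symm_iff, LinearIndependent.pair_iff' hy] at hxy
        push Not at hxy
        obtain ⟨a, ha⟩ := hxy
        exact ⟨y, a, 1, ha.symm, by simp⟩
    obtain ⟨z, a, b, rfl, rfl⟩ := hcase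
    rw [← add_smul, ← sub_smul]
    simp only [hK.gauge_smul_abs, mul_pow, sq_abs]
    ring

end ConvexSym

end

/-! ### The Blaschke–Santaló inequality in coordinates -/

noncomputable section

namespace ConvexSym

open Set Filter Topology
open scoped ENNReal Pointwise

/-- A norm on a finite-dimensional space which satisfies the parallelogram law is Euclidean. -/
theorem exists_linearEquiv_euclidean {V : Type*} [AddCommGroup V] [Module ℝ V]
    [FiniteDimensional ℝ V] {N : ℕ} (hN : Module.finrank ℝ V = N) (p : V → ℝ)
    (hadd : ∀ x y, p (x + y) ≤ p x + p y) (hsmul : ∀ (c : ℝ) x, p (c • x) = |c| * p x)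
    (hpos : ∀ x, x ≠ 0 → 0 < p x)
    (hpar : ∀ x y, p (x + y) ^ 2 + p (x - y) ^ 2 = 2 * (p x ^ 2 + p y ^ 2)) :
    ∃ e : V ≃ₗ[ℝ] EuclideanSpace ℝ (Fin N), ∀ x, p x = ‖e x‖ := by
  let P : AddGroupNorm V :=
    { toFun := p
      map_zero' := by simpa using hsmul 0 0
      add_le' := hadd
      neg' := fun x => by simpa using hsmul (-1) x
      eq_zero_of_map_eq_zero' := fun x hx => by
        by_contra h
        exact (hpos x h).ne' hx }
  let _ : NormedAddCommGroup V := P.toNormedAddCommGroup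
  let _ : NormedSpace ℝ V := ⟨fun c x => (hsmul c x).le⟩
  let _ : InnerProductSpace ℝ V := InnerProductSpace.ofNorm ℝ fun x y => by
    have := hpar x y
    simp only [← sq]
    exact this
  let b := (stdOrthonormalBasis ℝ V).reindex (finCongr hN)
  exact ⟨b.repr.toLinearEquiv, fun x => (b.repr.norm_map x).symm⟩

/-- The Euclidean unit ball in coordinates. -/
def euclBall (N : ℕ) : Set (Fin N → ℝ) := {x | x ⬝ᵥ x ≤ 1}

theorem dotProduct_self_eq_norm_sq {N : ℕ} (x : Fin N → ℝ) :
    x ⬝ᵥ x = ‖(WithLp.toLp 2 x : EuclideanSpace ℝ (Fin N))‖ ^ 2 := by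
  rw [EuclideanSpace.norm_sq_eq]
  simp [dotProduct, sq]

theorem toLp_preimage_closedBall (N : ℕ) :
    (WithLp.toLp 2 : (Fin N → ℝ) → EuclideanSpace ℝ (Fin N)) ⁻¹' Metric.closedBall 0 1 =
      euclBall N := by
  ext x
  rw [mem_preimage, mem_closedBall_zero_iff, euclBall, mem_ofPred_eq, dotProduct_self_eq_norm_sq,
    sq_le_one_iff₀ (norm_nonneg _)]

theorem isSymBody_closedBall {V : Type*} [NormedAddCommGroup V] [NormedSpace ℝ V]
    [FiniteDimensional ℝ V] : IsSymBody (Metric.closedBall (0 : V) 1) := by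
  have := FiniteDimensional.proper ℝ V
  exact ⟨convex_closedBall _ _, isCompact_closedBall _ _, fun x hx => by simpa using hx,
    mem_interior_iff_mem_nhds.2 (Metric.closedBall_mem_nhds _ one_pos)⟩

theorem isSymBody_euclBall (N : ℕ) : IsSymBody (euclBall N) := by
  rw [← toLp_preimage_closedBall]
  exact isSymBody_closedBall.preimage_equiv (EuclideanSpace.equiv (Fin N) ℝ).symm

theorem polar_euclBall (N : ℕ) : polar (euclBall N) = euclBall N := by
  ext y
  constructor
  · intro hy
    by_contra h
    have h : 1 < y ⬝ᵥ y := not_le.1 h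
    have hs : 0 < √(y ⬝ᵥ y) := Real.sqrt_pos.2 (by linarith)
    have hsq : √(y ⬝ᵥ y) * √(y ⬝ᵥ y) = y ⬝ᵥ y := Real.mul_self_sqrt (by linarith)
    have h1 := hy ((√(y ⬝ᵥ y))⁻¹ • y) (by
      rw [euclBall, mem_ofPred_eq, smul_dotProduct, dotProduct_smul, smul_eq_mul, smul_eq_mul]
      nth_rewrite 3 [← hsq]
      field_simp
      rfl)
    rw [smul_dotProduct, smul_eq_mul, inv_mul_le_iff₀ hs] at h1
    nlinarith
  · intro hy x hx
    have hx : x ⬝ᵥ x ≤ 1 := hx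
    have hy : y ⬝ᵥ y ≤ 1 := hy
    have h : 0 ≤ (x - y) ⬝ᵥ (x - y) := Finset.sum_nonneg fun i _ => mul_self_nonneg _
    rw [sub_dotProduct, dotProduct_sub, dotProduct_sub, dotProduct_comm y x] at h
    linarith

/-- By the theorem of Jordan and von Neumann the parallelogram law makes the gauge a Euclidean norm,
whose unit ball is `K`. -/
theorem exists_preimage_of_max {N : ℕ} {K : Set (Fin N → ℝ)} (hK : IsSymBody K)
    (hmax : ∀ L : Set (Fin N → ℝ), IsSymBody L → volProd L ≤ volProd K) :
    ∃ e : (Fin N → ℝ) ≃ₗ[ℝ] (Fin N → ℝ), K = e ⁻¹' euclBall N := by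
  obtain ⟨e, he⟩ := exists_linearEquiv_euclidean (N := N) (by simp) (gauge K) hK.gauge_add_le
    hK.gauge_smul_abs (fun x => hK.gauge_pos) (parallelogram_of_max hK hmax)
  refine ⟨e.trans (WithLp.linearEquiv 2 ℝ (Fin N → ℝ)), ?_⟩
  ext x
  rw [← hK.gauge_le_one_iff, he, ← toLp_preimage_closedBall]
  simp

theorem volProd_euclBall (N : ℕ) : volProd (euclBall N) = volume (euclBall N) ^ 2 := by
  rw [volProd, polar_euclBall, sq]

/-- The Blaschke–Santaló inequality for symmetric bodies. -/
theorem volProd_le {N : ℕ} {K : Set (Fin N → ℝ)} (hK : IsSymBody K) :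
    volProd K ≤ volume (euclBall N) ^ 2 := by
  obtain ⟨L, hL, hmax⟩ := exists_forall_volProd_le N
  obtain ⟨e, rfl⟩ := exists_preimage_of_max hL hmax
  refine (hmax K hK).trans_eq ?_
  rw [volProd_preimage, volProd_euclBall]

/-- The equality case of the Blaschke–Santaló inequality. -/
theorem volProd_eq_iff {N : ℕ} {K : Set (Fin N → ℝ)} (hK : IsSymBody K) :
    volProd K = volume (euclBall N) ^ 2 ↔
      ∃ e : (Fin N → ℝ) ≃ₗ[ℝ] (Fin N → ℝ), K = e ⁻¹' euclBall N := by
  constructor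
  · intro h
    exact exists_preimage_of_max hK fun L hL => (volProd_le hL).trans_eq h.symm
  · rintro ⟨e, rfl⟩
    rw [volProd_preimage, volProd_euclBall]

end ConvexSym

end

/-! ### Blaschke–Santaló without coordinates, polar coordinates, support functions -/

noncomputable section

namespace ConvexSym

open Set Filter Topology
open scoped ENNReal Pointwise RealInnerProductSpace

section InnerProduct

variable {V : Type*} [NormedAddCommGroup V] [InnerProductSpace ℝ V]

/-- The polar of a set with respect to the inner product. -/
def innerPolar (K : Set V) : Set V := {y | ∀ x ∈ K, ⟪x, y⟫ ≤ 1}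

/-- Coordinates in an orthonormal basis preserve volume and inner products simultaneously, so
volumes and polars both transfer. -/
theorem exists_coordinates [FiniteDimensional ℝ V] [MeasurableSpace V] [BorelSpace V] :
    ∃ φ : V ≃L[ℝ] (Fin (Module.finrank ℝ V) → ℝ),
      MeasurePreserving φ (volume : Measure V) volume ∧
        ∀ x y, ⟪x, y⟫ = φ x ⬝ᵥ φ y := by
  let b := stdOrthonormalBasis ℝ V
  refine ⟨b.repr.toContinuousLinearEquiv.trans (EuclideanSpace.equiv _ ℝ), ?_, fun x y => ?_⟩
  · exact (PiLp.volume_preserving_ofLp _).comp b.measurePreserving_repr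
  · rw [← b.repr.inner_map_map, PiLp.inner_apply]
    simp [dotProduct, mul_comm]

theorem innerPolar_preimage {N : ℕ} {φ : V ≃L[ℝ] (Fin N → ℝ)}
    (hφ : ∀ x y, ⟪x, y⟫ = φ x ⬝ᵥ φ y) (K : Set (Fin N → ℝ)) :
    innerPolar (φ ⁻¹' K) = φ ⁻¹' polar K := by
  ext y
  constructor
  · intro h x hx
    have := h (φ.symm x) (by simpa using hx)
    rwa [hφ, φ.apply_symm_apply] at this
  · intro h x hx
    rw [hφ]
    exact h _ hx

theorem closedBall_eq_preimage {N : ℕ} {φ : V ≃L[ℝ] (Fin N → ℝ)}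
    (hφ : ∀ x y, ⟪x, y⟫ = φ x ⬝ᵥ φ y) : Metric.closedBall (0 : V) 1 = φ ⁻¹' euclBall N := by
  ext x
  rw [mem_closedBall_zero_iff, mem_preimage, euclBall, mem_ofPred_eq, ← hφ,
    real_inner_self_eq_norm_sq, sq_le_one_iff₀ (norm_nonneg _)]

variable [FiniteDimensional ℝ V] {K : Set V}

theorem innerPolar_isSymBody (hK : IsSymBody K) : IsSymBody (innerPolar K) := by
  borelize V
  obtain ⟨φ, -, hφ⟩ := exists_coordinates (V := V)
  obtain ⟨L, hL, rfl⟩ : ∃ L, IsSymBody L ∧ K = φ ⁻¹' L :=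
    ⟨φ.symm ⁻¹' K, hK.preimage_equiv φ.symm, by ext; simp⟩
  rw [innerPolar_preimage hφ]
  exact (polar_isSymBody hL).preimage_equiv φ

variable [MeasurableSpace V] [BorelSpace V]

/-- The Blaschke–Santaló inequality in a Euclidean space. -/
theorem volume_mul_volume_innerPolar_le (hK : IsSymBody K) :
    volume K * volume (innerPolar K) ≤ volume (Metric.closedBall (0 : V) 1) ^ 2 := by
  obtain ⟨φ, hφm, hφ⟩ := exists_coordinates (V := V)
  obtain ⟨L, hL, rfl⟩ : ∃ L, IsSymBody L ∧ K = φ ⁻¹' L :=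
    ⟨φ.symm ⁻¹' K, hK.preimage_equiv φ.symm, by ext; simp⟩
  rw [innerPolar_preimage hφ, closedBall_eq_preimage hφ,
    hφm.measure_preimage hL.isCompact.measurableSet.nullMeasurableSet,
    hφm.measure_preimage (isClosed_polar.measurableSet.nullMeasurableSet),
    hφm.measure_preimage (isSymBody_euclBall _).isCompact.measurableSet.nullMeasurableSet]
  exact volProd_le hL

/-- The equality case of the Blaschke–Santaló inequality in a Euclidean space. -/
theorem volume_mul_volume_innerPolar_eq_iff (hK : IsSymBody K) :
    volume K * volume (innerPolar K) = volume (Metric.closedBall (0 : V) 1) ^ 2 ↔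
      ∃ e : V ≃ₗ[ℝ] V, K = {x | ‖e x‖ ≤ 1} := by
  obtain ⟨φ, hφm, hφ⟩ := exists_coordinates (V := V)
  obtain ⟨L, hL, rfl⟩ : ∃ L, IsSymBody L ∧ K = φ ⁻¹' L :=
    ⟨φ.symm ⁻¹' K, hK.preimage_equiv φ.symm, by ext; simp⟩
  have hb := closedBall_eq_preimage hφ
  rw [innerPolar_preimage hφ, hb,
    hφm.measure_preimage hL.isCompact.measurableSet.nullMeasurableSet,
    hφm.measure_preimage (isClosed_polar.measurableSet.nullMeasurableSet),
    hφm.measure_preimage (isSymBody_euclBall _).isCompact.measurableSet.nullMeasurableSet]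
  refine (volProd_eq_iff hL).trans ?_
  have hmem : ∀ x : V, ‖x‖ ≤ 1 ↔ φ x ∈ euclBall _ := fun x => by
    rw [← mem_closedBall_zero_iff, hb]; rfl
  constructor
  · rintro ⟨e, rfl⟩
    refine ⟨φ.toLinearEquiv.trans (e.trans φ.toLinearEquiv.symm), ?_⟩
    ext x
    rw [mem_ofPred_eq, hmem]
    simp
  · rintro ⟨e, he⟩
    refine ⟨φ.toLinearEquiv.symm.trans (e.trans φ.toLinearEquiv), ?_⟩
    ext x
    have := congrArg (φ.symm x ∈ ·) he
    simp only [mem_preimage, mem_ofPred_eq, hmem, φ.apply_symm_apply] at this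
    rw [this]
    simp

end InnerProduct

/-! ### Integration in polar coordinates -/

section PolarCoordinates

variable {V : Type*} [NormedAddCommGroup V] [NormedSpace ℝ V] [FiniteDimensional ℝ V]
  [Nontrivial V] [MeasurableSpace V] [BorelSpace V] (μ : Measure V) [μ.IsAddHaarMeasure]

theorem lintegral_eq_lintegral_sphere {f : V → ℝ≥0∞} (hf : Measurable f) :
    ∫⁻ x, f x ∂μ = ∫⁻ u : Metric.sphere (0 : V) 1, ∫⁻ r : Ioi (0 : ℝ), f (r.1 • u.1)
      ∂(Measure.volumeIoiPow (Module.finrank ℝ V - 1)) ∂μ.toSphere := by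
  have h1 : ∫⁻ x, f x ∂μ = ∫⁻ x : ({0}ᶜ : Set V), f x.1 ∂(μ.comap (↑)) := by
    rw [lintegral_subtype_comap (measurableSet_singleton _).compl,
      restrict_compl_singleton]
  have e := μ.measurePreserving_homeomorphUnitSphereProd
  have hm : Measurable fun p : Metric.sphere (0 : V) 1 × Ioi (0 : ℝ) => f (p.2.1 • p.1.1) :=
    hf.comp (by fun_prop)
  rw [h1, ← lintegral_prod _ hm.aemeasurable, ← e.lintegral_comp hm]
  refine lintegral_congr fun x => ?_
  congr 1
  have hx : (x : V) ≠ 0 := x.2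
  simp [smul_smul, hx]

/-- The volume of the set `p < 1` for a positively homogeneous function `p`. -/
theorem volume_lt_one_eq_lintegral {p : V → ℝ} (hp : Continuous p) (hpos : ∀ x, x ≠ 0 → 0 < p x)
    (hsmul : ∀ c : ℝ, 0 < c → ∀ x, p (c • x) = c * p x) :
    μ {x | p x < 1} = ∫⁻ x in Metric.ball 0 1,
      ENNReal.ofReal ((‖x‖ / p x) ^ Module.finrank ℝ V) ∂μ := by
  have hd : Module.finrank ℝ V - 1 + 1 = Module.finrank ℝ V :=
    Nat.sub_add_cancel Module.finrank_pos
  have hS : MeasurableSet {x | p x < 1} := measurableSet_lt hp.measurable measurable_const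
  have hm : Measurable fun x => ENNReal.ofReal ((‖x‖ / p x) ^ Module.finrank ℝ V) :=
    ((measurable_norm.div hp.measurable).pow_const _).ennreal_ofReal
  rw [← lintegral_indicator_one hS, ← lintegral_indicator measurableSet_ball,
    lintegral_eq_lintegral_sphere μ (measurable_one.indicator hS),
    lintegral_eq_lintegral_sphere μ (hm.indicator measurableSet_ball)]
  refine lintegral_congr fun u => ?_
  have hu0 : (u : V) ≠ 0 := Metric.ne_of_mem_sphere u.2 one_ne_zero
  have hu1 : ‖(u : V)‖ = 1 := by simp
  have hpu := hpos _ hu0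
  -- On the ray through `u` the left side integrates `1` up to `1 / p u`, and the right side
  -- integrates the constant `(p u)⁻¹ ^ d` up to `1`. Against the density `r ^ (d - 1)` both give
  -- `(p u)⁻¹ ^ d / d`.
  have e1 : ∀ r : Ioi (0 : ℝ), {x | p x < 1}.indicator (1 : V → ℝ≥0∞) (r.1 • u.1) =
      (Iio (⟨(p u)⁻¹, mem_Ioi.2 (inv_pos.2 hpu)⟩ : Ioi (0 : ℝ))).indicator 1 r := by
    intro r
    have h : r.1 • u.1 ∈ {x | p x < 1} ↔
        r ∈ Iio (⟨(p u)⁻¹, mem_Ioi.2 (inv_pos.2 hpu)⟩ : Ioi (0 : ℝ)) := by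
      rw [mem_ofPred_eq, hsmul _ r.2, mem_Iio, ← Subtype.coe_lt_coe]
      show _ ↔ (r : ℝ) < (p u)⁻¹
      rw [← one_div, lt_div_iff₀ hpu]
    by_cases hr : r.1 • u.1 ∈ {x | p x < 1}
    · rw [indicator_of_mem hr, indicator_of_mem (h.1 hr), Pi.one_apply, Pi.one_apply]
    · rw [indicator_of_notMem hr, indicator_of_notMem (fun h' => hr (h.2 h'))]
  have e2 : ∀ r : Ioi (0 : ℝ), (Metric.ball 0 1).indicator
      (fun x => ENNReal.ofReal ((‖x‖ / p x) ^ Module.finrank ℝ V)) (r.1 • u.1) =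
      ENNReal.ofReal ((p u)⁻¹ ^ Module.finrank ℝ V) *
        (Iio (⟨1, mem_Ioi.2 one_pos⟩ : Ioi (0 : ℝ))).indicator 1 r := by
    intro r
    have hr : (0 : ℝ) < r.1 := r.2
    have hn : ‖r.1 • u.1‖ = r.1 := by rw [norm_smul, hu1, mul_one, Real.norm_of_nonneg hr.le]
    have h : r.1 • u.1 ∈ Metric.ball (0 : V) 1 ↔
        r ∈ Iio (⟨1, mem_Ioi.2 one_pos⟩ : Ioi (0 : ℝ)) := by
      rw [mem_ball_zero_iff, hn, mem_Iio, ← Subtype.coe_lt_coe]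
    by_cases hr' : r.1 • u.1 ∈ Metric.ball (0 : V) 1
    · rw [indicator_of_mem hr', indicator_of_mem (h.1 hr'), Pi.one_apply, mul_one, hn,
        hsmul _ r.2, div_mul_eq_div_div, div_self hr.ne', one_div]
    · rw [indicator_of_notMem hr', indicator_of_notMem (fun h' => hr' (h.2 h')), mul_zero]
  simp only [e1, e2]
  rw [lintegral_indicator_one measurableSet_Iio, lintegral_const_mul' _ _ ENNReal.ofReal_ne_top,
    lintegral_indicator_one measurableSet_Iio, Measure.volumeIoiPow_apply_Iio,
    Measure.volumeIoiPow_apply_Iio, ← ENNReal.ofReal_mul (by positivity), hd]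
  congr 1
  simp only [one_pow]
  ring

/-- The set where the gauge is below `1` is the interior, and the boundary of a convex set is null.
-/
theorem volume_eq_lintegral_gauge {K : Set V} (hK : IsSymBody K) :
    μ K = ∫⁻ x in Metric.ball 0 1,
      ENNReal.ofReal ((‖x‖ / gauge K x) ^ Module.finrank ℝ V) ∂μ := by
  rw [← volume_lt_one_eq_lintegral μ (continuous_gauge hK.convex hK.mem_nhds)
    (fun x => hK.gauge_pos) (fun c hc x => by rw [hK.gauge_smul_abs, abs_of_pos hc])]
  have h1 : {x | gauge K x < 1} = interior K := by
    ext x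
    exact gauge_lt_one_iff_mem_interior hK.convex hK.mem_nhds
  rw [h1]
  have h2 := hK.convex.addHaar_frontier μ
  refine le_antisymm ?_ (measure_mono interior_subset)
  calc μ K ≤ μ (interior K ∪ frontier K) := measure_mono (by
        rw [← closure_eq_interior_union_frontier]; exact subset_closure)
    _ ≤ μ (interior K) + μ (frontier K) := measure_union_le _ _
    _ = μ (interior K) := by rw [h2, add_zero]

end PolarCoordinates

/-- The gauge of the polar is the support function. -/
theorem gauge_innerPolar {V : Type*} [NormedAddCommGroup V] [InnerProductSpace ℝ V]
    [FiniteDimensional ℝ V] {K : Set V} (hK : IsSymBody K) (v : V) :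
    (∀ x ∈ K, ⟪x, v⟫ ≤ gauge (innerPolar K) v) ∧ ∃ x ∈ K, ⟪x, v⟫ = gauge (innerPolar K) v := by
  have hD := innerPolar_isSymBody hK
  have hsc : ∀ t : ℝ, 0 < t → (gauge (innerPolar K) v ≤ t ↔ ∀ x ∈ K, ⟪x, v⟫ ≤ t) := by
    intro t ht
    rw [← inv_mul_le_one₀ ht, ← abs_of_pos (inv_pos.2 ht), ← hD.gauge_smul_abs,
      hD.gauge_le_one_iff]
    refine forall₂_congr fun x _ => ?_
    rw [real_inner_smul_right, inv_mul_le_one₀ ht]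
  have h1 : ∀ x ∈ K, ⟪x, v⟫ ≤ gauge (innerPolar K) v := by
    by_cases hv : v = 0
    · subst hv; simp
    · exact (hsc _ (hD.gauge_pos hv)).1 le_rfl
  refine ⟨h1, ?_⟩
  obtain ⟨x, hx, hmax⟩ := hK.isCompact.exists_isMaxOn ⟨0, hK.zero_mem⟩
    (f := fun x => ⟪x, v⟫) (by fun_prop)
  have hmax : ∀ y ∈ K, ⟪y, v⟫ ≤ ⟪x, v⟫ := fun y hy => hmax hy
  refine ⟨x, hx, le_antisymm (h1 x hx) ?_⟩
  have h0 : 0 ≤ ⟪x, v⟫ := by simpa using hmax 0 hK.zero_mem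
  -- The criterion `hsc` requires a positive bound, whereas the maximum vanishes for `v = 0`; hence
  -- the slack `ε`.
  refine le_of_forall_pos_le_add fun ε hε => ?_
  exact (hsc _ (by linarith)).2 fun y hy => (hmax y hy).trans (by linarith)

end ConvexSym

end

noncomputable section

/-! ### Uniqueness of uniformly distributed measures -/

section UniformlyDistributed

open Set Filter Topology
open scoped ENNReal

theorem ENNReal.liminf_le_one_of_inv {u : ℕ → ℝ≥0∞} (h : 1 ≤ liminf (fun n => (u n)⁻¹) atTop) :
    liminf u atTop ≤ 1 := by
  rw [← ENNReal.inv_limsup, ENNReal.one_le_inv] at h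
  exact (liminf_le_limsup (by isBoundedDefault) (by isBoundedDefault)).trans h

variable {X Y : Type*} [TopologicalSpace X] [MeasurableSpace X]
  [SecondCountableTopology X] [PseudoMetricSpace Y] {φ : X → Y} {μ ν : Measure X}

theorem measurableSet_dist_lt [BorelSpace X] (hφ : IsInducing φ) (r : ℝ) :
    MeasurableSet {p : X × X | dist (φ p.1) (φ p.2) < r} := by
  refine IsOpen.measurableSet (isOpen_lt ?_ continuous_const)
  exact (hφ.continuous.comp continuous_fst).dist (hφ.continuous.comp continuous_snd)

/-- Countably many balls of radius `r` cover the space by second countability, so balls of measure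
zero would annihilate it. -/
theorem measure_near_pos (hφ : IsInducing φ) [IsProbabilityMeasure ν] {c : ℝ → ℝ≥0∞}
    (hν : ∀ x r, ν {y | dist (φ y) (φ x) < r} = c r) {r : ℝ} (hr : 0 < r) : c r ≠ 0 := by
  intro h0
  have hopen : ∀ x, IsOpen {y | dist (φ y) (φ x) < r} := fun x =>
    isOpen_lt (hφ.continuous.dist continuous_const) continuous_const
  obtain ⟨T, hT, hTu⟩ := TopologicalSpace.isOpen_iUnion_countable
    (fun x => {y | dist (φ y) (φ x) < r}) hopen
  have h1 : (univ : Set X) ⊆ ⋃ x ∈ T, {y | dist (φ y) (φ x) < r} := by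
    rw [hTu]
    exact fun x _ => mem_iUnion.2 ⟨x, by simpa using hr⟩
  have h2 : ν univ = 0 := measure_mono_null h1
    ((measure_biUnion_null_iff hT).2 fun x _ => by rw [hν, h0])
  simp at h2

variable [BorelSpace X]

/-- For `x ∈ U` all sufficiently small balls about `x` lie in `U`, so the fraction of their `ν`-mass
inside `U` is eventually `1`. Fubini evaluates the `μ`-integral of this fraction as `c r / d r * ν
U`, and Fatou passes to the limit. -/
theorem measure_open_le_liminf_mul (hφ : IsInducing φ) [IsProbabilityMeasure μ]
    [IsProbabilityMeasure ν] {c d : ℝ → ℝ≥0∞}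
    (hμ : ∀ x r, μ {y | dist (φ y) (φ x) < r} = c r)
    (hν : ∀ x r, ν {y | dist (φ y) (φ x) < r} = d r) {r : ℕ → ℝ} (hr : ∀ n, 0 < r n)
    (hr0 : Tendsto r atTop (𝓝 0)) {U : Set X} (hU : IsOpen U) :
    μ U ≤ liminf (fun n => c (r n) / d (r n)) atTop * ν U := by
  have hd0 : ∀ n, d (r n) ≠ 0 := fun n => measure_near_pos hφ hν (hr n)
  have hx : Nonempty X := by
    by_contra h
    rw [not_nonempty_iff] at h
    have : μ univ = 0 := by rw [univ_eq_empty_iff.2 h, measure_empty]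
    simp at this
  have hdt : ∀ n, d (r n) ≠ ⊤ := fun n => by
    rw [← hν hx.some]; exact measure_ne_top _ _
  have hB : ∀ n, MeasurableSet {p : X × X | p.2 ∈ U ∧ dist (φ p.1) (φ p.2) < r n} := fun n =>
    (measurable_snd hU.measurableSet).inter (measurableSet_dist_lt hφ _)
  let f : ℕ → X → ℝ≥0∞ := fun n x => ν {y | y ∈ U ∧ dist (φ x) (φ y) < r n} / d (r n)
  have hf : ∀ n, Measurable (f n) := fun n =>
    (measurable_measure_prodMk_left (hB n)).div_const _
  have hpt : ∀ x ∈ U, 1 ≤ liminf (fun n => f n x) atTop := by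
    intro x hx
    refine le_liminf_of_le (by isBoundedDefault) ?_
    have hn : U ∈ 𝓝 x := hU.mem_nhds hx
    rw [hφ.nhds_eq_comap, mem_comap] at hn
    obtain ⟨W, hW, hWU⟩ := hn
    obtain ⟨ε, hε, hεW⟩ := Metric.mem_nhds_iff.1 hW
    filter_upwards [hr0.eventually (gt_mem_nhds hε)] with n hn
    have : {y | y ∈ U ∧ dist (φ x) (φ y) < r n} = {y | dist (φ y) (φ x) < r n} := by
      ext y
      simp only [mem_ofPred_eq, dist_comm (φ x)]
      refine ⟨fun h => h.2, fun h => ⟨hWU (hεW (h.trans hn)), h⟩⟩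
    simp only [f]
    rw [this, hν, ENNReal.div_self (hd0 n) (hdt n)]
  have hint : ∀ n, ∫⁻ x, f n x ∂μ = c (r n) / d (r n) * ν U := by
    intro n
    have e1 : ∫⁻ x, ν {y | y ∈ U ∧ dist (φ x) (φ y) < r n} ∂μ = c (r n) * ν U := by
      have h1 := Measure.prod_apply (μ := μ) (ν := ν) (hB n)
      have h2 := Measure.prod_apply_symm (μ := μ) (ν := ν) (hB n)
      refine (h1.symm.trans h2).trans ?_
      have h3 : ∀ y, μ ((fun x => (x, y)) ⁻¹' {p : X × X | p.2 ∈ U ∧ dist (φ p.1) (φ p.2) < r n}) =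
          U.indicator (fun _ => c (r n)) y := by
        intro y
        by_cases hy : y ∈ U
        · rw [indicator_of_mem hy, ← hμ y]
          congr 1
          ext x
          simp [hy]
        · rw [indicator_of_notMem hy]
          convert measure_empty (μ := μ)
          ext x
          simp [hy]
      simp only [h3]
      rw [lintegral_indicator_const hU.measurableSet]
    simp only [f, div_eq_mul_inv]
    rw [lintegral_mul_const' _ _ (ENNReal.inv_ne_top.2 (hd0 n)), e1]
    ring
  calc μ U = ∫⁻ x in U, 1 ∂μ := by simp
    _ ≤ ∫⁻ x in U, liminf (fun n => f n x) atTop ∂μ :=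
        setLIntegral_mono' hU.measurableSet hpt
    _ ≤ ∫⁻ x, liminf (fun n => f n x) atTop ∂μ := setLIntegral_le_lintegral _ _
    _ ≤ liminf (fun n => ∫⁻ x, f n x ∂μ) atTop := lintegral_liminf_le hf
    _ = liminf (fun n => c (r n) / d (r n) * ν U) atTop := by simp only [hint]
    _ = liminf (fun n => c (r n) / d (r n)) atTop * ν U :=
        (ENNReal.liminf_mul_const_of_ne_top (measure_ne_top ν U)).trans (mul_comm _ _)

/-- Two probability measures with respect to both of which all balls of the same radius have the
same measure are equal. -/
theorem eq_of_uniformlyDistributed (hφ : IsInducing φ) [IsProbabilityMeasure μ]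
    [IsProbabilityMeasure ν] {c d : ℝ → ℝ≥0∞}
    (hμ : ∀ x r, μ {y | dist (φ y) (φ x) < r} = c r)
    (hν : ∀ x r, ν {y | dist (φ y) (φ x) < r} = d r) : μ = ν := by
  let r : ℕ → ℝ := fun n => 1 / (n + 1)
  have hr : ∀ n, 0 < r n := fun n => by positivity
  have hr0 : Tendsto r atTop (𝓝 0) := tendsto_one_div_add_atTop_nhds_zero_nat
  have h1 := fun U hU => measure_open_le_liminf_mul hφ hμ hν hr hr0 (U := U) hU
  have h2 := fun U hU => measure_open_le_liminf_mul hφ hν hμ hr hr0 (U := U) hU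
  have a1 := h1 univ isOpen_univ
  have a2 := h2 univ isOpen_univ
  rw [measure_univ, measure_univ, mul_one] at a1 a2
  have hc0 : ∀ n, c (r n) ≠ 0 := fun n => measure_near_pos hφ hμ (hr n)
  have hd0 : ∀ n, d (r n) ≠ 0 := fun n => measure_near_pos hφ hν (hr n)
  have hx : Nonempty X := by
    by_contra h
    rw [not_nonempty_iff] at h
    have : μ univ = 0 := by rw [univ_eq_empty_iff.2 h, measure_empty]
    simp at this
  have hct : ∀ n, c (r n) ≠ ⊤ := fun n => by
    rw [← hμ hx.some]; exact measure_ne_top _ _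
  have hdt : ∀ n, d (r n) ≠ ⊤ := fun n => by
    rw [← hν hx.some]; exact measure_ne_top _ _
  have e1 : (fun n => d (r n) / c (r n)) = fun n => (c (r n) / d (r n))⁻¹ := by
    funext n
    rw [ENNReal.inv_div (.inl (hdt n)) (.inl (hd0 n))]
  have e2 : (fun n => c (r n) / d (r n)) = fun n => (d (r n) / c (r n))⁻¹ := by
    funext n
    rw [ENNReal.inv_div (.inl (hct n)) (.inl (hc0 n))]
  -- The case `U = univ` bounds the lower limits of `c / d` and of `d / c` from below by `1`;
  -- inverting each bounds the other from above by `1`.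
  have b1 := ENNReal.liminf_le_one_of_inv (e1 ▸ a2)
  have b2 := ENNReal.liminf_le_one_of_inv (e2 ▸ a1)
  refine ext_of_generate_finite _ (BorelSpace.measurable_eq : _ = borel X)
    isPiSystem_isOpen (fun U hU => le_antisymm ?_ ?_) (by simp)
  · exact (h1 U hU).trans (mul_le_of_le_one_left' b1)
  · exact (h2 U hU).trans (mul_le_of_le_one_left' b2)

end UniformlyDistributed

end

/-! ### Lines, unitary maps and uniqueness of the Haar measure -/

noncomputable section

namespace FLutwak

set_option linter.unusedSectionVars false

open Set Filter Topology
open scoped ENNReal RealInnerProductSpace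

variable {F : Type} [NormedDivisionRing F] [InnerProductSpace ℝ F] {m n : ℕ}

/-- Polarization: right multiplication by `a` scales all norms by `‖a‖`. -/
theorem inner_op_smul (a : F) (x y : EuclideanSpace F (Fin n)) :
    ⟪MulOpposite.op a • x, MulOpposite.op a • y⟫ = ‖a‖ ^ 2 * ⟪x, y⟫ := by
  rw [real_inner_eq_norm_add_mul_self_sub_norm_mul_self_sub_norm_mul_self_div_two,
    real_inner_eq_norm_add_mul_self_sub_norm_mul_self_sub_norm_mul_self_div_two,
    ← smul_add, norm_rsmul, norm_rsmul, norm_rsmul]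
  ring

variable [SMulCommClass ℝ F F]

theorem op_real_smul (r : ℝ) (a : F) (x : EuclideanSpace F (Fin n)) :
    MulOpposite.op (r • a) • x = r • MulOpposite.op a • x := by
  rw [MulOpposite.op_smul, smul_assoc]

theorem op_smul_real_smul (a : F) (r : ℝ) (x : EuclideanSpace F (Fin n)) :
    MulOpposite.op a • r • x = r • MulOpposite.op a • x :=
  map_real_smul (DistribSMul.toAddMonoidHom (EuclideanSpace F (Fin n)) (MulOpposite.op a))
    (continuous_const_smul _) r x

theorem sub_half_smul_add {M : Type*} [AddCommGroup M] [Module ℝ M] (x w : M) :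
    x - (1 / 2 : ℝ) • (x + w) = (1 / 2 : ℝ) • (x - w) := by
  module

theorem half_smul_add_add_half_smul_add_sub {M : Type*} [AddCommGroup M] [Module ℝ M] (x w : M) :
    (1 / 2 : ℝ) • (x + w) + (1 / 2 : ℝ) • (x + w) - x = w := by
  module

/-- The real linear isometry underlying a unitary map. -/
def UnitaryGrp.real (U : UnitaryGrp F n) :
    EuclideanSpace F (Fin n) ≃ₗᵢ[ℝ] EuclideanSpace F (Fin n) :=
  { U.toLinearEquiv.restrictScalars ℝ with norm_map' := U.norm_map }

variable [FiniteDimensional ℝ F]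

theorem Gr.real_map (U : UnitaryGrp F n) (E : Gr F m n) :
    (Gr.map U E).real = E.real.map (UnitaryGrp.real U).toLinearEquiv.toLinearMap := by
  ext y
  simp only [Gr.map, Gr.real, Submodule.restrictScalars_mem, Submodule.mem_map]
  rfl

theorem Gr.starProjection_map (U : UnitaryGrp F n) (E : Gr F m n) :
    (Gr.map U E).real.starProjection =
      ((UnitaryGrp.real U).toContinuousLinearEquiv : _ →L[ℝ] _) ∘L E.real.starProjection ∘L
        ((UnitaryGrp.real U).symm.toContinuousLinearEquiv : _ →L[ℝ] _) := by
  ext1 x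
  have := Submodule.starProjection_map_apply (UnitaryGrp.real U) E.real x
  simp only [Gr.real_map]
  exact this

theorem Gr.op_smul_mem (E : Gr F m n) (a : F) {x : EuclideanSpace F (Fin n)} (hx : x ∈ E.real) :
    MulOpposite.op a • x ∈ E.real :=
  Submodule.smul_mem E.1 _ hx

/-- The orthogonal projections onto `F`-subspaces are `F`-linear. -/
theorem Gr.starProjection_op_smul (E : Gr F m n) (a : F) (x : EuclideanSpace F (Fin n)) :
    E.real.starProjection (MulOpposite.op a • x) = MulOpposite.op a • E.real.starProjection x := by
  by_cases ha : a = 0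
  · subst ha; simp
  refine Submodule.eq_starProjection_of_mem_of_inner_eq_zero
    (E.op_smul_mem a (Submodule.starProjection_apply_mem _ _)) fun w hw => ?_
  have hw' : w = MulOpposite.op a • MulOpposite.op a⁻¹ • w := by
    rw [smul_smul, ← MulOpposite.op_mul, inv_mul_cancel₀ ha, MulOpposite.op_one, one_smul]
  rw [hw', ← smul_sub, inner_op_smul,
    Submodule.starProjection_inner_eq_zero _ _ (E.op_smul_mem a⁻¹ hw), mul_zero]

theorem line_op_smul {v : EuclideanSpace F (Fin n)} (hv : v ≠ 0) {a : F}
    (hav : MulOpposite.op a • v ≠ 0) : line (MulOpposite.op a • v) hav = line v hv := by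
  have ha : MulOpposite.op a ≠ 0 := by
    intro h
    rw [h, zero_smul] at hav
    exact hav rfl
  exact Subtype.ext (Submodule.span_singleton_smul_eq (IsUnit.mk0 _ ha) v)

theorem mem_line_self (v : EuclideanSpace F (Fin n)) (hv : v ≠ 0) : v ∈ (line v hv).real :=
  Submodule.mem_span_singleton_self v

theorem mem_line_iff {v : EuclideanSpace F (Fin n)} (hv : v ≠ 0) {x : EuclideanSpace F (Fin n)} :
    x ∈ (line v hv).real ↔ ∃ b : F, x = MulOpposite.op b • v := by
  refine (Submodule.mem_span_singleton (R := Fᵐᵒᵖ)).trans ⟨?_, ?_⟩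
  · rintro ⟨c, rfl⟩
    exact ⟨c.unop, rfl⟩
  · rintro ⟨b, rfl⟩
    exact ⟨_, rfl⟩

theorem Gr.exists_eq_line (E : Gr F 1 n) : ∃ v hv, E = line v hv := by
  obtain ⟨v, hv, h⟩ := finrank_eq_one_iff'.1 E.2
  have hv' : (v : EuclideanSpace F (Fin n)) ≠ 0 := fun h => hv (Subtype.ext h)
  refine ⟨v, hv', Subtype.ext (le_antisymm (fun x hx => ?_) ?_)⟩
  · obtain ⟨c, hc⟩ := h ⟨x, hx⟩
    exact Submodule.mem_span_singleton.2 ⟨c, congrArg Subtype.val hc⟩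
  · exact (Submodule.span_singleton_le_iff_mem _ _).2 v.2

/-- Each vector can be rotated in its `F`-line such that its projection to a given line becomes a
non-negative real multiple of a given vector. -/
theorem exists_op_smul_starProjection {u w : EuclideanSpace F (Fin n)} (hw : w ≠ 0) :
    ∃ a : F, ‖a‖ = 1 ∧ ∃ β : ℝ, 0 ≤ β ∧
      (line w hw).real.starProjection (MulOpposite.op a • u) = β • w := by
  obtain ⟨b, hb⟩ := (mem_line_iff hw).1 ((line w hw).real.starProjection_apply_mem u)
  by_cases hb0 : b = 0
  · refine ⟨1, norm_one, 0, le_rfl, ?_⟩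
    rw [MulOpposite.op_one, one_smul, hb, hb0]
    simp
  · have hbn : ‖b‖ ≠ 0 := norm_ne_zero_iff.2 hb0
    -- The projection of `u` is `w · b`, and `b` times this unit scalar is the real number `‖b‖`.
    refine ⟨‖b‖ • b⁻¹, ?_, ‖b‖, norm_nonneg _, ?_⟩
    · rw [norm_smul, norm_norm, norm_inv, mul_inv_cancel₀ hbn]
    · rw [Gr.starProjection_op_smul, hb, op_real_smul, smul_smul, ← MulOpposite.op_mul,
        mul_inv_cancel₀ hb0, MulOpposite.op_one, one_smul]

/-- The reflection in an `F`-subspace. -/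
def Gr.reflection (E : Gr F m n) : UnitaryGrp F n where
  toFun := E.real.reflection
  invFun := E.real.reflection
  map_add' := map_add _
  map_smul' c x := by
    obtain ⟨a, rfl⟩ := MulOpposite.op_surjective c
    rw [RingHom.id_apply, Submodule.reflection_apply, Submodule.reflection_apply,
      Gr.starProjection_op_smul, smul_sub, two_nsmul, two_nsmul, smul_add]
  left_inv := Submodule.reflection_reflection _
  right_inv := Submodule.reflection_reflection _
  norm_map' := E.real.reflection.norm_map

theorem Gr.reflection_apply (E : Gr F m n) (x : EuclideanSpace F (Fin n)) :
    E.reflection x = E.real.starProjection x + E.real.starProjection x - x := by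
  have h : E.real.reflection x = E.real.starProjection x + E.real.starProjection x - x := by
    rw [Submodule.reflection_apply, two_nsmul]
  rw [← h]
  rfl

/-- The unitary group acts transitively on the lines. -/
theorem exists_map_line_eq {u w : EuclideanSpace F (Fin n)} (hu : u ≠ 0) (hw : w ≠ 0) :
    ∃ U : UnitaryGrp F n, Gr.map U (line u hu) = line w hw := by
  set t : ℝ := ‖w‖ / ‖u‖ with ht
  have hun := norm_pos_iff.2 hu
  have hwn := norm_pos_iff.2 hw
  have ht0 : 0 < t := div_pos hwn hun
  -- After scaling and rotating within its line, `u` becomes `x` with `‖x‖ = ‖w‖` and projection `β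
  -- • w`, where `β ≥ 0`. The reflection in the line of `x + w` then exchanges `x` and `w`.
  obtain ⟨a, ha, β, hβ, hP⟩ := exists_op_smul_starProjection (u := t • u) hw
  set x := MulOpposite.op a • t • u with hx
  have hxn : ‖x‖ = ‖w‖ := by
    rw [hx, norm_rsmul, ha, one_mul, norm_smul, Real.norm_of_nonneg ht0.le, ht]
    field_simp
  have hx0 : x ≠ 0 := norm_pos_iff.1 (hxn ▸ hwn)
  have hxu : line x hx0 = line u hu := by
    have e : x = MulOpposite.op (t • a) • u := by
      rw [op_real_smul, hx, op_smul_real_smul]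
    have := line_op_smul hu (a := t • a) (e ▸ hx0)
    rw [← this]
    congr 1
  have hself : ∀ z ∈ (line w hw).real, ∀ y, ⟪z, y⟫ = ⟪z, (line w hw).real.starProjection y⟫ := by
    intro z hz y
    rw [← Submodule.inner_starProjection_left_eq_right, Submodule.starProjection_eq_self_iff.2 hz]
  have hsum : x + w ≠ 0 := by
    intro h
    have h1 : ⟪w, x + w⟫ = 0 := by rw [h, inner_zero_right]
    rw [inner_add_right, hself w (mem_line_self w hw) x, hP, real_inner_smul_right,
      real_inner_self_eq_norm_sq] at h1
    nlinarith [sq_nonneg ‖w‖, pow_pos hwn 2, mul_nonneg hβ (sq_nonneg ‖w‖)]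
  -- The vector `x - w` is orthogonal to all of `(x + w) · F`: the squared norms agree, and the
  -- mixed terms agree because `β` is real.
  have hproj : (line (x + w) hsum).real.starProjection x = (1 / 2 : ℝ) • (x + w) := by
    refine Submodule.eq_starProjection_of_mem_of_inner_eq_zero
      (Submodule.smul_mem _ _ (mem_line_self _ _)) fun z hz => ?_
    obtain ⟨c, rfl⟩ := (mem_line_iff hsum).1 hz
    have e1 : x - (1 / 2 : ℝ) • (x + w) = (1 / 2 : ℝ) • (x - w) := sub_half_smul_add x w
    rw [e1, real_inner_smul_left, smul_add, inner_sub_left, inner_add_right, inner_add_right]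
    have s1 : ∀ y : EuclideanSpace F (Fin n), ⟪y, MulOpposite.op c • y⟫ =
        ‖y‖ ^ 2 * ⟪(1 : F), c⟫ := by
      intro y
      rw [← inner_rsmul, MulOpposite.op_one, one_smul]
    have hwc : MulOpposite.op c • w ∈ (line w hw).real := (line w hw).op_smul_mem c
      (mem_line_self w hw)
    have s2 : ⟪x, MulOpposite.op c • w⟫ = β * ⟪w, MulOpposite.op c • w⟫ := by
      rw [real_inner_comm, hself _ hwc, hP, real_inner_smul_right, real_inner_comm]
    have s3 : ⟪w, MulOpposite.op c • x⟫ = β * ⟪w, MulOpposite.op c • w⟫ := by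
      rw [hself w (mem_line_self w hw), Gr.starProjection_op_smul, hP, op_smul_real_smul,
        real_inner_smul_right]
    rw [s1 x, s1 w, s2, s3, hxn, s1 w]
    ring
  refine ⟨(line (x + w) hsum).reflection, ?_⟩
  rw [← hxu]
  refine Subtype.ext ?_
  have hU : (line (x + w) hsum).reflection x = w := by
    rw [Gr.reflection_apply, hproj, half_smul_add_add_half_smul_add_sub]
  simp only [Gr.map, line, Submodule.map_span, image_singleton]
  congr 2

section Haar

theorem Gr.isInducing_starProjection :
    IsInducing fun E : Gr F m n => E.real.starProjection := ⟨rfl⟩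

instance Gr.secondCountableTopology : SecondCountableTopology (Gr F m n) :=
  Gr.isInducing_starProjection.secondCountableTopology

theorem Gr.dist_map (U : UnitaryGrp F n) (E E' : Gr F m n) :
    dist (Gr.map U E).real.starProjection (Gr.map U E').real.starProjection =
      dist E.real.starProjection E'.real.starProjection := by
  rw [dist_eq_norm, dist_eq_norm, Gr.starProjection_map, Gr.starProjection_map,
    ← ContinuousLinearMap.comp_sub, ← ContinuousLinearMap.sub_comp]
  refine (LinearIsometry.norm_toContinuousLinearMap_comp
    (UnitaryGrp.real U).toLinearIsometry).trans ?_
  exact ContinuousLinearMap.opNorm_comp_linearIsometryEquiv _ (UnitaryGrp.real U).symm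

/-- The Haar probability measure on the Grassmannian of lines is unique. -/
theorem IsHaarProbability.unique {μ ν : Measure (Gr F 1 n)} (hμ : IsHaarProbability μ)
    (hν : IsHaarProbability ν) : μ = ν := by
  have := hμ.isProbabilityMeasure
  have := hν.isProbabilityMeasure
  -- Unitary maps act transitively on lines and isometrically for the norm distance of projections,
  -- so all balls of radius `r` have the same measure.
  have key : ∀ {μ : Measure (Gr F 1 n)}, IsHaarProbability μ → ∀ (r : ℝ) (E E₁ : Gr F 1 n),
      μ {E' | dist E'.real.starProjection E.real.starProjection < r} =
        μ {E' | dist E'.real.starProjection E₁.real.starProjection < r} := by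
    intro μ hμ r E E₁
    obtain ⟨u, hu, rfl⟩ := E.exists_eq_line
    obtain ⟨w, hw, rfl⟩ := E₁.exists_eq_line
    obtain ⟨U, hU⟩ := exists_map_line_eq hu hw
    have hopen : IsOpen {E' : Gr F 1 n |
        dist E'.real.starProjection (line w hw).real.starProjection < r} :=
      isOpen_lt (Gr.isInducing_starProjection.continuous.dist continuous_const) continuous_const
    rw [← (hμ.invariant U).measure_preimage hopen.measurableSet.nullMeasurableSet]
    congr 1
    ext E'
    rw [mem_preimage, mem_ofPred_eq, mem_ofPred_eq, ← hU, Gr.dist_map]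
  have hne : Nonempty (Gr F 1 n) := by
    by_contra h
    rw [not_nonempty_iff] at h
    have : μ univ = 0 := by rw [univ_eq_empty_iff.2 h, measure_empty]
    simp at this
  exact eq_of_uniformlyDistributed Gr.isInducing_starProjection
    (c := fun r => μ {E' | dist E'.real.starProjection hne.some.real.starProjection < r})
    (d := fun r => ν {E' | dist E'.real.starProjection hne.some.real.starProjection < r})
    (fun E r => key hμ r E _) (fun E r => key hν r E _)

end Haar

end FLutwak

end

/-! ### Projections onto lines and the integral of their volumes -/

noncomputable section

namespace FLutwak

set_option linter.unusedSectionVars false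

open Set Filter Topology Module ConvexSym
open scoped ENNReal RealInnerProductSpace

variable {F : Type} [NormedDivisionRing F] [InnerProductSpace ℝ F] [SMulCommClass ℝ F F]
  [FiniteDimensional ℝ F] {n : ℕ}

section Dimension

theorem kappa_pos (k : ℕ) : 0 < kappa k :=
  div_pos (Real.rpow_pos_of_pos Real.pi_pos _) (Real.Gamma_pos_of_pos (by positivity))

instance isAddHaarMeasure_euclVol {V : Type*} [NormedAddCommGroup V] [InnerProductSpace ℝ V]
    [FiniteDimensional ℝ V] [MeasurableSpace V] [BorelSpace V] : (euclVol V).IsAddHaarMeasure :=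
  inferInstanceAs (volume : Measure V).IsAddHaarMeasure

theorem euclVol_closedBall {V : Type*} [NormedAddCommGroup V] [InnerProductSpace ℝ V]
    [FiniteDimensional ℝ V] [MeasurableSpace V] [BorelSpace V] [Nontrivial V] {r : ℝ}
    (hr : 0 ≤ r) :
    (euclVol V).real (Metric.closedBall 0 r) = kappa (finrank ℝ V) * r ^ finrank ℝ V := by
  have h := InnerProductSpace.volume_closedBall (0 : V) r
  rw [measureReal_def, euclVol, h, ENNReal.toReal_mul, ENNReal.toReal_pow,
    ENNReal.toReal_ofReal hr, ENNReal.toReal_ofReal, mul_comm, kappa, Real.sqrt_eq_rpow,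
    ← Real.rpow_mul_natCast Real.pi_pos.le]
  · congr 3
    ring
  · have := Real.Gamma_pos_of_pos (s := (finrank ℝ V : ℝ) / 2 + 1) (by positivity)
    positivity

theorem finrank_euclideanSpace : finrank ℝ (EuclideanSpace F (Fin n)) = n * finrank ℝ F := by
  rw [(WithLp.linearEquiv 2 ℝ (Fin n → F)).finrank_eq, finrank_pi_fintype]
  simp

theorem finrank_line {v : EuclideanSpace F (Fin n)} (hv : v ≠ 0) :
    finrank ℝ (line v hv).real = finrank ℝ F := by
  let T : F →ₗ[ℝ] EuclideanSpace F (Fin n) :=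
    { toFun := fun b => MulOpposite.op b • v
      map_add' := fun a b => by rw [MulOpposite.op_add, add_smul]
      map_smul' := fun r b => op_real_smul r b v }
  have hT : (line v hv).real = LinearMap.range T := by
    ext x
    rw [mem_line_iff, LinearMap.mem_range]
    exact exists_congr fun b => eq_comm
  rw [hT, LinearMap.finrank_range_of_inj]
  refine (injective_iff_map_eq_zero T).2 fun b hb => ?_
  have h : ‖MulOpposite.op b • v‖ = 0 := by rw [show MulOpposite.op b • v = 0 from hb, norm_zero]
  rw [norm_rsmul, mul_eq_zero] at h
  exact norm_eq_zero.1 (h.resolve_right (norm_ne_zero_iff.2 hv))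

theorem Gr.finrank_real (E : Gr F 1 n) : finrank ℝ E.real = finrank ℝ F := by
  obtain ⟨v, hv, rfl⟩ := E.exists_eq_line
  exact finrank_line hv

theorem Gr.nontrivial_real (E : Gr F 1 n) : Nontrivial E.real := by
  obtain ⟨v, hv, rfl⟩ := E.exists_eq_line
  exact ⟨⟨v, mem_line_self v hv⟩, 0, fun h => hv (congrArg Subtype.val h)⟩

end Dimension

section Projection

variable {K : Set (EuclideanSpace F (Fin n))}

theorem UnitScalarInvariant.op_smul_mem (h : UnitScalarInvariant K) {a : F} (ha : ‖a‖ = 1)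
    {x : EuclideanSpace F (Fin n)} (hx : x ∈ K) : MulOpposite.op a • x ∈ K := by
  rw [← h a ha]
  exact mem_image_of_mem _ hx

theorem UnitScalarInvariant.isSymBody (h : UnitScalarInvariant K) (hc : Convex ℝ K)
    (hK : IsCompact K) (hi : (interior K).Nonempty) : IsSymBody K := by
  refine IsSymBody.of_interior_nonempty hc hK (fun x hx => ?_) hi
  have := h.op_smul_mem (a := -1) (by rw [norm_neg, norm_one]) hx
  rwa [MulOpposite.op_neg, MulOpposite.op_one, neg_smul, one_smul] at this

/-- Rotating `x` by a unit scalar keeps it in `K` and aligns its projection with `v`; then `‖P x‖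
‖v‖` is an inner product with `v`, which the support function bounds. -/
theorem norm_starProjection_mul_le (hK : IsSymBody K) (h : UnitScalarInvariant K)
    {v : EuclideanSpace F (Fin n)} (hv : v ≠ 0) {x : EuclideanSpace F (Fin n)} (hx : x ∈ K) :
    ‖(line v hv).real.starProjection x‖ * ‖v‖ ≤ gauge (innerPolar K) v := by
  obtain ⟨a, ha, β, hβ, hP⟩ := exists_op_smul_starProjection (u := x) hv
  have h1 := (gauge_innerPolar hK v).1 _ (h.op_smul_mem ha hx)
  have h2 : ⟪MulOpposite.op a • x, v⟫ = β * ‖v‖ ^ 2 := by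
    rw [← Submodule.starProjection_eq_self_iff.2 (mem_line_self v hv),
      ← Submodule.inner_starProjection_left_eq_right, hP, real_inner_smul_left,
      real_inner_self_eq_norm_sq,
      Submodule.starProjection_eq_self_iff.2 (mem_line_self v hv)]
  have h3 : ‖(line v hv).real.starProjection x‖ = β * ‖v‖ := by
    rw [← one_mul ‖_‖, ← ha, ← norm_rsmul, ← Gr.starProjection_op_smul, hP, norm_smul,
      Real.norm_of_nonneg hβ]
  rw [h3]
  nlinarith

theorem exists_gauge_le_norm_starProjection_mul (hK : IsSymBody K)
    {v : EuclideanSpace F (Fin n)} (hv : v ≠ 0) :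
    ∃ x ∈ K, gauge (innerPolar K) v ≤ ‖(line v hv).real.starProjection x‖ * ‖v‖ := by
  obtain ⟨x, hx, hxv⟩ := (gauge_innerPolar hK v).2
  refine ⟨x, hx, ?_⟩
  rw [← hxv]
  have : ⟪x, v⟫ = ⟪(line v hv).real.starProjection x, v⟫ := by
    rw [Submodule.inner_starProjection_left_eq_right,
      Submodule.starProjection_eq_self_iff.2 (mem_line_self v hv)]
  rw [this]
  exact real_inner_le_norm _ _

theorem Gr.coe_proj (E : Gr F 1 n) (x : EuclideanSpace F (Fin n)) :
    (E.proj x : EuclideanSpace F (Fin n)) = E.real.starProjection x := rfl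

theorem proj_image_line (hK : IsSymBody K) (h : UnitScalarInvariant K)
    {v : EuclideanSpace F (Fin n)} (hv : v ≠ 0) :
    (line v hv).proj '' K = Metric.closedBall 0 (gauge (innerPolar K) v / ‖v‖) := by
  have hvn := norm_pos_iff.2 hv
  refine Subset.antisymm ?_ fun y hy => ?_
  · rintro _ ⟨x, hx, rfl⟩
    rw [mem_closedBall_zero_iff, Submodule.coe_norm, Gr.coe_proj, le_div_iff₀ hvn]
    exact norm_starProjection_mul_le hK h hv hx
  · rw [mem_closedBall_zero_iff, Submodule.coe_norm, le_div_iff₀ hvn] at hy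
    obtain ⟨x, hx, hxg⟩ := exists_gauge_le_norm_starProjection_mul hK hv
    obtain ⟨a, ha, β, hβ, hP⟩ := exists_op_smul_starProjection (u := x) hv
    obtain ⟨c, hc⟩ := (mem_line_iff hv).1 y.2
    have h3 : ‖(line v hv).real.starProjection x‖ = β * ‖v‖ := by
      rw [← one_mul ‖_‖, ← ha, ← norm_rsmul, ← Gr.starProjection_op_smul, hP, norm_smul,
        Real.norm_of_nonneg hβ]
    rw [h3] at hxg
    rw [hc, norm_rsmul] at hy
    have hcβ : ‖c‖ ≤ β := by
      have := le_of_mul_le_mul_right (hy.trans hxg) hvn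
      exact le_of_mul_le_mul_right this hvn
    by_cases hc0 : c = 0
    · refine ⟨0, hK.zero_mem, Subtype.ext ?_⟩
      rw [hc, hc0, map_zero]
      simp
    · have hcn := norm_pos_iff.2 hc0
      have hβ0 := hcn.trans_le hcβ
      -- The point `x · a` projects to `β • v`; rotation by the unit scalar `c / ‖c‖` and shrinking
      -- by `‖c‖ / β ≤ 1` keep it in `K` and move its projection to `v · c`.
      refine ⟨(‖c‖ / β) • MulOpposite.op (‖c‖⁻¹ • c) • MulOpposite.op a • x, ?_, ?_⟩
      · refine hK.smul_mem (h.op_smul_mem ?_ (h.op_smul_mem ha hx)) ?_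
        · rw [norm_smul, norm_inv, norm_norm, inv_mul_cancel₀ hcn.ne']
        · rw [abs_of_nonneg (by positivity)]
          exact (div_le_one hβ0).2 hcβ
      · refine Subtype.ext ?_
        rw [Gr.coe_proj, map_smul, Gr.starProjection_op_smul, hP, hc, op_real_smul,
          op_smul_real_smul, smul_smul, smul_smul]
        have : ‖c‖ / β * ‖c‖⁻¹ * β = 1 := by field_simp
        rw [this, one_smul]

variable [MeasurableSpace F] [BorelSpace F]

theorem projVol_line (hK : IsSymBody K) (h : UnitScalarInvariant K)
    {v : EuclideanSpace F (Fin n)} (hv : v ≠ 0) :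
    projVol K (line v hv) =
      kappa (finrank ℝ F) * (gauge (innerPolar K) v / ‖v‖) ^ finrank ℝ F := by
  have := (line v hv).nontrivial_real
  rw [projVol, proj_image_line hK h hv,
    euclVol_closedBall (div_nonneg (gauge_nonneg _) (norm_nonneg _)), Gr.finrank_real]

/-- The radius of the ball to which a body projects on a line. -/
def lineRadius (K : Set (EuclideanSpace F (Fin n))) (E : Gr F 1 n) : ℝ :=
  gauge (innerPolar K) E.exists_eq_line.choose / ‖E.exists_eq_line.choose‖

theorem projVol_eq_lineRadius (hK : IsSymBody K) (h : UnitScalarInvariant K) (E : Gr F 1 n) :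
    projVol K E = kappa (finrank ℝ F) * lineRadius K E ^ finrank ℝ F := by
  obtain ⟨hv, hE⟩ := E.exists_eq_line.choose_spec
  conv_lhs => rw [hE]
  exact projVol_line hK h hv

/-- Frees the radius from the chosen spanning vector: sublevel sets become intersections of closed
conditions on the projection, whence measurability. -/
theorem lineRadius_le_iff (hK : IsSymBody K) (h : UnitScalarInvariant K) (E : Gr F 1 n) (c : ℝ) :
    lineRadius K E ≤ c ↔ ∀ x ∈ K, ‖E.real.starProjection x‖ ≤ c := by
  obtain ⟨hv, hE⟩ := E.exists_eq_line.choose_spec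
  have hvn := norm_pos_iff.2 hv
  have e : ∀ x, E.real.starProjection x =
      (line E.exists_eq_line.choose hv).real.starProjection x := fun x => by
    conv_lhs => rw [hE]
  simp only [e]
  rw [lineRadius, div_le_iff₀ hvn]
  refine ⟨fun hc x hx => ?_, fun hc => ?_⟩
  · exact le_of_mul_le_mul_right ((norm_starProjection_mul_le hK h hv hx).trans hc) hvn
  · obtain ⟨x, hx, hxg⟩ := exists_gauge_le_norm_starProjection_mul hK hv
    exact hxg.trans (mul_le_mul_of_nonneg_right (hc x hx) hvn.le)

theorem measurable_lineRadius (hK : IsSymBody K) (h : UnitScalarInvariant K) :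
    Measurable (lineRadius K) := by
  refine measurable_of_Iic fun c => ?_
  have : lineRadius K ⁻¹' Iic c = ⋂ x ∈ K, {E : Gr F 1 n | ‖E.real.starProjection x‖ ≤ c} := by
    ext E
    simp only [mem_preimage, mem_Iic, mem_iInter, mem_ofPred_eq]
    exact lineRadius_le_iff hK h E c
  rw [this]
  refine (isClosed_biInter fun x _ => isClosed_le ?_ continuous_const).measurableSet
  exact (Gr.isInducing_starProjection.continuous.clm_apply continuous_const).norm

/-- A ball inside `K` bounds the support function from below; this uniform bound makes the negative
powers of `|P_E K|` bounded and hence integrable. -/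
theorem exists_le_lineRadius (hK : IsSymBody K) :
    ∃ ε > 0, ∀ E : Gr F 1 n, ε ≤ lineRadius K E := by
  obtain ⟨ε, hε, hεK⟩ := hK.exists_closedBall_subset
  refine ⟨ε, hε, fun E => ?_⟩
  obtain ⟨hv, hE⟩ := E.exists_eq_line.choose_spec
  set v := E.exists_eq_line.choose
  have hvn := norm_pos_iff.2 hv
  rw [lineRadius, le_div_iff₀ hvn]
  have := (gauge_innerPolar hK v).1 ((ε / ‖v‖) • v) (hεK (by
    rw [mem_closedBall_zero_iff, norm_smul, norm_div, norm_norm, Real.norm_of_nonneg hε.le,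
      div_mul_cancel₀ _ hvn.ne']))
  rw [real_inner_smul_left, real_inner_self_eq_norm_sq] at this
  calc ε * ‖v‖ = ε / ‖v‖ * ‖v‖ ^ 2 := by field_simp
    _ ≤ _ := this

theorem integrable_projVol_zpow (hK : IsSymBody K) (h : UnitScalarInvariant K)
    (μ : Measure (Gr F 1 n)) [IsFiniteMeasure μ] (k : ℕ) :
    Integrable (fun E : Gr F 1 n => projVol K E ^ (-(k : ℤ))) μ := by
  obtain ⟨ε, hε, hr⟩ := exists_le_lineRadius hK
  have hκ := kappa_pos (finrank ℝ F)
  simp only [projVol_eq_lineRadius hK h, zpow_neg, zpow_natCast]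
  refine Integrable.of_bound (C := ((kappa (finrank ℝ F) * ε ^ finrank ℝ F) ^ k)⁻¹) ?_ (ae_of_all _ fun E => ?_)
  · exact ((((measurable_lineRadius hK h).pow_const _).const_mul _).pow_const _).inv.aestronglyMeasurable
  · have := hε.trans_le (hr E)
    rw [Real.norm_of_nonneg (by positivity)]
    have := hr E
    gcongr

end Projection

section Haar

variable [MeasurableSpace F] [BorelSpace F]

/-- The line spanned by a random point of the unit ball is distributed according to the Haar
probability measure. -/
theorem isHaarProbability_map_lineMap (E₀ : Gr F 1 n) :
    IsHaarProbability ((ProbabilityTheory.cond (euclVol (EuclideanSpace F (Fin n)))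
      (Metric.ball 0 1)).map (lineMap E₀)) := by
  obtain ⟨v₀, hv₀, -⟩ := E₀.exists_eq_line
  have : Nontrivial (EuclideanSpace F (Fin n)) := ⟨v₀, 0, hv₀⟩
  let vl := euclVol (EuclideanSpace F (Fin n))
  have hb : vl (Metric.ball 0 1) ≠ 0 := (Metric.measure_ball_pos _ _ one_pos).ne'
  let ν := ProbabilityTheory.cond vl (Metric.ball 0 1)
  have hν : IsProbabilityMeasure ν := ProbabilityTheory.cond_isProbabilityMeasure_of_finite hb
    measure_ball_lt_top.ne
  have hm := measurable_lineMap E₀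
  refine ⟨@Measure.isProbabilityMeasure_map _ _ _ _ ν hν _ hm.aemeasurable, fun U => ?_⟩
  have hU : MeasurePreserving U ν ν := by
    have h0 : MeasurePreserving U vl vl := (UnitaryGrp.real U).measurePreserving
    have h1 := h0.restrict_preimage (s := Metric.ball 0 1) Metric.isOpen_ball.measurableSet
    have h2 : U ⁻¹' (Metric.ball 0 1) = Metric.ball 0 1 := by ext; simp
    rw [h2] at h1
    exact h1.smul_measure _
  have hcont : Continuous (Gr.map (m := 1) U) := by
    rw [continuous_induced_rng]
    have : (fun E : Gr F 1 n => E.real.starProjection) ∘ Gr.map U = fun E =>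
        ((UnitaryGrp.real U).toContinuousLinearEquiv : _ →L[ℝ] _) ∘L E.real.starProjection ∘L
          ((UnitaryGrp.real U).symm.toContinuousLinearEquiv : _ →L[ℝ] _) :=
      funext (Gr.starProjection_map U)
    rw [this]
    have hc : Continuous (fun E : Gr F 1 n => E.real.starProjection) := continuous_induced_dom
    fun_prop
  refine ⟨hcont.measurable, ?_⟩
  change ((ν.map (lineMap E₀)).map (Gr.map U)) = ν.map (lineMap E₀)
  rw [Measure.map_map hcont.measurable hm]
  conv_rhs => rw [← hU.map_eq]
  rw [Measure.map_map hm hU.measurable]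
  refine Measure.map_congr ?_
  have hac : ν ≪ vl := ProbabilityTheory.cond_absolutelyContinuous
  have : ∀ᵐ v ∂ν, v ≠ 0 := hac.ae_le (Measure.ae_ne vl 0)
  filter_upwards [this] with v hv
  have hv2 : U v ≠ 0 := by simpa using hv
  simp only [Function.comp, lineMap, hv, hv2, ne_eq, not_false_eq_true, dite_true]
  apply Subtype.ext
  simp [Gr.map, line, Submodule.map_span]

/-- By uniqueness the Haar measure may be replaced by the law of the line through a uniform point
`v` of the unit ball. The integrand becomes `κ_p^{-n} (‖v‖ / h(v))^{np}`, whose integral over the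
ball is `κ_p^{-n} |K°|`; the remaining constant normalizes the uniform law. -/
theorem integral_projVol_zpow {μ : Measure (Gr F 1 n)} (hμ : IsHaarProbability μ)
    {K : Set (EuclideanSpace F (Fin n))} (hn : 1 ≤ n) (hK : IsSymBody K)
    (h : UnitScalarInvariant K) :
    ∫ E, projVol K E ^ (-(n : ℤ)) ∂μ =
      (kappa (finrank ℝ F) ^ n * kappa (n * finrank ℝ F))⁻¹ * vol (innerPolar K) := by
  have : NeZero n := ⟨by omega⟩
  have he : (WithLp.toLp 2 (fun _ => 1) : EuclideanSpace F (Fin n)) ≠ 0 := fun h => by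
    simpa using congrArg (fun v : EuclideanSpace F (Fin n) => v 0) h
  have : Nontrivial (EuclideanSpace F (Fin n)) := ⟨_, _, he⟩
  have hpr := hμ.isProbabilityMeasure
  have hint := integrable_projVol_zpow hK h μ n
  set p := finrank ℝ F with hp
  set C := innerPolar K with hC
  have hCb : IsSymBody C := innerPolar_isSymBody hK
  have hcont : Continuous (gauge C) := continuous_gauge hCb.convex hCb.mem_nhds
  have hball : (euclVol (EuclideanSpace F (Fin n))).real (Metric.ball 0 1) = kappa (n * p) := by
    have := euclVol_closedBall (V := EuclideanSpace F (Fin n)) zero_le_one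
    rw [one_pow, mul_one, finrank_euclideanSpace] at this
    rw [← this, measureReal_def, measureReal_def]
    congr 1
    exact (Measure.addHaar_closedBall_eq_addHaar_ball volume (0 : EuclideanSpace F (Fin n)) 1).symm
  have hvolC : vol C = ∫ v in Metric.ball 0 1, (‖v‖ / gauge C v) ^ (n * p)
      ∂(euclVol (EuclideanSpace F (Fin n))) := by
    rw [integral_eq_lintegral_of_nonneg_ae, vol, measureReal_def,
      volume_eq_lintegral_gauge _ hCb, finrank_euclideanSpace]
    · exact ae_of_all _ fun v => pow_nonneg (div_nonneg (norm_nonneg _) (gauge_nonneg _)) _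
    · exact ((measurable_norm.div hcont.measurable).pow_const _).aestronglyMeasurable
  rw [hμ.unique (isHaarProbability_map_lineMap (line _ he))] at hint ⊢
  rw [integral_map (measurable_lineMap _).aemeasurable hint.1, hvolC, ProbabilityTheory.cond,
    integral_smul_measure, ← integral_const_mul, ENNReal.toReal_inv, ← measureReal_def, hball,
    smul_eq_mul, ← integral_const_mul]
  refine integral_congr_ae ?_
  have hne : ∀ᵐ v ∂((volume : Measure (EuclideanSpace F (Fin n))).restrict (Metric.ball 0 1)),
      v ≠ 0 := ae_restrict_of_ae (Measure.ae_ne _ 0)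
  filter_upwards [hne] with v hv
  simp only [lineMap, dif_pos hv]
  rw [projVol_line hK h hv, zpow_neg, zpow_natCast, mul_pow, mul_inv, mul_inv, ← pow_mul,
    ← hp, ← hC, mul_comm p n, ← inv_pow _ (n * p), inv_div]
  ring

end Haar

end FLutwak

end

/-! ### `F`-ellipsoids and the conclusion -/

noncomputable section

namespace FLutwak

set_option linter.unusedSectionVars false

open Set Filter Topology Module ConvexSym Polynomial
open scoped ENNReal RealInnerProductSpace

section Normalization

variable {V : Type*} [NormedAddCommGroup V] [InnerProductSpace ℝ V] [FiniteDimensional ℝ V]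

/-- A linear automorphism becomes an isometry when it is composed with the inverse of its absolute
value, and this is a polynomial in `e† e`. -/
theorem exists_aeval_adjoint_comp_isometry (e : V ≃ₗ[ℝ] V) :
    ∃ P : ℝ[X], ∀ x, ‖e (aeval (LinearMap.adjoint e.toLinearMap ∘ₗ e.toLinearMap) P x)‖ = ‖x‖ := by
  classical
  set A : V →ₗ[ℝ] V := LinearMap.adjoint e.toLinearMap ∘ₗ e.toLinearMap with hA
  have hAi : ∀ x y, ⟪A x, y⟫ = ⟪e x, e y⟫ := fun x y => by
    rw [hA, LinearMap.comp_apply, LinearMap.adjoint_inner_left]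
    rfl
  have hsymm : A.IsSymmetric := fun x y => by
    rw [hAi, real_inner_comm, ← hAi, real_inner_comm]
  set b := hsymm.eigenvectorBasis rfl with hb
  set l := hsymm.eigenvalues rfl with hl
  have hAb : ∀ i, A (b i) = l i • b i := fun i => hsymm.apply_eigenvectorBasis rfl i
  have hlpos : ∀ i, 0 < l i := fun i => by
    have h1 := hAi (b i) (b i)
    rw [hAb, real_inner_smul_left, real_inner_self_eq_norm_sq, b.norm_eq_one,
      real_inner_self_eq_norm_sq, one_pow, mul_one] at h1
    rw [h1]
    have : e (b i) ≠ 0 := fun h => b.orthonormal.ne_zero i (e.map_eq_zero_iff.1 h)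
    positivity
  -- `P` interpolates `t ↦ 1 / √t` at the eigenvalues of `e† e`, so `P(e† e)` is its inverse square
  -- root.
  let P : ℝ[X] := Lagrange.interpolate (Finset.univ.image l) id fun t => (√t)⁻¹
  have hP : ∀ i, P.eval (l i) = (√(l i))⁻¹ := fun i =>
    Lagrange.eval_interpolate_at_node (v := id) _ (fun _ _ _ _ h => h)
      (Finset.mem_image_of_mem l (Finset.mem_univ i))
  refine ⟨P, ?_⟩
  set T := aeval A P with hT
  have hTb : ∀ i, T (b i) = (√(l i))⁻¹ • b i := fun i => by
    rw [hT, Module.End.aeval_apply_of_hasEigenvector (μ := l i), hP]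
    exact ⟨Module.End.mem_eigenspace_iff.2 (hAb i), b.orthonormal.ne_zero i⟩
  have horth : Orthonormal ℝ ((e.toLinearMap ∘ₗ T) ∘ b.toBasis) := by
    rw [orthonormal_iff_ite]
    intro i j
    simp only [Function.comp_apply, LinearMap.comp_apply, OrthonormalBasis.coe_toBasis,
      LinearEquiv.coe_coe]
    rw [← hAi, hTb, hTb, map_smul, hAb, real_inner_smul_left, real_inner_smul_left,
      real_inner_smul_right, orthonormal_iff_ite.1 b.orthonormal i j]
    split_ifs with hij
    · subst hij
      have := Real.mul_self_sqrt (hlpos i).le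
      have h0 := Real.sqrt_pos.2 (hlpos i)
      field_simp
      nlinarith
    · simp
  intro x
  exact ((e.toLinearMap ∘ₗ T).isometryOfOrthonormal (v := b.toBasis) (by
    rw [b.coe_toBasis]; exact b.orthonormal) horth).norm_map x

end Normalization

variable {F : Type} [NormedDivisionRing F] [InnerProductSpace ℝ F] [SMulCommClass ℝ F F]
  [FiniteDimensional ℝ F] {n : ℕ} {K : Set (EuclideanSpace F (Fin n))}

/-- Unit scalars cannot increase `‖e x‖`, the gauge of the body; applied to the inverse scalar as
well, this gives equality, and real homogeneity covers all other scalars. -/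
theorem norm_equiv_op_smul {e : EuclideanSpace F (Fin n) ≃ₗ[ℝ] EuclideanSpace F (Fin n)}
    (h : UnitScalarInvariant {x | ‖e x‖ ≤ 1}) (a : F) (x : EuclideanSpace F (Fin n)) :
    ‖e (MulOpposite.op a • x)‖ = ‖a‖ * ‖e x‖ := by
  have key : ∀ {a : F}, ‖a‖ = 1 → ∀ x, ‖e (MulOpposite.op a • x)‖ ≤ ‖e x‖ := by
    intro a ha x
    by_cases hx : e x = 0
    · have := e.map_eq_zero_iff.1 hx
      simp [this]
    have hxn := norm_pos_iff.2 hx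
    have h1 : ‖e (MulOpposite.op a • ‖e x‖⁻¹ • x)‖ ≤ 1 :=
      h.op_smul_mem ha (show ‖e (‖e x‖⁻¹ • x)‖ ≤ 1 by
        rw [map_smul, norm_smul, norm_inv, norm_norm, inv_mul_cancel₀ hxn.ne'])
    rw [op_smul_real_smul, map_smul, norm_smul, norm_inv, norm_norm, inv_mul_le_iff₀ hxn,
      mul_one] at h1
    exact h1
  have key' : ∀ {a : F}, ‖a‖ = 1 → ∀ x, ‖e (MulOpposite.op a • x)‖ = ‖e x‖ := by
    intro a ha x
    refine le_antisymm (key ha x) ?_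
    have ha0 : a ≠ 0 := norm_ne_zero_iff.1 (by rw [ha]; exact one_ne_zero)
    have := key (a := a⁻¹) (by rw [norm_inv, ha, inv_one]) (MulOpposite.op a • x)
    rwa [smul_smul, ← MulOpposite.op_mul, mul_inv_cancel₀ ha0, MulOpposite.op_one,
      one_smul] at this
  by_cases ha : a = 0
  · simp [ha]
  have han := norm_pos_iff.2 ha
  have h1 : a = ‖a‖ • (‖a‖⁻¹ • a) := by rw [smul_smul, mul_inv_cancel₀ han.ne', one_smul]
  conv_lhs => rw [h1]
  rw [op_real_smul, map_smul, norm_smul, norm_norm, key']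
  rw [norm_smul, norm_inv, norm_norm, inv_mul_cancel₀ han.ne']

/-- The form `⟪e x, e y⟫` and the inner product are both multiplied by `‖a‖ ^ 2` under simultaneous
multiplication by `a`, so the operator `e† e` linking them commutes with `a`. -/
theorem adjoint_comp_op_smul {e : EuclideanSpace F (Fin n) ≃ₗ[ℝ] EuclideanSpace F (Fin n)}
    (h : UnitScalarInvariant {x | ‖e x‖ ≤ 1}) (a : F) (x : EuclideanSpace F (Fin n)) :
    (LinearMap.adjoint e.toLinearMap ∘ₗ e.toLinearMap) (MulOpposite.op a • x) =
      MulOpposite.op a • (LinearMap.adjoint e.toLinearMap ∘ₗ e.toLinearMap) x := by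
  by_cases ha : a = 0
  · simp [ha]
  have hAi : ∀ x y, ⟪(LinearMap.adjoint e.toLinearMap ∘ₗ e.toLinearMap) x, y⟫ = ⟪e x, e y⟫ :=
    fun x y => by
      rw [LinearMap.comp_apply, LinearMap.adjoint_inner_left]
      rfl
  refine ext_inner_right ℝ fun y => ?_
  have hy : y = MulOpposite.op a • MulOpposite.op a⁻¹ • y := by
    rw [smul_smul, ← MulOpposite.op_mul, inv_mul_cancel₀ ha, MulOpposite.op_one, one_smul]
  generalize MulOpposite.op a⁻¹ • y = z at hy
  subst hy
  rw [inner_op_smul, hAi, hAi,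
    real_inner_eq_norm_add_mul_self_sub_norm_mul_self_sub_norm_mul_self_div_two,
    real_inner_eq_norm_add_mul_self_sub_norm_mul_self_sub_norm_mul_self_div_two,
    ← map_add, ← map_add, ← smul_add, norm_equiv_op_smul h, norm_equiv_op_smul h,
    norm_equiv_op_smul h]
  ring

theorem aeval_op_smul {A : EuclideanSpace F (Fin n) →ₗ[ℝ] EuclideanSpace F (Fin n)} {a : F}
    (hA : ∀ x, A (MulOpposite.op a • x) = MulOpposite.op a • A x) (P : ℝ[X]) :
    ∀ x, aeval A P (MulOpposite.op a • x) = MulOpposite.op a • aeval A P x := by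
  induction P using Polynomial.induction_on' with
  | add p q hp hq =>
    intro x
    rw [map_add, LinearMap.add_apply, LinearMap.add_apply, hp, hq, smul_add]
  | monomial k r =>
    intro x
    have hk : ∀ k : ℕ, ∀ x, (A ^ k) (MulOpposite.op a • x) = MulOpposite.op a • (A ^ k) x := by
      intro k
      induction k with
      | zero => exact fun x => rfl
      | succ k ih =>
        intro x
        rw [pow_succ, Module.End.mul_apply, Module.End.mul_apply, hA, ih]
    rw [aeval_monomial, Module.algebraMap_end_eq_smul_id, smul_mul_assoc, LinearMap.smul_apply,
      LinearMap.smul_apply, Module.End.mul_apply, Module.End.mul_apply, hk, LinearMap.id_apply,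
      LinearMap.id_apply, op_smul_real_smul]

/-- The map `e` is only real linear. The map `T = (e† e)^{-1/2}` is `F`-linear as a polynomial in
`e† e`, and `‖e (T z)‖ = ‖z‖` says that it takes the unit ball onto the body. -/
theorem isEllipsoid_of_equiv {e : EuclideanSpace F (Fin n) ≃ₗ[ℝ] EuclideanSpace F (Fin n)}
    (h : UnitScalarInvariant {x | ‖e x‖ ≤ 1}) : IsEllipsoid {x | ‖e x‖ ≤ 1} := by
  obtain ⟨P, hP⟩ := exists_aeval_adjoint_comp_isometry e
  set T := aeval (LinearMap.adjoint e.toLinearMap ∘ₗ e.toLinearMap) P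
  let L : EuclideanSpace F (Fin n) →ₗ[Fᵐᵒᵖ] EuclideanSpace F (Fin n) :=
    { toFun := T
      map_add' := map_add T
      map_smul' := fun c x => by
        obtain ⟨a, rfl⟩ := MulOpposite.op_surjective c
        exact aeval_op_smul (adjoint_comp_op_smul h a) P x }
  have hinj : Function.Injective T := (injective_iff_map_eq_zero T).2 fun x hx => by
    have := hP x
    rw [hx, map_zero, norm_zero] at this
    exact norm_eq_zero.1 this.symm
  have hsurj := LinearMap.surjective_of_injective hinj
  refine ⟨L.toAffineMap, Subset.antisymm (fun x hx => ?_) ?_⟩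
  · obtain ⟨z, rfl⟩ := hsurj x
    refine ⟨z, ?_, rfl⟩
    rw [mem_closedBall_zero_iff, ← hP]
    exact hx
  · rintro _ ⟨z, hz, rfl⟩
    rw [mem_closedBall_zero_iff, ← hP] at hz
    exact hz

/-- An affine map could be singular or have a translation part; the interior of `K` excludes the
former and the symmetry of `K` the latter. -/
theorem IsEllipsoid.exists_equiv (hE : IsEllipsoid K) (hK : IsSymBody K) :
    ∃ e : EuclideanSpace F (Fin n) ≃ₗ[ℝ] EuclideanSpace F (Fin n), K = {x | ‖e x‖ ≤ 1} := by
  obtain ⟨f, hf⟩ := hE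
  set c := f 0 with hc
  let L : EuclideanSpace F (Fin n) →ₗ[ℝ] EuclideanSpace F (Fin n) :=
    { toFun := f.linear
      map_add' := map_add f.linear
      map_smul' := fun r x => by
        have h : ∀ y : EuclideanSpace F (Fin n), r • y = MulOpposite.op (r • (1 : F)) • y :=
          fun y => by rw [op_real_smul, MulOpposite.op_one, one_smul]
        rw [h x, map_smul, RingHom.id_apply, h (f.linear x)] }
  have hfL : ∀ x, f x = L x + c := fun x => by
    have := congrFun f.decomp x
    rw [Pi.add_apply] at this
    exact this
  have hmem : ∀ x, x ∈ K ↔ ∃ z, ‖z‖ ≤ 1 ∧ L z + c = x := fun x => by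
    rw [hf]
    simp only [mem_image, mem_closedBall_zero_iff, hfL]
  -- By symmetry `-c = L z + c` for some `z`, hence `c = L (-z / 2)`.
  have hcR : c ∈ LinearMap.range L := by
    have h1 : c ∈ K := (hmem c).2 ⟨0, by simp, by simp⟩
    obtain ⟨z, -, hz⟩ := (hmem _).1 (hK.neg_mem c h1)
    refine ⟨(-(1 / 2) : ℝ) • z, ?_⟩
    have h2 : L z = -c - c := eq_sub_of_add_eq hz
    rw [map_smul, h2]
    module
  have hKR : K ⊆ LinearMap.range L := fun x hx => by
    obtain ⟨z, -, rfl⟩ := (hmem x).1 hx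
    exact Submodule.add_mem _ ⟨z, rfl⟩ hcR
  have hsurj : Function.Surjective L := LinearMap.range_eq_top.1
    (Submodule.eq_top_of_nonempty_interior' _ ⟨0, interior_mono hKR hK.zero_mem_interior⟩)
  let Le := LinearEquiv.ofBijective L ⟨LinearMap.injective_iff_surjective.2 hsurj, hsurj⟩
  obtain ⟨d, hd⟩ := hsurj c
  have hmem' : ∀ x, L x ∈ K ↔ ‖x - d‖ ≤ 1 := fun x => by
    rw [hmem]
    constructor
    · rintro ⟨z, hz, h⟩
      rw [← hd, ← map_add] at h
      rw [← Le.injective h, add_sub_cancel_right]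
      exact hz
    · exact fun h => ⟨x - d, h, by rw [map_sub, hd, sub_add_cancel]⟩
  have hd0 : d = 0 := by
    by_contra h
    have hdn := norm_pos_iff.2 h
    -- This point lies at distance `1` from the centre `d`, while its negative is at distance `2‖d‖
    -- + 1`.
    have h1 : L ((1 + ‖d‖⁻¹) • d) ∈ K := (hmem' _).2 (by
      rw [add_smul, one_smul, add_sub_cancel_left, norm_smul, norm_inv, norm_norm,
        inv_mul_cancel₀ hdn.ne'])
    have h2 := hK.neg_mem _ h1
    rw [← map_neg, hmem'] at h2
    have h3 : -((1 + ‖d‖⁻¹) • d) - d = (-(2 + ‖d‖⁻¹)) • d := by module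
    rw [h3, norm_smul, norm_neg, Real.norm_of_nonneg (by positivity), add_mul,
      inv_mul_cancel₀ hdn.ne'] at h2
    linarith
  refine ⟨Le.symm, ?_⟩
  ext x
  obtain ⟨z, rfl⟩ := Le.surjective x
  rw [mem_ofPred_eq, LinearEquiv.symm_apply_apply]
  refine (hmem' z).trans ?_
  rw [hd0, sub_zero]

theorem isEllipsoid_iff_exists_equiv (hK : IsSymBody K) (h : UnitScalarInvariant K) :
    IsEllipsoid K ↔ ∃ e : EuclideanSpace F (Fin n) ≃ₗ[ℝ] EuclideanSpace F (Fin n),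
      K = {x | ‖e x‖ ≤ 1} := by
  refine ⟨fun hE => hE.exists_equiv hK, ?_⟩
  rintro ⟨e, rfl⟩
  exact isEllipsoid_of_equiv h

variable [MeasurableSpace F] [BorelSpace F]

/-- After insertion of the integral the right side is `|K°| / κ_{np}²`, so the claim is
Blaschke–Santaló divided by `|K| κ_{np}²`, with the same equality case. The argument is uniform in
`F`; only the real dimension `p` varies. -/
theorem integrable_and_vol_inv_ge (hn : 1 ≤ n) {μ : Measure (Gr F 1 n)}
    (hμ : IsHaarProbability μ) (hc : Convex ℝ K) (hK : IsCompact K)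
    (hi : (interior K).Nonempty) (h : UnitScalarInvariant K) :
    Integrable (fun E : Gr F 1 n => projVol K E ^ (-(n : ℤ))) μ ∧
      (vol K)⁻¹ ≥ kappa (finrank ℝ F) ^ n / kappa (n * finrank ℝ F) *
        ∫ E : Gr F 1 n, projVol K E ^ (-(n : ℤ)) ∂μ ∧
      ((vol K)⁻¹ = kappa (finrank ℝ F) ^ n / kappa (n * finrank ℝ F) *
        ∫ E : Gr F 1 n, projVol K E ^ (-(n : ℤ)) ∂μ ↔ IsEllipsoid K) := by
  have : NeZero n := ⟨by omega⟩
  have he : (WithLp.toLp 2 (fun _ => 1) : EuclideanSpace F (Fin n)) ≠ 0 := fun h => by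
    simpa using congrArg (fun v : EuclideanSpace F (Fin n) => v 0) h
  have : Nontrivial (EuclideanSpace F (Fin n)) := ⟨_, _, he⟩
  have hS := h.isSymBody hc hK hi
  have hS' := innerPolar_isSymBody hS
  have hpr := hμ.isProbabilityMeasure
  refine ⟨integrable_projVol_zpow hS h μ n, ?_⟩
  set p := finrank ℝ F with hp
  have hκp := kappa_pos p
  have hκ := kappa_pos (n * p)
  have hvol : 0 < vol K := by
    refine ENNReal.toReal_pos ?_ hS.isCompact.measure_lt_top.ne
    exact (Measure.measure_pos_of_mem_nhds _ hS.mem_nhds).ne'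
  have hfin' := hS'.isCompact.measure_lt_top (μ := euclVol (EuclideanSpace F (Fin n)))
  have hfin := hS.isCompact.measure_lt_top (μ := euclVol (EuclideanSpace F (Fin n)))
  have hball : (euclVol (EuclideanSpace F (Fin n)) (Metric.closedBall 0 1)) ^ 2 =
      ENNReal.ofReal (kappa (n * p) ^ 2) := by
    have := euclVol_closedBall (V := EuclideanSpace F (Fin n)) zero_le_one
    rw [one_pow, mul_one, finrank_euclideanSpace] at this
    rw [← this, ENNReal.ofReal_pow measureReal_nonneg, measureReal_def, ENNReal.ofReal_toReal]
    exact measure_closedBall_lt_top.ne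
  have hprod : euclVol (EuclideanSpace F (Fin n)) K *
      euclVol (EuclideanSpace F (Fin n)) (innerPolar K) =
        ENNReal.ofReal (vol K * vol (innerPolar K)) := by
    rw [ENNReal.ofReal_mul hvol.le, vol, vol, measureReal_def, measureReal_def,
      ENNReal.ofReal_toReal hfin.ne, ENNReal.ofReal_toReal hfin'.ne]
  have hle : vol K * vol (innerPolar K) ≤ kappa (n * p) ^ 2 := by
    have := volume_mul_volume_innerPolar_le hS
    change euclVol _ _ * euclVol _ _ ≤ euclVol _ _ ^ 2 at this
    rw [hball, hprod] at this
    exact (ENNReal.ofReal_le_ofReal_iff (by positivity)).1 this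
  have heq : vol K * vol (innerPolar K) = kappa (n * p) ^ 2 ↔ IsEllipsoid K := by
    rw [isEllipsoid_iff_exists_equiv hS h, ← volume_mul_volume_innerPolar_eq_iff hS]
    change _ ↔ euclVol _ _ * euclVol _ _ = euclVol _ _ ^ 2
    rw [hball, hprod]
    have h0 : 0 ≤ vol (innerPolar K) := measureReal_nonneg
    exact (ENNReal.ofReal_eq_ofReal_iff (mul_nonneg hvol.le h0) (by positivity)).symm
  have hint : kappa p ^ n / kappa (n * p) * ∫ E : Gr F 1 n, projVol K E ^ (-(n : ℤ)) ∂μ =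
      vol (innerPolar K) / kappa (n * p) ^ 2 := by
    rw [integral_projVol_zpow hμ hn hS h, ← hp]
    field_simp
  rw [hint]
  refine ⟨?_, ?_⟩
  · rw [ge_iff_le, inv_eq_one_div, div_le_div_iff₀ (by positivity) hvol]
    linarith
  · rw [← heq, inv_eq_one_div, div_eq_div_iff hvol.ne' (by positivity), one_mul, mul_comm (vol K),
      eq_comm]

end FLutwak

end

theorem proposition6p2 (n : ℕ) (hn : 1 ≤ n) :
    -- the real case
    (∀ μ : Measure (FLutwak.Gr ℝ 1 n), FLutwak.IsHaarProbability μ →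
      ∀ K : Set (EuclideanSpace ℝ (Fin n)),
        Convex ℝ K → IsCompact K → (interior K).Nonempty → FLutwak.UnitScalarInvariant K →
        Integrable (fun E : FLutwak.Gr ℝ 1 n => FLutwak.projVol K E ^ (-(n : ℤ))) μ ∧
        (FLutwak.vol K)⁻¹ ≥ FLutwak.kappa 1 ^ n / FLutwak.kappa (n * 1) *
            ∫ E : FLutwak.Gr ℝ 1 n, FLutwak.projVol K E ^ (-(n : ℤ)) ∂μ ∧
        ((FLutwak.vol K)⁻¹ = FLutwak.kappa 1 ^ n / FLutwak.kappa (n * 1) *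
            ∫ E : FLutwak.Gr ℝ 1 n, FLutwak.projVol K E ^ (-(n : ℤ)) ∂μ ↔
          FLutwak.IsEllipsoid K)) ∧
    -- the complex case
    (∀ μ : Measure (FLutwak.Gr ℂ 1 n), FLutwak.IsHaarProbability μ →
      ∀ K : Set (EuclideanSpace ℂ (Fin n)),
        Convex ℝ K → IsCompact K → (interior K).Nonempty → FLutwak.UnitScalarInvariant K →
        Integrable (fun E : FLutwak.Gr ℂ 1 n => FLutwak.projVol K E ^ (-(n : ℤ))) μ ∧
        (FLutwak.vol K)⁻¹ ≥ FLutwak.kappa 2 ^ n / FLutwak.kappa (n * 2) *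
            ∫ E : FLutwak.Gr ℂ 1 n, FLutwak.projVol K E ^ (-(n : ℤ)) ∂μ ∧
        ((FLutwak.vol K)⁻¹ = FLutwak.kappa 2 ^ n / FLutwak.kappa (n * 2) *
            ∫ E : FLutwak.Gr ℂ 1 n, FLutwak.projVol K E ^ (-(n : ℤ)) ∂μ ↔
          FLutwak.IsEllipsoid K)) ∧
    -- the quaternionic case
    (∀ μ : Measure (FLutwak.Gr ℍ 1 n), FLutwak.IsHaarProbability μ →
      ∀ K : Set (EuclideanSpace ℍ (Fin n)),
        Convex ℝ K → IsCompact K → (interior K).Nonempty → FLutwak.UnitScalarInvariant K →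
        Integrable (fun E : FLutwak.Gr ℍ 1 n => FLutwak.projVol K E ^ (-(n : ℤ))) μ ∧
        (FLutwak.vol K)⁻¹ ≥ FLutwak.kappa 4 ^ n / FLutwak.kappa (n * 4) *
            ∫ E : FLutwak.Gr ℍ 1 n, FLutwak.projVol K E ^ (-(n : ℤ)) ∂μ ∧
        ((FLutwak.vol K)⁻¹ = FLutwak.kappa 4 ^ n / FLutwak.kappa (n * 4) *
            ∫ E : FLutwak.Gr ℍ 1 n, FLutwak.projVol K E ^ (-(n : ℤ)) ∂μ ↔
          FLutwak.IsEllipsoid K)) := by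
  refine ⟨fun μ hμ K hc hK hi h => ?_, fun μ hμ K hc hK hi h => ?_, fun μ hμ K hc hK hi h => ?_⟩
  · have := FLutwak.integrable_and_vol_inv_ge hn hμ hc hK hi h
    rwa [Module.finrank_self] at this
  · have := FLutwak.integrable_and_vol_inv_ge hn hμ hc hK hi h
    rwa [Complex.finrank_real_complex] at this
  · have := FLutwak.integrable_and_vol_inv_ge hn hμ hc hK hi h
    rwa [Quaternion.finrank_eq_four] at this
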